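/- **Setting.** Let $M$ be a smooth finite-dimensional manifold and $\mathbb{T}M=TM\oplus T^*M$, with the fibrewise pairing $\langle v_1\oplus\alpha_1,v_2\oplus\alpha_2\rangle=\alpha_1(v_2)+\alpha_2(v_1)$ and the Clifford action $\varrho(v\oplus\alpha)\phi=\iota(v)\phi+\alpha\wedge\phi$ on differential forms $\phi\in\Omega(M)$ of mixed degree. A *Dirac structure* relative to a closed 3-form $\eta\in\Omega^3(M)$ is a smooth Lagrangian subbundle $E\subset\mathbb{T}M$ (that is, $E=E^\perp$) that is integrable: for every smooth pure spinor $\phi$ on an open set with $\{w\mid\varrho(w)\phi=0\}=E$ there, one has $\varrho(w_0)\varrho(w_1)\varrho(w_2)\,(\mathrm d+\eta)\phi=0$ for all $w_0,w_1,w_2\in E$. Let $\operatorname{ran}(E)\subset TM$ be the projection of $E$ to $TM$. **(a)** Let $E$ be a Dirac structure on $M$ relative to the closed 3-form $\eta$. Let $\iota_S\colon S\to M$ be a leaf of the generalized foliation defined by $\operatorname{ran}(E)$, or, more generally, any smooth immersion of a manifold $S$ with $\mathrm d\iota_S(T_sS)=\operatorname{ran}(E)_{\iota_S(s)}$ for all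 $s\in S$. Then there is a unique 2-form $\omega_S$ on $S$ with $$\omega_S(v_1,v_2)=\langle\alpha_1,v_2\rangle\quad\text{whenever } v_1,v_2\in T_sS \text{ and } v_1\oplus\alpha_1\in E_{\iota_S(s)}$$ (where $T_sS$ is identified with its image in $T_{\iota_S(s)}M$); it is smooth, and $$\mathrm d\omega_S=\iota_S^*\eta .$$ **(b)** In particular, let $G$ be a Lie group with Lie algebra $\mathfrak g$, and let $B$ be an $\operatorname{Ad}$-invariant, nondegenerate symmetric bilinear form on $\mathfrak g$. Let $\theta^L,\theta^R$ be the left- and right-invariant Maurer–Cartan forms, $\xi^L,\xi^R$ the left- and right-invariant vector fields given by $\xi\in\mathfrak g$, $\xi^\sharp=\xi^L-\xi^R$, and $\eta=\frac1{12}B(\theta^L,[\theta^L,\theta^L])$. On every conjugacy class $\iota_{\mathcal C}\colon\mathcal C\hookrightarrow G$ (with its manifold structure as an orbit of the conjugation action) there is a unique 2-form $\omega_{\mathcal C}$, the GHJW form, with $$\omega_{\mathcal C}(\xi_1^\sharp,\xi_2^\sharp)\big|_g=\tfrac12 B\big((\operatorname{Ad}_{g^{-1}}-\operatorname{Ad}_g)\xi_1,\xi_2\big),\qquad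 g\in\mathcal C,\ \xi_1,\xi_2\in\mathfrak g .$$ It is smooth, it is the 2-form induced (as in (a)) by the Cartan–Dirac structure on $G$, which is spanned by the sections $(\xi^L-\xi^R)\oplus B\big(\tfrac{\theta^L+\theta^R}{2},\xi\big)$, $\xi\in\mathfrak g$, and $$\mathrm d\omega_{\mathcal C}=\iota_{\mathcal C}^*\eta .$$ -/

import Mathlib

open scoped Manifold ContDiff

universe u₁ u₂ u₃ u₄

noncomputable section

namespace DiracGeometry

/-! ### Linear algebra on `V ⊕ V*` and the contravariant spinor module -/

section Linear

variable {V : Type*} [NormedAddCommGroup V] [NormedSpace ℝ V]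

/-- The symmetric pairing `⟨v₁ ⊕ α₁, v₂ ⊕ α₂⟩ = α₁(v₂) + α₂(v₁)` on `V ⊕ V*`. -/
def pairing (w₁ w₂ : V × (V →L[ℝ] ℝ)) : ℝ := w₁.2 w₂.1 + w₂.2 w₁.1

/-- A subspace `L` of `V ⊕ V*` is Lagrangian if it equals its own orthogonal space. -/
def IsLagrangian (L : Submodule ℝ (V × (V →L[ℝ] ℝ))) : Prop :=
  ∀ w, w ∈ L ↔ ∀ w' ∈ L, pairing w w' = 0

/-- The range of `L ⊆ V ⊕ V*`: its projection to `V`. -/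
def ran (L : Submodule ℝ (V × (V →L[ℝ] ℝ))) : Submodule ℝ V :=
  L.map (LinearMap.fst ℝ V (V →L[ℝ] ℝ))

/-- The wedge product `α ∧ φ` of a covector with a `k`-form:
`(α ∧ φ)(v₀, …, v_k) = ∑ᵢ (-1)ⁱ α(vᵢ) φ(v₀, …, v̂ᵢ, …, v_k)`. -/
def covWedge {k : ℕ} (α : V →L[ℝ] ℝ) (φ : V [⋀^Fin k]→L[ℝ] ℝ) : V [⋀^Fin (k + 1)]→L[ℝ] ℝ :=
  ContinuousAlternatingMap.alternatizeUncurryFin (α.smulRight φ)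

/-- The contravariant spinor module `∧V*`. An element is given by its homogeneous components;
those of degree larger than `dim V` vanish, so this is the direct sum of the `∧ᵏV*`. -/
abbrev Spinor (V : Type*) [NormedAddCommGroup V] [NormedSpace ℝ V] : Type _ :=
  ∀ k : ℕ, V [⋀^Fin k]→L[ℝ] ℝ

/-- The Clifford action `ρ(v ⊕ α) φ = ι(v) φ + α ∧ φ` on `∧V*`. -/
def cliffordAct (w : V × (V →L[ℝ] ℝ)) (φ : Spinor V) : Spinor V
  | 0 => (φ 1).curryLeft w.1
  | k + 1 => (φ (k + 2)).curryLeft w.1 + covWedge w.2 (φ k)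

/-- `φ` is a pure spinor with null space `N_φ = {w | ρ(w) φ = 0}` equal to the (Lagrangian)
subspace `L`. -/
def IsPureSpinorOf (L : Submodule ℝ (V × (V →L[ℝ] ℝ))) (φ : Spinor V) : Prop :=
  φ ≠ 0 ∧ IsLagrangian L ∧ ∀ w, w ∈ L ↔ cliffordAct w φ = 0

/-- The `k`-th step of the filtration of the spinor module defined by `L`: all `γ` with
`ρ(w₀) ⋯ ρ(w_k) γ = 0` for all `wᵢ ∈ L`. -/
def spinorFiltration (L : Submodule ℝ (V × (V →L[ℝ] ℝ))) : ℕ → Set (Spinor V)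
  | 0 => {γ | ∀ w ∈ L, cliffordAct w γ = 0}
  | k + 1 => {γ | ∀ w ∈ L, cliffordAct w γ ∈ spinorFiltration L k}

variable [FiniteDimensional ℝ V]

/-- The members `e¹, …, eⁿ` of the basis of `V*` dual to the basis `e₁, …, eₙ` of `V` given by
`Module.finBasis`. -/
def dualBasis (i : Fin (Module.finrank ℝ V)) : V →L[ℝ] ℝ :=
  LinearMap.toContinuousLinearMap ((Module.finBasis ℝ V).coord i)

/-- The wedge product `η ∧ φ` of a 3-form with a `k`-form, through
`η = (1/3!) ∑ η(e_a, e_b, e_c) eᵃ ∧ eᵇ ∧ eᶜ` (the result does not depend on the basis). -/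
def wedge₃ {k : ℕ} (η : V [⋀^Fin 3]→L[ℝ] ℝ) (φ : V [⋀^Fin k]→L[ℝ] ℝ) :
    V [⋀^Fin (k + 3)]→L[ℝ] ℝ :=
  (1 / 6 : ℝ) • ∑ a, ∑ b, ∑ c,
    η ![Module.finBasis ℝ V a, Module.finBasis ℝ V b, Module.finBasis ℝ V c] •
      covWedge (dualBasis a) (covWedge (dualBasis b) (covWedge (dualBasis c) φ))

/-- The operator `η ∧ ·` on the spinor module. -/
def spinorWedge₃ (η : V [⋀^Fin 3]→L[ℝ] ℝ) (φ : Spinor V) : Spinor V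
  | 0 => 0
  | 1 => 0
  | 2 => 0
  | k + 3 => wedge₃ η (φ k)

end Linear

/-! ### Differential forms on manifolds

A manifold `M` is modelled on a normed space `V` (finite dimensional in the theorem), without
boundary. In Mathlib every tangent space `TangentSpace 𝓘(ℝ, V) x` is, by definition, the space
`V`; its elements are related to the elements of the coordinate space by the derivative of a
chart. A `k`-form on `M` is thus a function `M → V [⋀^Fin k]→L[ℝ] ℝ`. -/

section Manifold

variable {V : Type*} [NormedAddCommGroup V] [NormedSpace ℝ V]
  {M : Type*} [TopologicalSpace M] [ChartedSpace V M]
  {W : Type*} [NormedAddCommGroup W] [NormedSpace ℝ W]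
  {S : Type*} [TopologicalSpace S] [ChartedSpace W S]

/-- The tangent map `T_x M → T_{f x} S` of `f : M → S`. -/
def tangent (f : M → S) (x : M) : V →L[ℝ] W := mfderiv 𝓘(ℝ, V) 𝓘(ℝ, W) f x

/-- The expression of a `k`-form in the preferred chart at `x₀`: its pullback under the inverse
of the chart (only meaningful on the target of the chart). -/
def formInChart {k : ℕ} (σ : M → V [⋀^Fin k]→L[ℝ] ℝ) (x₀ : M) (y : V) : V [⋀^Fin k]→L[ℝ] ℝ :=
  (σ ((extChartAt 𝓘(ℝ, V) x₀).symm y)).compContinuousLinearMap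
    (tangent (V := V) (W := V) (M := V) (S := M) (extChartAt 𝓘(ℝ, V) x₀).symm y)

/-- The part of the coordinate space of the chart at `x₀` that corresponds to `U ⊆ M`. -/
def chartDomain (x₀ : M) (U : Set M) : Set V :=
  (extChartAt 𝓘(ℝ, V) x₀).target ∩ (extChartAt 𝓘(ℝ, V) x₀).symm ⁻¹' U

/-- The `k`-form `σ` is smooth on the open set `U`. -/
def SmoothFormOn {k : ℕ} (σ : M → V [⋀^Fin k]→L[ℝ] ℝ) (U : Set M) : Prop :=
  ∀ x₀ : M, ContDiffOn ℝ ∞ (formInChart σ x₀) (chartDomain x₀ U)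

/-- The exterior derivative of a `k`-form: computed at `x` in the preferred chart at `x`, and
pulled back to `T_x M` by the derivative of that chart. -/
def extD {k : ℕ} (σ : M → V [⋀^Fin k]→L[ℝ] ℝ) (x : M) : V [⋀^Fin (k + 1)]→L[ℝ] ℝ :=
  (extDeriv (formInChart σ x) (extChartAt 𝓘(ℝ, V) x x)).compContinuousLinearMap
    (tangent (V := V) (W := V) (M := M) (S := V) (extChartAt 𝓘(ℝ, V) x) x)

/-- The pullback `f^* σ` of a `k`-form. -/
def pullback {k : ℕ} (f : S → M) (σ : M → V [⋀^Fin k]→L[ℝ] ℝ) (s : S) : W [⋀^Fin k]→L[ℝ] ℝ :=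
  (σ (f s)).compContinuousLinearMap (tangent f s)

/-- A section `v ⊕ α` of `𝕋M = TM ⊕ T*M` is smooth on the open set `U`: in every chart, the
vector field `v` and the 1-form `α` have smooth coordinate expressions. -/
def SmoothSectionOn (w : M → V × (V →L[ℝ] ℝ)) (U : Set M) : Prop :=
  ∀ x₀ : M,
    ContDiffOn ℝ ∞ (fun y : V =>
      tangent (V := V) (W := V) (M := M) (S := V) (extChartAt 𝓘(ℝ, V) x₀)
        ((extChartAt 𝓘(ℝ, V) x₀).symm y) (w ((extChartAt 𝓘(ℝ, V) x₀).symm y)).1) (chartDomain x₀ U) ∧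
    ContDiffOn ℝ ∞ (fun y : V =>
      (w ((extChartAt 𝓘(ℝ, V) x₀).symm y)).2.comp
        (tangent (V := V) (W := V) (M := V) (S := M) (extChartAt 𝓘(ℝ, V) x₀).symm y))
      (chartDomain x₀ U)

/-- An almost Dirac structure: a smooth Lagrangian subbundle `E` of `𝕋M = TM ⊕ T*M`. -/
structure IsAlmostDirac (E : M → Submodule ℝ (V × (V →L[ℝ] ℝ))) : Prop where
  lagrangian : ∀ x, IsLagrangian (E x)
  /-- `E` has smooth local frames. -/
  smooth : ∀ x₀ : M, ∃ U : Set M, IsOpen U ∧ x₀ ∈ U ∧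
    ∃ w : Fin (Module.finrank ℝ V) → M → V × (V →L[ℝ] ℝ),
      (∀ i, SmoothSectionOn (w i) U) ∧
      ∀ x ∈ U, LinearIndependent ℝ (fun i => w i x) ∧
        E x = Submodule.span ℝ (Set.range fun i => w i x)

/-- The exterior derivative of a field of spinors (a form of mixed degree). -/
def spinorD (φ : M → Spinor V) (x : M) : Spinor V
  | 0 => 0
  | k + 1 => extD (fun x' => φ x' k) x

variable [FiniteDimensional ℝ V]

/-- The Courant integrability condition relative to the 3-form `η`: for every smooth pure spinor
`φ` with `N_φ = E`, defined on some open set `U`, the form `(d + η) φ` lies in the second step of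
the filtration of the spinor module by `E`, i.e. its class in degree 3 of the associated graded
module is zero. -/
def IsCourantIntegrable (E : M → Submodule ℝ (V × (V →L[ℝ] ℝ)))
    (η : M → V [⋀^Fin 3]→L[ℝ] ℝ) : Prop :=
  ∀ (U : Set M) (φ : M → Spinor V), IsOpen U →
    (∀ k, SmoothFormOn (fun x => φ x k) U) →
    (∀ x ∈ U, IsPureSpinorOf (E x) (φ x)) →
    ∀ x ∈ U, spinorD φ x + spinorWedge₃ (η x) (φ x) ∈ spinorFiltration (E x) 2

/-- `E` is a Dirac structure on `M` relative to the closed 3-form `η`. -/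
structure IsDirac (E : M → Submodule ℝ (V × (V →L[ℝ] ℝ)))
    (η : M → V [⋀^Fin 3]→L[ℝ] ℝ) : Prop where
  almostDirac : IsAlmostDirac E
  smooth : SmoothFormOn η Set.univ
  closed : ∀ x, extD η x = 0
  integrable : IsCourantIntegrable E η


end Manifold

section Leaves

variable {V : Type*} [NormedAddCommGroup V] [NormedSpace ℝ V]
  {M : Type*} [TopologicalSpace M] [ChartedSpace V M]
  {W : Type*} [NormedAddCommGroup W] [NormedSpace ℝ W]
  {S : Type*} [TopologicalSpace S] [ChartedSpace W S]

variable (W) in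
/-- `ι : S → M` is an immersed integral manifold of the generalized distribution `ran(E)`: a
smooth immersion with `dι(T_s S) = ran(E)` at `ι(s)`, for all `s`. The leaves of the generalized
foliation defined by `ran(E)`, with their inclusions, are the connected injectively immersed
integral manifolds that are maximal. -/
structure IsIntegralManifold (E : M → Submodule ℝ (V × (V →L[ℝ] ℝ))) (ι : S → M) : Prop where
  smooth : ContMDiff 𝓘(ℝ, W) 𝓘(ℝ, V) ∞ ι
  immersion : ∀ s, Function.Injective (tangent ι s : W →L[ℝ] V)
  tangent_eq : ∀ s, Set.range (tangent ι s : W →L[ℝ] V) = ran (E (ι s))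

/-- `τ` is the 2-form induced by `E` on `S`: identifying `T_s S` with its image under `dι`,
`τ(v₁, v₂) = α₁(v₂)` for every lift `v₁ ⊕ α₁ ∈ E` of `v₁`. -/
def IsInducedForm (E : M → Submodule ℝ (V × (V →L[ℝ] ℝ))) (ι : S → M)
    (τ : S → W [⋀^Fin 2]→L[ℝ] ℝ) : Prop :=
  ∀ (s : S) (u₁ u₂ : W) (α₁ : V →L[ℝ] ℝ),
    ((tangent ι s u₁ : V), α₁) ∈ E (ι s) → τ s ![u₁, u₂] = α₁ (tangent ι s u₂)

end Leaves

/-! ### Lie groups and conjugacy classes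

The Lie algebra of `G` is Mathlib's `GroupLieAlgebra 𝓘(ℝ, V) G`, the tangent space of `G` at `1`
with the bracket of left-invariant vector fields; its underlying vector space is `V`. -/

section LieGroup

variable {V : Type*} [NormedAddCommGroup V] [NormedSpace ℝ V]
  {G : Type*} [TopologicalSpace G] [ChartedSpace V G] [Group G]

/-- The value at `g` of the left-invariant vector field `ξᴸ`. -/
def leftInv (g : G) : V →L[ℝ] V := tangent (fun x : G => g * x) 1

/-- The value at `g` of the right-invariant vector field `ξᴿ`. -/
def rightInv (g : G) : V →L[ℝ] V := tangent (fun x : G => x * g) 1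

/-- The left-invariant Maurer-Cartan form `θᴸ = g⁻¹ dg` at `g`. -/
def thetaL (g : G) : V →L[ℝ] V := tangent (fun x : G => g⁻¹ * x) g

/-- The right-invariant Maurer-Cartan form `θᴿ = dg g⁻¹` at `g`. -/
def thetaR (g : G) : V →L[ℝ] V := tangent (fun x : G => x * g⁻¹) g

/-- The adjoint action `Ad_g` on the Lie algebra. -/
def Ad (g : G) : V →L[ℝ] V := tangent (fun x : G => g * x * g⁻¹) 1

/-- The generating vector fields `ξ^♯ = ξᴸ - ξᴿ` of the conjugation action, at `g`. -/
def sharp (g : G) : V →L[ℝ] V := leftInv g - rightInv g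

/-- The bracket of the Lie algebra of `G`. -/
def lieBracket (G : Type*) [TopologicalSpace G] [ChartedSpace V G] [Group G] (ξ ζ : V) : V :=
  Bracket.bracket (L := GroupLieAlgebra 𝓘(ℝ, V) G) (M := GroupLieAlgebra 𝓘(ℝ, V) G) ξ ζ

variable (G) in
/-- An invariant inner product on the Lie algebra: a nondegenerate symmetric bilinear form, not
necessarily definite, that is invariant under the adjoint action. -/
structure IsInvariantInner (B : LinearMap.BilinForm ℝ V) : Prop where
  symm : B.IsSymm
  nondegenerate : B.Nondegenerate
  invariant : ∀ (g : G) (ξ ζ : V), B (Ad g ξ) (Ad g ζ) = B ξ ζ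

variable {W : Type*} [NormedAddCommGroup W] [NormedSpace ℝ W]
  {C : Type*} [TopologicalSpace C] [ChartedSpace W C]

variable (V W) in
/-- `ι : C → G` is the inclusion of the conjugacy class of `g₀` with its structure of a manifold
as an orbit of the conjugation action: `ι` is an injective immersion onto the conjugacy class,
and the orbit map `G → C`, `a ↦ a g₀ a⁻¹` is a smooth submersion. -/
structure IsConjugacyClass (g₀ : G) (ι : C → G) : Prop where
  smooth : ContMDiff 𝓘(ℝ, W) 𝓘(ℝ, V) ∞ ι
  injective : Function.Injective ι
  immersion : ∀ c, Function.Injective (tangent ι c : W →L[ℝ] V)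
  range_eq : Set.range ι = {g | IsConj g₀ g}
  orbit : ∃ q : G → C, (∀ a, ι (q a) = a * g₀ * a⁻¹) ∧
    ContMDiff 𝓘(ℝ, V) 𝓘(ℝ, W) ∞ q ∧ ∀ a, Function.Surjective (tangent q a : V →L[ℝ] W)

/-- `τ` is the Guruprasad-Huebschmann-Jeffrey-Weinstein 2-form on the conjugacy class `C`:
`τ(ξ₁^♯, ξ₂^♯) = ½ B((Ad_{g⁻¹} - Ad_g) ξ₁, ξ₂)` at `g`. (This is the sign for which it is the form
induced by the Cartan-Dirac structure.) -/
def IsGHJWForm (B : LinearMap.BilinForm ℝ V) (ι : C → G)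
    (τ : C → W [⋀^Fin 2]→L[ℝ] ℝ) : Prop :=
  ∀ (c : C) (u₁ u₂ : W) (ξ₁ ξ₂ : V),
    (tangent ι c u₁ : V) = sharp (ι c) ξ₁ → (tangent ι c u₂ : V) = sharp (ι c) ξ₂ →
      τ c ![u₁, u₂] = (1 / 2 : ℝ) * B (Ad (ι c)⁻¹ ξ₁ - Ad (ι c) ξ₁) ξ₂

variable [FiniteDimensional ℝ V]

/-- The bundle map `e(ξ) = (ξᴸ - ξᴿ) ⊕ B((θᴸ + θᴿ)/2, ξ)` at `g`. -/
def cartanDiracMap (B : LinearMap.BilinForm ℝ V) (g : G) (ξ : V) : V × (V →L[ℝ] ℝ) :=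
  (sharp g ξ, LinearMap.toContinuousLinearMap
    ((1 / 2 : ℝ) • (B.flip ξ ∘ₗ (thetaL g + thetaR g : V →L[ℝ] V).toLinearMap)))

/-- The Cartan-Dirac structure of `G`: the subbundle of `𝕋G` spanned by the sections `e(ξ)`. -/
def cartanDirac (B : LinearMap.BilinForm ℝ V) (g : G) : Submodule ℝ (V × (V →L[ℝ] ℝ)) :=
  Submodule.span ℝ (Set.range (cartanDiracMap B g))

/-- The Cartan 3-form `η = (1/12) B(θᴸ, [θᴸ, θᴸ])`, that is
`(1/12) ∑ B(e_a, [e_b, e_c]) θᵃ ∧ θᵇ ∧ θᶜ` where `θᴸ = ∑ θᵃ e_a` in a basis `e_a` of the Lie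
algebra (the result does not depend on the basis). -/
def cartanForm (B : LinearMap.BilinForm ℝ V) (g : G) : V [⋀^Fin 3]→L[ℝ] ℝ :=
  let e : Fin (Module.finrank ℝ V) → V := Module.finBasis ℝ V
  let θ : Fin (Module.finrank ℝ V) → V →L[ℝ] ℝ := fun a => (dualBasis a).comp (thetaL g)
  (1 / 12 : ℝ) • ∑ a, ∑ b, ∑ c, B (e a) (lieBracket G (e b) (e c)) •
    covWedge (θ a) (covWedge (θ b) (covWedge (θ c)
      (ContinuousAlternatingMap.constOfIsEmpty ℝ V (Fin 0) 1)))

end LieGroup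

end DiracGeometry

end

/-!
The 2-form on an integral manifold `ι : S → M` of `ran(E)` exists because `E` is isotropic: if
`v₁ ⊕ α₁` and `v₁ ⊕ α₁'` lie in `E`, then `α₁ - α₁'` vanishes on `ran(E)`
(`existsUnique_isInducedForm`). It is smooth because the tangent vectors of `S` have smooth lifts to
`E` along `ι` (`exists_smooth_lift`, `contDiffAt_inducedForm`).

For the exterior derivative, everything is read in a chart, where the tangent spaces are identified
with a fixed space `V` and `D` is the flat derivative. Near every point `E` is the null space of a
smooth pure spinor `φ`, the Clifford product of a local frame applied to a constant form
(`exists_smooth_pureSpinor`). Differentiating `ρ(w)φ = 0` gives `ρ(w) D_u φ = -ρ(D_u w) φ`, and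
since `d = ∑ eᵃ ∧ D_a`, the Clifford relations turn `ρ(w₀)ρ(w₁)ρ(w₂)(d + η)φ = 0` into the Courant
identity
`⟨w₀, D_{v₁} w₂⟩ - ⟨w₀, D_{v₂} w₁⟩ - ⟨w₁, D_{v₀} w₂⟩ = η(v₀, v₁, v₂)` for the sections
`wᵢ = vᵢ ⊕ αᵢ` of `E` (`courantIdentityAt_of_spinor`). Its left hand side is tensorial on `E`, so it
may be evaluated on smooth lifts along `ι` of coordinate vector fields of `S`, where it is the
exterior derivative of the induced form (`extDeriv_inducedForm`). No Lie brackets are needed.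

A conjugacy class is an integral manifold of the range of the Cartan-Dirac structure, which is
isotropic by invariance of `B`, and the GHJW condition says precisely that the form is induced by it
(`IsInvariantInner.isGHJWForm_iff`); existence, uniqueness and smoothness follow as above. The
exterior derivative is computed after pulling back along the submersion `a ↦ a g a⁻¹` onto the
class. The pullback of the form is left-invariant with value `½ B((A⁻¹ - A)u, v)`, `A = Ad_g`
(`IsGHJWForm.pullback_orbit`), so that its exterior derivative at the unit follows from the
Maurer-Cartan equation (`extDeriv_leftInvariant`). The pullback of `η` at the unit has the value
`½ T((A⁻¹ - 1)u₀, (A⁻¹ - 1)u₁, (A⁻¹ - 1)u₂)`, `T(x, y, z) = B(x, [y, z])`, and the two agree because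
`T` is alternating and invariant under `A` (`IsInvariantInner.apply_lieBracket_sub`). That `T` has
these properties follows from the formula `[ξ, ζ] = D_ξ Ad(ζ)` at the unit (`hasMFDerivAt_Ad`).
-/

noncomputable section

namespace DiracGeometry

/-! ### The Clifford module of forms on a vector space -/

section Clifford

variable {V : Type*} [NormedAddCommGroup V] [NormedSpace ℝ V]

theorem covWedge_apply {k : ℕ} (α : V →L[ℝ] ℝ) (φ : V [⋀^Fin k]→L[ℝ] ℝ) (v : Fin (k + 1) → V) :
    covWedge α φ v = ∑ i : Fin (k + 1), (-1) ^ (i : ℕ) * (α (v i) * φ (i.removeNth v)) := by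
  simp [covWedge, ContinuousAlternatingMap.alternatizeUncurryFin_apply]

theorem covWedge_add_left {k : ℕ} (α β : V →L[ℝ] ℝ) (φ : V [⋀^Fin k]→L[ℝ] ℝ) :
    covWedge (α + β) φ = covWedge α φ + covWedge β φ := by
  ext v
  simp [covWedge_apply, add_mul, mul_add, Finset.sum_add_distrib]

theorem covWedge_smul_left {k : ℕ} (c : ℝ) (α : V →L[ℝ] ℝ) (φ : V [⋀^Fin k]→L[ℝ] ℝ) :
    covWedge (c • α) φ = c • covWedge α φ := by
  ext v
  simp only [covWedge_apply, ContinuousAlternatingMap.smul_apply, Finset.smul_sum]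
  refine Finset.sum_congr rfl fun i _ => ?_
  simp; ring

theorem covWedge_add_right {k : ℕ} (α : V →L[ℝ] ℝ) (φ ψ : V [⋀^Fin k]→L[ℝ] ℝ) :
    covWedge α (φ + ψ) = covWedge α φ + covWedge α ψ := by
  ext v
  simp [covWedge_apply, mul_add, Finset.sum_add_distrib]

theorem covWedge_smul_right {k : ℕ} (c : ℝ) (α : V →L[ℝ] ℝ) (φ : V [⋀^Fin k]→L[ℝ] ℝ) :
    covWedge α (c • φ) = c • covWedge α φ := by
  ext v
  simp only [covWedge_apply, ContinuousAlternatingMap.smul_apply, Finset.smul_sum]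
  refine Finset.sum_congr rfl fun i _ => ?_
  simp; ring

theorem covWedge_zero_right {k : ℕ} (α : V →L[ℝ] ℝ) :
    covWedge α (0 : V [⋀^Fin k]→L[ℝ] ℝ) = 0 := by
  ext v
  simp [covWedge_apply]

theorem covWedge_self {k : ℕ} (α : V →L[ℝ] ℝ) (φ : V [⋀^Fin k]→L[ℝ] ℝ) :
    covWedge α (covWedge α φ) = 0 := by
  have h := ContinuousAlternatingMap.alternatizeUncurryFin_alternatizeUncurryFinCLM_comp_of_symmetric
    (f := α.smulRight (α.smulRight φ)) (by intro x y; ext v; simp; ring)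
  rw [← h]
  unfold covWedge
  congr 1
  ext x v
  simp [ContinuousAlternatingMap.alternatizeUncurryFin_apply, Finset.mul_sum]

/-- The interior product with a vector is an antiderivation with respect to the wedge product
with a covector. -/
theorem curryLeft_covWedge {k : ℕ} (α : V →L[ℝ] ℝ) (φ : V [⋀^Fin (k + 1)]→L[ℝ] ℝ) (x : V) :
    (covWedge α φ).curryLeft x = α x • φ - covWedge α (φ.curryLeft x) := by
  ext v
  rw [ContinuousAlternatingMap.curryLeft_apply_apply, covWedge_apply, Fin.sum_univ_succ]
  rw [ContinuousAlternatingMap.sub_apply, ContinuousAlternatingMap.smul_apply, covWedge_apply,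
    sub_eq_add_neg, ← Finset.sum_neg_distrib]
  refine congrArg₂ (· + ·) ?_ ?_
  · simp [Matrix.vecCons]
  · refine Finset.sum_congr rfl fun i _ => ?_
    have : Fin.removeNth i.succ (Fin.cons x v : Fin (k + 2) → V) = Fin.cons x (i.removeNth v) := by
      funext j
      refine Fin.cases ?_ (fun j => ?_) j <;> simp [Fin.removeNth]
    simp [Matrix.vecCons, pow_succ, this]

theorem curryLeft_covWedge_zero (α : V →L[ℝ] ℝ) (φ : V [⋀^Fin 0]→L[ℝ] ℝ) (x : V) :
    (covWedge α φ).curryLeft x = α x • φ := by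
  ext v
  rw [ContinuousAlternatingMap.curryLeft_apply_apply, covWedge_apply]
  simp [Subsingleton.elim _ v]

/-- The Clifford action as a linear map on `V ⊕ V*` with values in the endomorphisms of `∧V*`. -/
def clifford : (V × (V →L[ℝ] ℝ)) →ₗ[ℝ] Module.End ℝ (Spinor V) where
  toFun w :=
    { toFun := cliffordAct w
      map_add' := fun φ ψ => by
        funext k
        cases k with
        | zero => simp [cliffordAct]
        | succ k => simp [cliffordAct, covWedge_add_right]; abel
      map_smul' := fun c φ => by
        funext k
        cases k with
        | zero => simp [cliffordAct]
        | succ k => simp [cliffordAct, covWedge_smul_right] }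
  map_add' w w' := by
    ext φ k : 2
    cases k with
    | zero => simp [cliffordAct]
    | succ k => simp [cliffordAct, covWedge_add_left]; abel
  map_smul' c w := by
    ext φ k : 2
    cases k with
    | zero => simp [cliffordAct]
    | succ k => simp [cliffordAct, covWedge_smul_left]

theorem clifford_apply (w : V × (V →L[ℝ] ℝ)) (φ : Spinor V) : clifford w φ = cliffordAct w φ := rfl

theorem clifford_apply_self (w : V × (V →L[ℝ] ℝ)) (φ : Spinor V) :
    clifford w (clifford w φ) = w.2 w.1 • φ := by
  have h0 (k : ℕ) : ((φ (k + 2)).curryLeft w.1).curryLeft w.1 = 0 :=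
    ContinuousAlternatingMap.curryLeft_same _ _
  funext k
  rcases k with _ | _ | k
  · simp [clifford_apply, cliffordAct, h0, curryLeft_covWedge_zero]
  · simp [clifford_apply, cliffordAct, h0, curryLeft_covWedge]
  · simp [clifford_apply, cliffordAct, h0, curryLeft_covWedge, covWedge_self, covWedge_add_right]

/-- The Clifford relation `ρ(w) ρ(w') + ρ(w') ρ(w) = ⟨w, w'⟩`. -/
theorem clifford_comm (w w' : V × (V →L[ℝ] ℝ)) (φ : Spinor V) :
    clifford w (clifford w' φ) = pairing w w' • φ - clifford w' (clifford w φ) := by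
  have h := clifford_apply_self (w + w') φ
  simp only [map_add, LinearMap.add_apply, clifford_apply_self, Prod.fst_add, Prod.snd_add,
    add_apply, clifford_apply_self, add_smul] at h
  have h2 : clifford w (clifford w' φ) + clifford w' (clifford w φ) = pairing w w' • φ := by
    rw [pairing, add_smul, add_comm (w.2 w'.1 • φ)]
    rw [← sub_eq_zero] at h ⊢
    rw [← h]
    abel
  rw [← h2]; abel

theorem pairing_comm (w w' : V × (V →L[ℝ] ℝ)) : pairing w w' = pairing w' w := add_comm _ _

/-- The pairing of `V ⊕ V*` as a bilinear form. -/
def pairingForm : LinearMap.BilinForm ℝ (V × (V →L[ℝ] ℝ)) :=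
  LinearMap.mk₂ ℝ pairing (by intros; simp [pairing]; ring) (by intros; simp [pairing]; ring)
    (by intros; simp [pairing]; ring) (by intros; simp [pairing]; ring)

theorem pairingForm_apply (w w' : V × (V →L[ℝ] ℝ)) : pairingForm w w' = pairing w w' := rfl

/-- The product `ρ(w₀) ⋯ ρ(w_{m-1}) ψ`. -/
def cliffordProd : {m : ℕ} → (Fin m → V × (V →L[ℝ] ℝ)) → Spinor V → Spinor V
  | 0, _, ψ => ψ
  | _ + 1, w, ψ => clifford (w 0) (cliffordProd (fun i => w i.succ) ψ)

theorem cliffordProd_clifford {m : ℕ} (w : Fin m → V × (V →L[ℝ] ℝ)) (u : V × (V →L[ℝ] ℝ))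
    (h : ∀ i, pairing u (w i) = 0) (ψ : Spinor V) :
    cliffordProd w (clifford u ψ) = (-1 : ℝ) ^ m • clifford u (cliffordProd w ψ) := by
  induction m with
  | zero => simp [cliffordProd]
  | succ m ih =>
    simp only [cliffordProd, ih (fun i => w i.succ) fun i => h i.succ, map_smul]
    rw [clifford_comm u (w 0), h 0, zero_smul, zero_sub, pow_succ]
    simp

theorem clifford_cliffordProd_eq_zero {m : ℕ} (w : Fin m → V × (V →L[ℝ] ℝ))
    (h : ∀ i j, pairing (w i) (w j) = 0) (ψ : Spinor V) (i : Fin m) :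
    clifford (w i) (cliffordProd w ψ) = 0 := by
  induction m with
  | zero => exact i.elim0
  | succ m ih =>
    refine Fin.cases ?_ (fun i => ?_) i
    · have := h 0 0
      simp only [pairing] at this
      rw [cliffordProd, clifford_apply_self, show (w 0).2 (w 0).1 = 0 by linarith, zero_smul]
    · rw [cliffordProd, clifford_comm, h, ih (fun i => w i.succ) fun i j => h i.succ j.succ]
      simp

/-- A nonzero spinor killed by a Lagrangian subspace `L` is a pure spinor with null space `L`,
since null spaces are isotropic. -/
theorem isPureSpinorOf_of_forall_clifford_eq_zero {L : Submodule ℝ (V × (V →L[ℝ] ℝ))}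
    (hL : IsLagrangian L) {φ : Spinor V} (h0 : φ ≠ 0) (h : ∀ w ∈ L, clifford w φ = 0) :
    IsPureSpinorOf L φ := by
  refine ⟨h0, hL, fun w => ⟨h w, fun hw => (hL w).2 fun w' hw' => ?_⟩⟩
  have h1 := clifford_comm w w' φ
  rw [h w' hw', clifford_apply w φ, hw, map_zero, map_zero, sub_zero] at h1
  exact (smul_eq_zero.1 h1.symm).resolve_right h0

/-- A product of Clifford actions of a frame of a Lagrangian subspace is a pure spinor, unless it
vanishes. -/
theorem isPureSpinorOf_cliffordProd {L : Submodule ℝ (V × (V →L[ℝ] ℝ))} (hL : IsLagrangian L)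
    {m : ℕ} (w : Fin m → V × (V →L[ℝ] ℝ)) (hw : L = Submodule.span ℝ (Set.range w)) (ψ : Spinor V)
    (h0 : cliffordProd w ψ ≠ 0) : IsPureSpinorOf L (cliffordProd w ψ) := by
  have hm (i) : w i ∈ L := hw ▸ Submodule.subset_span ⟨i, rfl⟩
  refine isPureSpinorOf_of_forall_clifford_eq_zero hL h0 fun x hx => ?_
  rw [hw] at hx
  induction hx using Submodule.span_induction with
  | mem x hx =>
    obtain ⟨i, rfl⟩ := hx
    exact clifford_cliffordProd_eq_zero w (fun i j => (hL (w i)).1 (hm i) _ (hm j)) ψ i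
  | zero => simp
  | add x y _ _ hx hy => simp [hx, hy]
  | smul c x _ hx => simp [hx]

theorem clifford_covector_succ (α : V →L[ℝ] ℝ) (φ : Spinor V) (k : ℕ) :
    clifford (0, α) φ (k + 1) = covWedge α (φ k) := by
  simp [clifford_apply, cliffordAct]

theorem clifford_covector_zero (α : V →L[ℝ] ℝ) (φ : Spinor V) :
    clifford (0, α) φ 0 = 0 := by
  simp [clifford_apply, cliffordAct]

variable [FiniteDimensional ℝ V]

theorem finBasis_repr_sum_dualBasis (v : V) : ∑ a, dualBasis a v • Module.finBasis ℝ V a = v :=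
  (Module.finBasis ℝ V).sum_repr v

theorem sum_dualBasis_smul {F : Type*} [AddCommGroup F] [Module ℝ F] (f : V →ₗ[ℝ] F) (v : V) :
    ∑ a, dualBasis a v • f (Module.finBasis ℝ V a) = f v := by
  conv_rhs => rw [← finBasis_repr_sum_dualBasis v]
  simp

theorem sum_dualBasis (α : V →L[ℝ] ℝ) : ∑ a, α (Module.finBasis ℝ V a) • dualBasis a = α := by
  ext v
  conv_rhs => rw [← finBasis_repr_sum_dualBasis v]
  simp [mul_comm]

/-- The pairing of `V ⊕ V*` is nondegenerate: it represents all linear functionals. -/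
theorem exists_pairing_eq (f : (V × (V →L[ℝ] ℝ)) →ₗ[ℝ] ℝ) : ∃ u, ∀ w, pairing u w = f w := by
  refine ⟨(∑ a, f (0, dualBasis a) • Module.finBasis ℝ V a,
    LinearMap.toContinuousLinearMap (f ∘ₗ LinearMap.inl ℝ V (V →L[ℝ] ℝ))), fun w => ?_⟩
  have h1 : f w = f (w.1, 0) + f (0, w.2) := by rw [← map_add]; simp
  have h2 : f (0, w.2) = ∑ a, w.2 (Module.finBasis ℝ V a) * f (0, dualBasis a) := by
    conv_lhs => rw [← sum_dualBasis w.2]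
    rw [show ((0 : V), ∑ a, w.2 (Module.finBasis ℝ V a) • dualBasis a) =
      ∑ a, w.2 (Module.finBasis ℝ V a) • ((0 : V), dualBasis a) by
        ext1 <;> simp [Prod.fst_sum, Prod.snd_sum], map_sum]
    simp only [map_smul, smul_eq_mul]
  rw [h1, h2]
  simp [pairing, mul_comm]

/-- A product of Clifford actions of linearly independent elements is a nonzero operator. -/
theorem exists_cliffordProd_ne_zero {m : ℕ} (w : Fin m → V × (V →L[ℝ] ℝ))
    (hw : LinearIndependent ℝ w) : ∃ ψ : Spinor V, cliffordProd w ψ ≠ 0 := by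
  induction m with
  | zero =>
    refine ⟨fun k => if h : k = 0 then
      h ▸ ContinuousAlternatingMap.constOfIsEmpty ℝ V (Fin 0) (1 : ℝ) else 0, fun h => ?_⟩
    have := congrArg (fun φ : Spinor V => φ 0 ![]) h
    simp [cliffordProd] at this
  | succ m ih =>
    obtain ⟨ψ, hψ⟩ := ih (fun i => w i.succ) (hw.comp _ (Fin.succ_injective m))
    -- An element `u` dual to `w 0`: either `ρ(w 0)` does not kill the product of the other
    -- factors, or it does not kill its image under `ρ(u)`.
    obtain ⟨f, hf⟩ : ∃ f : (V × (V →L[ℝ] ℝ)) →ₗ[ℝ] ℝ, ∀ i, f (w i) = if i = 0 then 1 else 0 := by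
      obtain ⟨f, hf⟩ := LinearMap.exists_extend
        ((Module.Basis.span hw).constr ℝ fun i => if i = 0 then (1 : ℝ) else 0)
      refine ⟨f, fun i => ?_⟩
      have := LinearMap.congr_fun hf (Module.Basis.span hw i)
      rw [Module.Basis.constr_basis] at this
      simpa [Module.Basis.span_apply] using this
    obtain ⟨u, hu⟩ := exists_pairing_eq f
    by_cases h : clifford (w 0) (cliffordProd (fun i => w i.succ) ψ) = 0
    · refine ⟨clifford u ψ, ?_⟩
      rw [cliffordProd, cliffordProd_clifford _ u fun i => by rw [hu, hf]; simp, map_smul,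
        clifford_comm, h, pairing_comm, hu, hf]
      simpa using hψ
    · exact ⟨ψ, h⟩

/-- The wedge product with a 3-form, through the Clifford action of covectors. -/
theorem spinorWedge₃_eq (η : V [⋀^Fin 3]→L[ℝ] ℝ) (φ : Spinor V) :
    spinorWedge₃ η φ = (1 / 6 : ℝ) • ∑ a, ∑ b, ∑ c,
      η ![Module.finBasis ℝ V a, Module.finBasis ℝ V b, Module.finBasis ℝ V c] •
        clifford (0, dualBasis a) (clifford (0, dualBasis b) (clifford (0, dualBasis c) φ)) := by
  funext k
  rcases k with _ | _ | _ | k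
  · simp [spinorWedge₃, clifford_covector_zero, Finset.sum_apply]
  · simp [spinorWedge₃, clifford_covector_zero, Finset.sum_apply, clifford_covector_succ,
      covWedge_zero_right]
  · simp [spinorWedge₃, clifford_covector_zero, Finset.sum_apply, clifford_covector_succ,
      covWedge_zero_right]
  · simp only [spinorWedge₃, wedge₃, clifford_covector_succ, Finset.sum_apply,
      Pi.smul_apply]

theorem apply_vecCons_eq_sum {k : ℕ} (η : V [⋀^Fin (k + 1)]→L[ℝ] ℝ) (x : V) (m : Fin k → V) :
    η (Matrix.vecCons x m) = ∑ a, dualBasis a x * η (Matrix.vecCons (Module.finBasis ℝ V a) m) := by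
  have h := congrArg (fun x => η.curryLeft x m) (finBasis_repr_sum_dualBasis x)
  simp only [ContinuousAlternatingMap.curryLeft_apply_apply] at h
  rw [← h, ← ContinuousAlternatingMap.curryLeft_apply_apply, map_sum]
  simp [ContinuousAlternatingMap.sum_apply]

theorem apply_three_eq_sum (η : V [⋀^Fin 3]→L[ℝ] ℝ) (x y z : V) :
    η ![x, y, z] = ∑ a, ∑ b, ∑ c, dualBasis a x * dualBasis b y * dualBasis c z *
      η ![Module.finBasis ℝ V a, Module.finBasis ℝ V b, Module.finBasis ℝ V c] := by
  rw [apply_vecCons_eq_sum]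
  refine Finset.sum_congr rfl fun a _ => ?_
  rw [← ContinuousAlternatingMap.curryLeft_apply_apply, apply_vecCons_eq_sum, Finset.mul_sum]
  refine Finset.sum_congr rfl fun b _ => ?_
  rw [← ContinuousAlternatingMap.curryLeft_apply_apply, apply_vecCons_eq_sum, Finset.mul_sum,
    Finset.mul_sum]
  refine Finset.sum_congr rfl fun c _ => ?_
  simp only [ContinuousAlternatingMap.curryLeft_apply_apply]
  ring

/-- The exterior derivative in terms of partial derivatives: `d = ∑ eᵃ ∧ D(e_a)`. -/
theorem exteriorDerivative_eq_sum {k : ℕ} (D : V →L[ℝ] V [⋀^Fin k]→L[ℝ] ℝ) :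
    ContinuousAlternatingMap.alternatizeUncurryFin D =
      ∑ a, covWedge (dualBasis a) (D (Module.finBasis ℝ V a)) := by
  ext v
  simp only [ContinuousAlternatingMap.alternatizeUncurryFin_apply,
    ContinuousAlternatingMap.sum_apply, covWedge_apply]
  rw [Finset.sum_comm]
  refine Finset.sum_congr rfl fun i _ => ?_
  conv_lhs => rw [← finBasis_repr_sum_dualBasis (v i)]
  simp [map_sum, ContinuousAlternatingMap.sum_apply, Finset.mul_sum]

/-- Three elements of the null space of `φ`, applied to the symbol `∑ eᵃ ∧ D(e_a)` of the exterior
derivative of `φ`. Here `D u` and `dwᵢ u` play the role of the derivatives of `φ` and of the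
`wᵢ` in the direction `u`. -/
theorem clifford_three_derivative (φ : Spinor V) (D : V →ₗ[ℝ] Spinor V)
    (w₀ w₁ w₂ : V × (V →L[ℝ] ℝ)) (dw₁ dw₂ : V →ₗ[ℝ] V × (V →L[ℝ] ℝ))
    (h₀ : clifford w₀ φ = 0) (h₁ : clifford w₁ φ = 0)
    (hd₁ : ∀ u, clifford w₁ (D u) = -clifford (dw₁ u) φ)
    (hd₂ : ∀ u, clifford w₂ (D u) = -clifford (dw₂ u) φ) :
    clifford w₀ (clifford w₁ (clifford w₂
      (∑ a, clifford (0, dualBasis a) (D (Module.finBasis ℝ V a))))) =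
    (pairing w₀ (dw₂ w₁.1) - pairing w₀ (dw₁ w₂.1) - pairing w₁ (dw₂ w₀.1)) • φ := by
  have hp (w : V × (V →L[ℝ] ℝ)) (a) : pairing w (0, dualBasis a) = dualBasis a w.1 := by
    simp [pairing]
  have e₂ : clifford w₂ (∑ a, clifford (0, dualBasis a) (D (Module.finBasis ℝ V a))) =
      D w₂.1 + ∑ a, clifford (0, dualBasis a) (clifford (dw₂ (Module.finBasis ℝ V a)) φ) := by
    rw [← sum_dualBasis_smul D w₂.1, map_sum, ← Finset.sum_add_distrib]
    refine Finset.sum_congr rfl fun a _ => ?_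
    rw [clifford_comm, hp, hd₂, map_neg, sub_neg_eq_add]
  have e₁ : clifford w₁ (D w₂.1 +
      ∑ a, clifford (0, dualBasis a) (clifford (dw₂ (Module.finBasis ℝ V a)) φ)) =
      clifford (dw₂ w₁.1 - dw₁ w₂.1) φ -
        ∑ a, pairing w₁ (dw₂ (Module.finBasis ℝ V a)) • clifford (0, dualBasis a) φ := by
    rw [map_add, hd₁, map_sum, map_sub, ← sum_dualBasis_smul dw₂ w₁.1, map_sum, LinearMap.sub_apply,
      LinearMap.sum_apply, neg_add_eq_sub, sub_right_comm, sub_left_inj, ← Finset.sum_sub_distrib]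
    refine Finset.sum_congr rfl fun a _ => ?_
    rw [clifford_comm, hp, clifford_comm w₁, h₁]
    simp
  have e₀ : ∑ a, pairing w₁ (dw₂ (Module.finBasis ℝ V a)) • dualBasis a w₀.1 • φ =
      pairing w₁ (dw₂ w₀.1) • φ := by
    have := sum_dualBasis_smul ((pairingForm w₁) ∘ₗ dw₂) w₀.1
    simp only [LinearMap.comp_apply, pairingForm_apply] at this
    rw [← this, Finset.sum_smul]
    refine Finset.sum_congr rfl fun a _ => ?_
    rw [smul_smul, smul_eq_mul, mul_comm]
  rw [e₂, e₁, map_sub, clifford_comm, h₀, map_zero, sub_zero, map_sum,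
    show pairing w₀ (dw₂ w₁.1 - dw₁ w₂.1) = pairing w₀ (dw₂ w₁.1) - pairing w₀ (dw₁ w₂.1) from
      map_sub (pairingForm w₀) _ _]
  refine Eq.trans ?_ (sub_smul _ _ φ).symm
  rw [← e₀]
  congr 1
  · refine Finset.sum_congr rfl fun a _ => ?_
    rw [map_smul, clifford_comm, h₀, hp]
    simp

/-- On a spinor with null space containing `w₀, w₁, w₂`, the product of their Clifford actions reduces
`η ∧ φ` to a multiple of `φ`. -/
theorem clifford_three_wedge₃ (η : V [⋀^Fin 3]→L[ℝ] ℝ) (φ : Spinor V)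
    (w₀ w₁ w₂ : V × (V →L[ℝ] ℝ))
    (h₀ : clifford w₀ φ = 0) (h₁ : clifford w₁ φ = 0) (h₂ : clifford w₂ φ = 0) :
    clifford w₀ (clifford w₁ (clifford w₂ (spinorWedge₃ η φ))) =
      -η ![w₀.1, w₁.1, w₂.1] • φ := by
  have hp (w : V × (V →L[ℝ] ℝ)) (a) : pairing w (0, dualBasis a) = dualBasis a w.1 := by
    simp [pairing]
  have hswap (x y z : V) : η ![x, y, z] = -η ![y, x, z] ∧ η ![x, y, z] = -η ![x, z, y] := by
    have h1 := η.toAlternatingMap.map_swap ![y, x, z] (i := 0) (j := 1) (by decide)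
    have h2 := η.toAlternatingMap.map_swap ![x, z, y] (i := 1) (j := 2) (by decide)
    constructor
    · rw [← ContinuousAlternatingMap.coe_toAlternatingMap, ← h1]
      congr 1; funext i; fin_cases i <;> rfl
    · rw [← ContinuousAlternatingMap.coe_toAlternatingMap, ← h2]
      congr 1; funext i; fin_cases i <;> rfl
  have key (a b c) : clifford w₀ (clifford w₁ (clifford w₂
      (clifford (0, dualBasis a) (clifford (0, dualBasis b) (clifford (0, dualBasis c) φ))))) =
      (dualBasis a w₂.1 * dualBasis b w₁.1 * dualBasis c w₀.1
      - dualBasis a w₂.1 * dualBasis b w₀.1 * dualBasis c w₁.1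
      - dualBasis a w₁.1 * dualBasis b w₂.1 * dualBasis c w₀.1
      + dualBasis a w₀.1 * dualBasis b w₂.1 * dualBasis c w₁.1
      + dualBasis a w₁.1 * dualBasis b w₀.1 * dualBasis c w₂.1
      - dualBasis a w₀.1 * dualBasis b w₁.1 * dualBasis c w₂.1) • φ := by
    simp only [clifford_comm w₀ ((0 : V), _), clifford_comm w₁ ((0 : V), _),
      clifford_comm w₂ ((0 : V), _), hp, h₀, h₁, h₂, map_sub, map_smul, map_zero,
      sub_zero, smul_sub]
    module
  have h210 : η ![w₂.1, w₁.1, w₀.1] = -η ![w₀.1, w₁.1, w₂.1] := by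
    rw [(hswap _ _ _).1, (hswap w₁.1 _ _).2, (hswap w₁.1 _ _).1]; ring
  have h201 : η ![w₂.1, w₀.1, w₁.1] = η ![w₀.1, w₁.1, w₂.1] := by
    rw [(hswap _ _ _).1, (hswap w₀.1 _ _).2]; ring
  have h120 : η ![w₁.1, w₂.1, w₀.1] = η ![w₀.1, w₁.1, w₂.1] := by
    rw [(hswap _ _ _).2, (hswap w₁.1 _ _).1]; ring
  have h021 : η ![w₀.1, w₂.1, w₁.1] = -η ![w₀.1, w₁.1, w₂.1] := (hswap _ _ _).2
  have h102 : η ![w₁.1, w₀.1, w₂.1] = -η ![w₀.1, w₁.1, w₂.1] := (hswap _ _ _).1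
  have hsum : -η ![w₀.1, w₁.1, w₂.1] = (1 / 6 : ℝ) * (η ![w₂.1, w₁.1, w₀.1] -
      η ![w₂.1, w₀.1, w₁.1] - η ![w₁.1, w₂.1, w₀.1] + η ![w₀.1, w₂.1, w₁.1] +
      η ![w₁.1, w₀.1, w₂.1] - η ![w₀.1, w₁.1, w₂.1]) := by
    rw [h210, h201, h120, h021, h102]; ring
  rw [spinorWedge₃_eq, hsum]
  simp only [map_smul, map_sum, key]
  simp only [apply_three_eq_sum η w₂.1, apply_three_eq_sum η w₁.1, apply_three_eq_sum η w₀.1,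
    ← Finset.sum_add_distrib, ← Finset.sum_sub_distrib, mul_smul, Finset.sum_smul]
  congr 1
  refine Finset.sum_congr rfl fun a _ => Finset.sum_congr rfl fun b _ =>
    Finset.sum_congr rfl fun c _ => ?_
  module

end Clifford

/-! ### Smooth families of forms on a vector space -/

section SmoothForms

open Topology

variable {V : Type*} [NormedAddCommGroup V] [NormedSpace ℝ V]
  {X : Type*} [NormedAddCommGroup X] [NormedSpace ℝ X] {n : WithTop ℕ∞}

/-- The interior product `φ ↦ (v ↦ ι(v) φ)` as a continuous linear map. -/
def curryLeftCLM (V : Type*) [NormedAddCommGroup V] [NormedSpace ℝ V] (k : ℕ) :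
    (V [⋀^Fin (k + 1)]→L[ℝ] ℝ) →L[ℝ] V →L[ℝ] V [⋀^Fin k]→L[ℝ] ℝ :=
  (ContinuousAlternatingMap.curryLeftLI (𝕜 := ℝ) (E := V) (F := ℝ)
    (n := k)).toContinuousLinearMap

theorem curryLeftCLM_apply {k : ℕ} (φ : V [⋀^Fin (k + 1)]→L[ℝ] ℝ) :
    curryLeftCLM V k φ = φ.curryLeft := rfl

theorem _root_.ContDiffAt.continuousAlternatingMap_apply {k : ℕ} {g : X → V [⋀^Fin k]→L[ℝ] ℝ}
    {v : Fin k → X → V} {x : X} (hg : ContDiffAt ℝ n g x) (hv : ∀ i, ContDiffAt ℝ n (v i) x) :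
    ContDiffAt ℝ n (fun y => g y (fun i => v i y)) x := by
  induction k with
  | zero =>
    have h := (ContinuousAlternatingMap.apply ℝ V ℝ (![] : Fin 0 → V)).contDiff.contDiffAt.comp x hg
    refine h.congr_of_eventuallyEq (Filter.Eventually.of_forall fun y => ?_)
    simp [Subsingleton.elim (fun i : Fin 0 => v i y) ![]]
  | succ k ih =>
    have h0 : ContDiffAt ℝ n (fun y => curryLeftCLM V k (g y)) x := by fun_prop
    have h1 : ContDiffAt ℝ n (fun y => curryLeftCLM V k (g y) (v 0 y)) x := h0.clm_apply (hv 0)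
    refine (ih h1 fun i => hv i.succ).congr_of_eventuallyEq (Filter.Eventually.of_forall fun y => ?_)
    simp only [curryLeftCLM_apply, ContinuousAlternatingMap.curryLeft_apply_apply]
    congr 1
    funext i
    refine Fin.cases ?_ (fun i => ?_) i <;> simp

/-- A family of alternating forms on a finite-dimensional space is smooth if all its evaluations
are. -/
theorem contDiffAt_continuousAlternatingMap_of_apply [FiniteDimensional ℝ V] {k : ℕ}
    {g : X → V [⋀^Fin k]→L[ℝ] ℝ} {x : X}
    (h : ∀ v, ContDiffAt ℝ n (fun y => g y v) x) : ContDiffAt ℝ n g x := by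
  let b := Module.finBasis ℝ V
  let ev : (V [⋀^Fin k]→L[ℝ] ℝ) →ₗ[ℝ] ((Fin k → Fin (Module.finrank ℝ V)) → ℝ) :=
    { toFun := fun φ r => φ fun i => b (r i)
      map_add' := fun φ ψ => rfl
      map_smul' := fun c φ => rfl }
  have hev : Function.Injective ev := by
    intro φ ψ hφ
    refine ContinuousAlternatingMap.toAlternatingMap_injective (b.ext_alternating fun r _ => ?_)
    exact congrFun hφ r
  obtain ⟨L, hL⟩ := ev.exists_leftInverse_of_injective (LinearMap.ker_eq_bot.2 hev)
  have h1 : ContDiffAt ℝ n (fun y => ev (g y)) x := contDiffAt_pi.2 fun r => h _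
  refine ((LinearMap.toContinuousLinearMap L).contDiff.contDiffAt.comp x h1).congr_of_eventuallyEq
    (Filter.Eventually.of_forall fun y => ?_)
  exact (LinearMap.congr_fun hL (g y)).symm

theorem contDiffAt_clifford [FiniteDimensional ℝ V] {φ : X → Spinor V}
    {w : X → V × (V →L[ℝ] ℝ)} {x : X} (hφ : ∀ k, ContDiffAt ℝ n (fun y => φ y k) x)
    (hw : ContDiffAt ℝ n w x) (k : ℕ) :
    ContDiffAt ℝ n (fun y => clifford (w y) (φ y) k) x := by
  have h0 (k : ℕ) : ContDiffAt ℝ n (fun y => curryLeftCLM V k (φ y (k + 1))) x := by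
    have := hφ (k + 1)
    fun_prop
  have h1 (k : ℕ) : ContDiffAt ℝ n (fun y => curryLeftCLM V k (φ y (k + 1)) (w y).1) x :=
    (h0 k).clm_apply hw.fst
  cases k with
  | zero => exact h1 0
  | succ k =>
    refine (h1 (k + 1)).add (contDiffAt_continuousAlternatingMap_of_apply fun v => ?_)
    simp only [covWedge_apply]
    refine ContDiffAt.sum fun i _ => contDiffAt_const.mul (ContDiffAt.mul ?_ ?_)
    · exact hw.snd.clm_apply contDiffAt_const
    · exact (hφ k).continuousAlternatingMap_apply fun _ => contDiffAt_const

theorem contDiffAt_cliffordProd [FiniteDimensional ℝ V] {m : ℕ} {ψ : X → Spinor V}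
    {w : Fin m → X → V × (V →L[ℝ] ℝ)} {x : X} (hψ : ∀ k, ContDiffAt ℝ n (fun y => ψ y k) x)
    (hw : ∀ i, ContDiffAt ℝ n (w i) x) (k : ℕ) :
    ContDiffAt ℝ n (fun y => cliffordProd (fun i => w i y) (ψ y) k) x := by
  induction m generalizing k with
  | zero => exact hψ k
  | succ m ih => exact contDiffAt_clifford (fun k => ih (fun i => hw i.succ) k) (hw 0) k

/-- The derivative of a family of spinors, degree by degree. -/
def spinorFDeriv (φ : X → Spinor V) (x : X) : X →ₗ[ℝ] Spinor V :=
  LinearMap.pi fun k => (fderiv ℝ (fun y => φ y k) x).toLinearMap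

theorem spinorFDeriv_apply (φ : X → Spinor V) (x u : X) (k : ℕ) :
    spinorFDeriv φ x u k = fderiv ℝ (fun y => φ y k) x u := rfl

/-- The product rule for the Clifford action, on a family that is killed by it. -/
theorem clifford_spinorFDeriv {φ : X → Spinor V} {w : X → V × (V →L[ℝ] ℝ)} {x : X}
    (hφ : ∀ k, DifferentiableAt ℝ (fun y => φ y k) x) (hw : DifferentiableAt ℝ w x)
    (h : ∀ᶠ y in 𝓝 x, clifford (w y) (φ y) = 0) (u : X) :
    clifford (w x) (spinorFDeriv φ x u) = -clifford (fderiv ℝ w x u) (φ x) := by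
  rw [← add_eq_zero_iff_eq_neg]
  have hev {k : ℕ} (v : Fin k → V) : HasFDerivAt (fun y => φ y k v)
      ((ContinuousAlternatingMap.apply ℝ V ℝ v).comp (fderiv ℝ (fun y => φ y k) x)) x :=
    (ContinuousAlternatingMap.apply ℝ V ℝ v).hasFDerivAt.comp x (hφ k).hasFDerivAt
  have h1 {k : ℕ} (v : Fin k → V) :
      HasFDerivAt (fun y => (φ y (k + 1)).curryLeft (w y).1 v)
        ((ContinuousAlternatingMap.apply ℝ V ℝ v).comp
          ((curryLeftCLM V k (φ x (k + 1))).comp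
            ((ContinuousLinearMap.fst ℝ V (V →L[ℝ] ℝ)).comp (fderiv ℝ w x)) +
          ((curryLeftCLM V k).comp (fderiv ℝ (fun y => φ y (k + 1)) x)).flip (w x).1)) x := by
    have h0 : HasFDerivAt (fun y => curryLeftCLM V k (φ y (k + 1)))
        ((curryLeftCLM V k).comp (fderiv ℝ (fun y => φ y (k + 1)) x)) x := by
      have h := ContinuousLinearMap.hasFDerivAt (𝕜 := ℝ) (E := V [⋀^Fin (k + 1)]→L[ℝ] ℝ)
        (F := V →L[ℝ] V [⋀^Fin k]→L[ℝ] ℝ) (curryLeftCLM V k) (x := φ x (k + 1))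
      exact HasFDerivAt.comp (𝕜 := ℝ) (E := X) (F := V [⋀^Fin (k + 1)]→L[ℝ] ℝ)
        (G := V →L[ℝ] V [⋀^Fin k]→L[ℝ] ℝ) x h (hφ (k + 1)).hasFDerivAt
    exact (ContinuousAlternatingMap.apply ℝ V ℝ v).hasFDerivAt.comp x
      (h0.clm_apply hw.hasFDerivAt.fst)
  have h2 {k : ℕ} (v : Fin (k + 1) → V) :
      HasFDerivAt (fun y => covWedge (w y).2 (φ y k) v)
        (∑ i : Fin (k + 1), ((-1 : ℝ) ^ (i : ℕ)) • ((w x).2 (v i) •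
          ((ContinuousAlternatingMap.apply ℝ V ℝ (i.removeNth v)).comp
            (fderiv ℝ (fun y => φ y k) x)) + φ x k (i.removeNth v) •
          ((ContinuousLinearMap.apply ℝ ℝ (v i)).comp
            ((ContinuousLinearMap.snd ℝ V (V →L[ℝ] ℝ)).comp (fderiv ℝ w x))))) x := by
    simp only [covWedge_apply]
    refine HasFDerivAt.fun_sum fun i _ => HasFDerivAt.const_mul (HasFDerivAt.mul ?_ ?_) _
    · exact (ContinuousLinearMap.apply ℝ ℝ (v i)).hasFDerivAt.comp x hw.hasFDerivAt.snd
    · exact hev _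
  funext k
  cases k with
  | zero =>
    ext v
    have h0 : (fun y => (φ y (0 + 1)).curryLeft (w y).1 v) =ᶠ[𝓝 x] fun _ => 0 :=
      h.mono fun y hy => by
        have := congrArg (fun ψ : Spinor V => ψ 0 v) hy
        simpa [clifford_apply, cliffordAct] using this
    have := congrArg (fun L : X →L[ℝ] ℝ => L u) ((h1 v).unique (h0.hasFDerivAt_iff.2 (hasFDerivAt_const 0 x)))
    simp [clifford_apply, cliffordAct, spinorFDeriv_apply, curryLeftCLM_apply] at this ⊢
    linarith
  | succ k =>
    ext v
    have h0 : (fun y => (φ y (k + 1 + 1)).curryLeft (w y).1 v + covWedge (w y).2 (φ y k) v)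
        =ᶠ[𝓝 x] fun _ => 0 :=
      h.mono fun y hy => by
        have := congrArg (fun ψ : Spinor V => ψ (k + 1) v) hy
        simpa [clifford_apply, cliffordAct] using this
    have := congrArg (fun L : X →L[ℝ] ℝ => L u)
      (((h1 v).add (h2 v)).unique (h0.hasFDerivAt_iff.2 (hasFDerivAt_const 0 x)))
    simp only [add_apply, ContinuousLinearMap.comp_apply, curryLeftCLM_apply,
      ContinuousLinearMap.flip_apply, ContinuousAlternatingMap.apply_apply,
      ContinuousLinearMap.coe_fst', ContinuousLinearMap.coe_snd', ContinuousLinearMap.apply_apply,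
      ContinuousAlternatingMap.add_apply, sum_apply,
      smul_apply, smul_eq_mul, zero_apply,
      mul_add, Finset.sum_add_distrib,
      Pi.add_apply, clifford_apply, cliffordAct, spinorFDeriv_apply, covWedge_apply] at this ⊢
    change _ = (0 : ℝ)
    simp only [mul_comm (φ x k _)] at this
    linarith

end SmoothForms

/-! ### The Courant identity in a coordinate space -/

section Courant

open Topology

variable {V : Type*} [NormedAddCommGroup V] [NormedSpace ℝ V]

/-- The integrability of the subbundle with frame `w` at the point `y` of a coordinate space,
relative to the value `η` at `y` of a 3-form: for all constant combinations `w₀, w₁, w₂` of the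
frame, with vector components `v₀, v₁, v₂`, one has
`⟨w₀, ∂_{v₁} w₂⟩ - ⟨w₀, ∂_{v₂} w₁⟩ - ⟨w₁, ∂_{v₀} w₂⟩ = η(v₀, v₁, v₂)`.
This is the vanishing of the Courant tensor, written out with the flat derivative. -/
def CourantIdentityAt {m : ℕ} (w : Fin m → V → V × (V →L[ℝ] ℝ)) (η : V [⋀^Fin 3]→L[ℝ] ℝ)
    (y : V) : Prop :=
  ∀ c₀ c₁ c₂ : Fin m → ℝ,
    let w' (c : Fin m → ℝ) : V × (V →L[ℝ] ℝ) := ∑ i, c i • w i y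
    let dw (c : Fin m → ℝ) (u : V) : V × (V →L[ℝ] ℝ) := ∑ i, c i • fderiv ℝ (w i) y u
    pairing (w' c₀) (dw c₂ (w' c₁).1) - pairing (w' c₀) (dw c₁ (w' c₂).1)
      - pairing (w' c₁) (dw c₂ (w' c₀).1) = η ![(w' c₀).1, (w' c₁).1, (w' c₂).1]

/-- If `(d + η) φ` is killed by the products of three elements of the null space of the pure
spinor `φ`, then the Courant identity holds. -/
theorem courantIdentityAt_of_spinor [FiniteDimensional ℝ V] {m : ℕ}
    {w : Fin m → V → V × (V →L[ℝ] ℝ)} {η : V [⋀^Fin 3]→L[ℝ] ℝ} {y : V} {φ : V → Spinor V}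
    {δ : Spinor V} (hδ₀ : δ 0 = 0) (hδ : ∀ k, δ (k + 1) = extDeriv (fun y => φ y k) y)
    (hφ : ∀ k, DifferentiableAt ℝ (fun y => φ y k) y) (hw : ∀ i, DifferentiableAt ℝ (w i) y)
    (h : ∀ᶠ z in 𝓝 y, ∀ i, clifford (w i z) (φ z) = 0) (h0 : φ y ≠ 0)
    (hint : ∀ w₀ ∈ Submodule.span ℝ (Set.range fun i => w i y),
      ∀ w₁ ∈ Submodule.span ℝ (Set.range fun i => w i y),
      ∀ w₂ ∈ Submodule.span ℝ (Set.range fun i => w i y),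
      clifford w₀ (clifford w₁ (clifford w₂ (δ + spinorWedge₃ η (φ y)))) = 0) :
    CourantIdentityAt w η y := by
  intro c₀ c₁ c₂ w' dw
  have hmem (c : Fin m → ℝ) : w' c ∈ Submodule.span ℝ (Set.range fun i => w i y) :=
    Submodule.sum_mem _ fun i _ => Submodule.smul_mem _ _ (Submodule.subset_span ⟨i, rfl⟩)
  let dw' (c : Fin m → ℝ) : V →ₗ[ℝ] V × (V →L[ℝ] ℝ) :=
    ∑ i, c i • (fderiv ℝ (w i) y).toLinearMap
  have hdw (c : Fin m → ℝ) (u : V) : dw' c u = dw c u := by simp [dw', dw]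
  have hk (c : Fin m → ℝ) : clifford (w' c) (φ y) = 0 := by
    simp [w', LinearMap.sum_apply, h.self_of_nhds]
  have hd (c : Fin m → ℝ) (u : V) :
      clifford (w' c) (spinorFDeriv φ y u) = -clifford (dw' c u) (φ y) := by
    simp only [hdw, w', dw, map_sum, map_smul, LinearMap.sum_apply, LinearMap.smul_apply,
      ← Finset.sum_neg_distrib]
    refine Finset.sum_congr rfl fun i _ => ?_
    rw [clifford_spinorFDeriv hφ (hw i) (h.mono fun z hz => hz i), smul_neg]
  have hδ' : δ = ∑ a, clifford (0, dualBasis a)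
      (spinorFDeriv φ y (Module.finBasis ℝ V a)) := by
    funext k
    cases k with
    | zero => simp [hδ₀, Finset.sum_apply, clifford_covector_zero]
    | succ k =>
      simp only [hδ, extDeriv, exteriorDerivative_eq_sum, Finset.sum_apply,
        clifford_covector_succ, spinorFDeriv_apply]
  have key := hint _ (hmem c₀) _ (hmem c₁) _ (hmem c₂)
  rw [map_add, map_add, map_add, clifford_three_wedge₃ _ _ _ _ _ (hk c₀) (hk c₁) (hk c₂), hδ',
    clifford_three_derivative (φ y) (spinorFDeriv φ y) _ _ _ (dw' c₁) (dw' c₂) (hk c₀) (hk c₁)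
      (hd c₁) (hd c₂)] at key
  have key' := (add_smul _ _ (φ y)).trans key
  have := (smul_eq_zero.1 key').resolve_right h0
  simp only [hdw] at this
  linarith

end Courant

/-! ### The induced 2-form in coordinates -/

section Induced

open Topology

variable {V : Type*} [NormedAddCommGroup V] [NormedSpace ℝ V]
  {W : Type*} [NormedAddCommGroup W] [NormedSpace ℝ W]

/-- If the vectors `vᵢ` along an immersion `f` are tangent to it and span its tangent space at
`z`, then near `z` every tangent vector of `f` is a combination of the `vᵢ`, with coefficients that
depend smoothly on the point. -/
theorem exists_smooth_coefficients [FiniteDimensional ℝ W] {m : ℕ} {f : W → V} {v : Fin m → W → V}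
    {z : W} (hf : ContDiffAt ℝ ∞ f z) (hv : ∀ i, ContDiffAt ℝ ∞ (v i) z)
    (hinj : Function.Injective (fderiv ℝ f z))
    (htan : ∀ᶠ z' in 𝓝 z, ∀ i, v i z' ∈ Set.range (fderiv ℝ f z'))
    (hspan : ∀ u, ∃ c : Fin m → ℝ, ∑ i, c i • v i z = fderiv ℝ f z u) [FiniteDimensional ℝ V] :
    ∃ C : W → W →L[ℝ] (Fin m → ℝ), ContDiffAt ℝ ∞ C z ∧
      ∀ᶠ z' in 𝓝 z, ∀ u, ∑ i, C z' u i • v i z' = fderiv ℝ f z' u := by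
  have hcomp : CompleteSpace W := FiniteDimensional.complete ℝ W
  have hdf : ContDiffAt ℝ ∞ (fderiv ℝ f) z := hf.fderiv_right (by simp)
  obtain ⟨P', hP'⟩ := (fderiv ℝ f z).toLinearMap.exists_leftInverse_of_injective
    (LinearMap.ker_eq_bot.2 hinj)
  let P : V →L[ℝ] W := LinearMap.toContinuousLinearMap P'
  have hP (u : W) : P (fderiv ℝ f z u) = u := LinearMap.congr_fun hP' u
  -- Both `P ∘ f'` and `P ∘ (c ↦ ∑ cᵢ vᵢ)` are onto at `z`; the coefficients come from a right
  -- inverse of the second, which exists near `z`.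
  let A : W → W →L[ℝ] W := fun z' => P.comp (fderiv ℝ f z')
  have hA : ContDiffAt ℝ ∞ A z := contDiffAt_const.clm_comp hdf
  let K : W → (Fin m → ℝ) →L[ℝ] W := fun z' =>
    ∑ i, (ContinuousLinearMap.proj i).smulRight (P (v i z'))
  have hK_apply (z' : W) (c : Fin m → ℝ) : K z' c = P (∑ i, c i • v i z') := by
    simp [K]
  have hK : ContDiffAt ℝ ∞ K z := by
    refine ContDiffAt.sum fun i _ => ?_
    exact contDiffAt_const.smulRight (contDiffAt_const.clm_apply (hv i))
  have hKz : Function.Surjective (K z) := fun u => by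
    obtain ⟨c, hc⟩ := hspan u
    exact ⟨c, by rw [hK_apply, hc, hP]⟩
  obtain ⟨R, hR⟩ := (K z).exists_rightInverse_of_surjective (LinearMap.range_eq_top.2 hKz)
  let B : W → W →L[ℝ] W := fun z' => (K z').comp R
  have hB : ContDiffAt ℝ ∞ B z := hK.clm_comp contDiffAt_const
  have hAz : A z = 1 := ContinuousLinearMap.ext hP
  have hBz : B z = 1 := hR
  have hBinv : ContDiffAt ℝ ∞ (fun z' => Ring.inverse (B z')) z := by
    have h1 : ContDiffAt ℝ ∞ Ring.inverse (B z) := by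
      rw [hBz]; exact contDiffAt_ringInverse ℝ (1 : (W →L[ℝ] W)ˣ)
    exact h1.comp z hB
  have hunit {F : W → W →L[ℝ] W} (hF : ContDiffAt ℝ ∞ F z) (h1 : F z = 1) :
      ∀ᶠ z' in 𝓝 z, IsUnit (F z') := by
    refine hF.continuousAt.eventually_mem (Units.isOpen.mem_nhds ?_)
    rw [h1]; exact isUnit_one
  refine ⟨fun z' => R.comp ((Ring.inverse (B z')).comp (A z')),
    contDiffAt_const.clm_comp (hBinv.clm_comp hA), ?_⟩
  filter_upwards [hunit hA hAz, hunit hB hBz, htan] with z' hAu hBu ht u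
  set c := R (Ring.inverse (B z') (A z' u)) with hc
  have h1 : P (∑ i, c i • v i z') = A z' u := by
    rw [← hK_apply, hc]
    change (B z' * Ring.inverse (B z')) (A z' u) = _
    rw [Ring.mul_inverse_cancel _ hBu]; rfl
  choose a ha using ht
  have h2 : ∑ i, c i • v i z' = fderiv ℝ f z' (∑ i, c i • a i) := by simp [ha]
  have h3 : A z' (∑ i, c i • a i) = A z' u := by rw [← h1, h2]; rfl
  have h4 : ∑ i, c i • a i = u := by
    have hinv (x : W) : Ring.inverse (A z') (A z' x) = x := by
      change (Ring.inverse (A z') * A z') x = x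
      rw [Ring.inverse_mul_cancel _ hAu]; rfl
    rw [← hinv u, ← h3, hinv]
  change ∑ i, c i • v i z' = _
  rw [h2, h4]

theorem contDiffAt_lift {m : ℕ} {f : W → V}
    {w : Fin m → V → V × (V →L[ℝ] ℝ)} {z : W} {C : W → W →L[ℝ] (Fin m → ℝ)} (hf : ContDiffAt ℝ ∞ f z)
    (hw : ∀ i, ContDiffAt ℝ ∞ (w i) (f z)) (hC : ContDiffAt ℝ ∞ C z) (u : W) :
    ContDiffAt ℝ ∞ (fun z' => ∑ i, C z' u i • w i (f z')) z :=
  ContDiffAt.sum fun i _ => (contDiffAt_pi.1 (hC.clm_apply contDiffAt_const) i).smul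
    ((hw i).comp z hf)

section

variable [FiniteDimensional ℝ V] [FiniteDimensional ℝ W] {m : ℕ} {f : W → V}
  {w : Fin m → V → V × (V →L[ℝ] ℝ)} {z : W} {τ : W → W [⋀^Fin 2]→L[ℝ] ℝ}

theorem minSmoothness_two_le_infty : minSmoothness ℝ 2 ≤ ∞ := by
  rw [minSmoothness_of_isRCLikeNormedField]
  exact WithTop.coe_le_coe.2 (le_top : (2 : ℕ∞) ≤ ⊤)

/-- Near `z`, tangent vectors of the integral manifold `f` have smooth lifts to sections along
`f` of the subbundle with frame `w`, and the induced form `τ` is computed with them. -/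
theorem exists_smooth_lift (hf : ContDiffAt ℝ ∞ f z) (hw : ∀ i, ContDiffAt ℝ ∞ (w i) (f z))
    (hinj : Function.Injective (fderiv ℝ f z))
    (hran : ∀ᶠ z' in 𝓝 z, ∀ v, v ∈ Set.range (fderiv ℝ f z') ↔
      ∃ c : Fin m → ℝ, ∑ i, c i • (w i (f z')).1 = v)
    (hτ : ∀ᶠ z' in 𝓝 z, ∀ (u₁ u₂ : W) (c : Fin m → ℝ),
      ∑ i, c i • (w i (f z')).1 = fderiv ℝ f z' u₁ →
        τ z' ![u₁, u₂] = (∑ i, c i • (w i (f z')).2) (fderiv ℝ f z' u₂)) :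
    ∃ C : W → W →L[ℝ] (Fin m → ℝ), ContDiffAt ℝ ∞ C z ∧
      ∀ᶠ z' in 𝓝 z, ∀ u, (∑ i, C z' u i • w i (f z')).1 = fderiv ℝ f z' u ∧
        ∀ u₂, τ z' ![u, u₂] = (∑ i, C z' u i • w i (f z')).2 (fderiv ℝ f z' u₂) := by
  obtain ⟨C, hC, h⟩ := exists_smooth_coefficients (v := fun i z' => (w i (f z')).1) hf
    (fun i => ((hw i).comp z hf).fst) hinj
    (hran.mono fun z' h i => (h _).2 ⟨Pi.single i 1, by
      rw [Finset.sum_eq_single i (fun j _ hj => by simp [Pi.single_eq_of_ne hj]) (by simp)]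
      simp⟩)
    (fun u => (hran.self_of_nhds _).1 ⟨u, rfl⟩)
  refine ⟨C, hC, ?_⟩
  filter_upwards [h, hτ] with z' h hτ u
  refine ⟨by rw [← h u, Prod.fst_sum]; rfl, fun u₂ => ?_⟩
  rw [hτ u u₂ (C z' u) (h u), Prod.snd_sum]
  rfl

/-- The induced 2-form is smooth. -/
theorem contDiffAt_inducedForm (hf : ContDiffAt ℝ ∞ f z) (hw : ∀ i, ContDiffAt ℝ ∞ (w i) (f z))
    (hinj : Function.Injective (fderiv ℝ f z))
    (hran : ∀ᶠ z' in 𝓝 z, ∀ v, v ∈ Set.range (fderiv ℝ f z') ↔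
      ∃ c : Fin m → ℝ, ∑ i, c i • (w i (f z')).1 = v)
    (hτ : ∀ᶠ z' in 𝓝 z, ∀ (u₁ u₂ : W) (c : Fin m → ℝ),
      ∑ i, c i • (w i (f z')).1 = fderiv ℝ f z' u₁ →
        τ z' ![u₁, u₂] = (∑ i, c i • (w i (f z')).2) (fderiv ℝ f z' u₂)) :
    ContDiffAt ℝ ∞ τ z := by
  obtain ⟨C, hC, h⟩ := exists_smooth_lift hf hw hinj hran hτ
  refine contDiffAt_continuousAlternatingMap_of_apply fun v => ?_
  have hdf : ContDiffAt ℝ ∞ (fderiv ℝ f) z := hf.fderiv_right (by simp)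
  refine ((contDiffAt_lift hf hw hC (v 0)).snd.clm_apply
    (hdf.clm_apply (contDiffAt_const (c := v 1)))).congr_of_eventuallyEq ?_
  filter_upwards [h] with z' h
  rw [← (h (v 0)).2 (v 1)]
  congr 1
  funext i
  fin_cases i <;> rfl

/-- By the Courant identity, the exterior derivative of the induced 2-form is the pullback of the
3-form. -/
theorem extDeriv_inducedForm (hf : ContDiffAt ℝ ∞ f z) (hw : ∀ i, ContDiffAt ℝ ∞ (w i) (f z))
    (hinj : Function.Injective (fderiv ℝ f z))
    (hran : ∀ᶠ z' in 𝓝 z, ∀ v, v ∈ Set.range (fderiv ℝ f z') ↔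
      ∃ c : Fin m → ℝ, ∑ i, c i • (w i (f z')).1 = v)
    (hτ : ∀ᶠ z' in 𝓝 z, ∀ (u₁ u₂ : W) (c : Fin m → ℝ),
      ∑ i, c i • (w i (f z')).1 = fderiv ℝ f z' u₁ →
        τ z' ![u₁, u₂] = (∑ i, c i • (w i (f z')).2) (fderiv ℝ f z' u₂))
    (hiso : ∀ i j, pairing (w i (f z)) (w j (f z)) = 0)
    {η : V [⋀^Fin 3]→L[ℝ] ℝ} (hη : CourantIdentityAt w η (f z)) :
    extDeriv τ z = η.compContinuousLinearMap (fderiv ℝ f z) := by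
  obtain ⟨C, hC, h⟩ := exists_smooth_lift hf hw hinj hran hτ
  have hdf : DifferentiableAt ℝ (fderiv ℝ f) z :=
    (hf.fderiv_right (m := ∞) (by simp)).differentiableAt (by simp)
  -- The lift of `u` and its derivative.
  let l : W → W → V × (V →L[ℝ] ℝ) := fun u z' => ∑ i, C z' u i • w i (f z')
  have hl (u : W) : DifferentiableAt ℝ (l u) z :=
    (contDiffAt_lift hf hw hC u).differentiableAt (by simp)
  have hl1 (u : W) : (fun z' => (l u z').1) =ᶠ[𝓝 z] fun z' => fderiv ℝ f z' u :=
    h.mono fun z' h => (h u).1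
  have hlz (u : W) : (l u z).1 = fderiv ℝ f z u := (hl1 u).self_of_nhds
  have hτl (u₁ u₂ : W) : (fun z' => τ z' ![u₁, u₂]) =ᶠ[𝓝 z] fun z' => (l u₁ z').2 (l u₂ z').1 :=
    h.mono fun z' h => by
      simp only [l]
      rw [(h u₂).1, (h u₁).2 u₂]
  have hsymm (u₁ u₂ : W) : (fderiv ℝ (l u₁) z u₂).1 = (fderiv ℝ (l u₂) z u₁).1 := by
    have h1 (u₁ u₂ : W) : (fderiv ℝ (l u₁) z u₂).1 = fderiv ℝ (fderiv ℝ f) z u₂ u₁ := by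
      have e1 := (hl u₁).hasFDerivAt.fst.unique
        ((hl1 u₁).hasFDerivAt_iff.2 (hdf.hasFDerivAt.clm_apply (hasFDerivAt_const u₁ z)))
      simpa using congrArg (fun L : W →L[ℝ] V => L u₂) e1
    rw [h1, h1]
    exact hf.isSymmSndFDerivAt minSmoothness_two_le_infty _ _
  have hdτ (u₁ u₂ u : W) : fderiv ℝ (fun z' => τ z' ![u₁, u₂]) z u =
      (fderiv ℝ (l u₁) z u).2 (l u₂ z).1 + (l u₁ z).2 (fderiv ℝ (l u₂) z u).1 := by
    rw [(hτl u₁ u₂).fderiv_eq,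
      ((hl u₁).hasFDerivAt.snd.clm_apply (hl u₂).hasFDerivAt.fst).fderiv]
    simp [add_comm]
  have hskew (u₁ u₂ u : W) : fderiv ℝ (fun z' => τ z' ![u₁, u₂]) z u =
      -fderiv ℝ (fun z' => τ z' ![u₂, u₁]) z u := by
    have : (fun z' => τ z' ![u₁, u₂]) = fun z' => -τ z' ![u₂, u₁] := by
      funext z'
      have h1 := (τ z').toAlternatingMap.map_swap ![u₂, u₁] (i := 0) (j := 1) (by decide)
      rw [← ContinuousAlternatingMap.coe_toAlternatingMap, ← h1]
      congr 1; funext i; fin_cases i <;> rfl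
    rw [this, fderiv_fun_neg]; rfl
  -- The derivatives of the coefficients do not contribute, since the subbundle is isotropic.
  have hcourant (u₀ u₁ u₂ : W) :
      pairing (l u₀ z) (fderiv ℝ (l u₂) z u₁) - pairing (l u₀ z) (fderiv ℝ (l u₁) z u₂)
        - pairing (l u₁ z) (fderiv ℝ (l u₂) z u₀) =
      η ![fderiv ℝ f z u₀, fderiv ℝ f z u₁, fderiv ℝ f z u₂] := by
    have hd (u u' : W) : fderiv ℝ (l u) z u' = ∑ i, (fderiv ℝ C z u' u i • w i (f z) +
        C z u i • fderiv ℝ (w i) (f z) (fderiv ℝ f z u')) := by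
      have hCd : HasFDerivAt C (fderiv ℝ C z) z := (hC.differentiableAt (by simp)).hasFDerivAt
      have hfd : HasFDerivAt f (fderiv ℝ f z) z := (hf.differentiableAt (by simp)).hasFDerivAt
      have h1 (i : Fin m) := hasFDerivAt_pi'.1 (hCd.clm_apply (hasFDerivAt_const u z)) i
      have h2 (i : Fin m) :=
        (((hw i).differentiableAt (by simp)).hasFDerivAt).comp z hfd
      have h3 := HasFDerivAt.fun_sum (u := Finset.univ) fun i _ => (h1 i).smul (h2 i)
      have h4 : HasFDerivAt (l u) _ z := h3
      rw [h4.fderiv]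
      simp [add_comm]
    have hp (u₀ u₁ u₂ : W) : pairing (l u₀ z) (fderiv ℝ (l u₂) z u₁) =
        pairing (l u₀ z) (∑ i, C z u₂ i • fderiv ℝ (w i) (f z) (l u₁ z).1) := by
      rw [hd, Finset.sum_add_distrib, ← pairingForm_apply, map_add, ← pairingForm_apply, hlz]
      have : pairingForm (l u₀ z) (∑ i, fderiv ℝ C z u₁ u₂ i • w i (f z)) = 0 := by
        simp [l, pairingForm_apply, hiso]
      rw [this, zero_add]
    rw [hp, hp, hp, ← hlz, ← hlz, ← hlz]
    exact hη (C z u₀) (C z u₁) (C z u₂)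
  ext u
  have hu : u = ![u 0, u 1, u 2] := by funext i; fin_cases i <;> rfl
  have hη' := hcourant (u 0) (u 1) (u 2)
  have hτd : DifferentiableAt ℝ τ z :=
    (contDiffAt_inducedForm hf hw hinj hran hτ).differentiableAt (by simp)
  have hr0 : (0 : Fin 3).removeNth u = ![u 1, u 2] := by
    funext i; fin_cases i <;> rfl
  have hr1 : (1 : Fin 3).removeNth u = ![u 0, u 2] := by
    funext i; fin_cases i <;> rfl
  have hr2 : (2 : Fin 3).removeNth u = ![u 0, u 1] := by
    funext i; fin_cases i <;> rfl
  have hη'' : η.compContinuousLinearMap (fderiv ℝ f z) u =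
      η ![fderiv ℝ f z (u 0), fderiv ℝ f z (u 1), fderiv ℝ f z (u 2)] := by
    rw [ContinuousAlternatingMap.compContinuousLinearMap_apply]
    congr 1; funext i; fin_cases i <;> rfl
  rw [extDeriv_apply hτd, hη'', ← hη', Fin.sum_univ_three, hr0, hr1, hr2]
  have s1 := hskew (u 0) (u 1) (u 2)
  have s2 := hskew (u 0) (u 2) (u 1)
  have s3 := hskew (u 1) (u 2) (u 0)
  simp only [hdτ] at s1 s2 s3 ⊢
  simp only [pairing, hsymm (u 1) (u 0), hsymm (u 2) (u 0), hsymm (u 2) (u 1)] at s1 s2 s3 ⊢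
  simp
  linarith

end

end Induced

/-! ### Tangent maps of charts -/

section Charts

open Topology

variable {V : Type*} [NormedAddCommGroup V] [NormedSpace ℝ V]
  {M : Type*} [TopologicalSpace M] [ChartedSpace V M]
  {W : Type*} [NormedAddCommGroup W] [NormedSpace ℝ W]
  {S : Type*} [TopologicalSpace S] [ChartedSpace W S]
  {X : Type*} [NormedAddCommGroup X] [NormedSpace ℝ X]
  {N : Type*} [TopologicalSpace N] [ChartedSpace X N]

theorem tangent_comp {g : S → N} {f : M → S} {x : M}
    (hg : MDifferentiableAt 𝓘(ℝ, W) 𝓘(ℝ, X) g (f x))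
    (hf : MDifferentiableAt 𝓘(ℝ, V) 𝓘(ℝ, W) f x) :
    (tangent (fun y => g (f y)) x : V →L[ℝ] X) =
      (tangent g (f x) : W →L[ℝ] X).comp (tangent f x : V →L[ℝ] W) :=
  mfderiv_comp x hg hf

theorem tangent_eq_fderiv (f : V → W) (x : V) :
    (tangent (M := V) (S := W) f x : V →L[ℝ] W) = fderiv ℝ f x :=
  mfderiv_eq_fderiv

variable (V) in
/-- The derivative at `x` of the preferred chart at `x₀`. -/
abbrev chartD (x₀ x : M) : V →L[ℝ] V :=
  tangent (V := V) (W := V) (M := M) (S := V) (extChartAt 𝓘(ℝ, V) x₀) x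

/-- The derivative at `y` of the inverse of the preferred chart at `x₀`. -/
abbrev chartSymmD (x₀ : M) (y : V) : V →L[ℝ] V :=
  tangent (V := V) (W := V) (M := V) (S := M) (extChartAt 𝓘(ℝ, V) x₀).symm y

theorem isOpen_chartDomain (x₀ : M) {U : Set M} (hU : IsOpen U) :
    IsOpen (chartDomain (V := V) x₀ U) :=
  (continuousOn_extChartAt_symm x₀).isOpen_inter_preimage (isOpen_extChartAt_target x₀) hU

theorem eventually_mem_source {f : S → M} {s₀ : S} {z : W}
    (hz : z ∈ (extChartAt 𝓘(ℝ, W) s₀).target)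
    (hf : ContinuousAt f ((extChartAt 𝓘(ℝ, W) s₀).symm z)) {U : Set M} (hU : IsOpen U)
    (hx : f ((extChartAt 𝓘(ℝ, W) s₀).symm z) ∈ U) :
    ∀ᶠ z' in 𝓝 z, z' ∈ (extChartAt 𝓘(ℝ, W) s₀).target ∧
      f ((extChartAt 𝓘(ℝ, W) s₀).symm z') ∈ U := by
  have h1 : ContinuousAt (fun z => f ((extChartAt 𝓘(ℝ, W) s₀).symm z)) z :=
    ContinuousAt.comp hf (continuousAt_extChartAt_symm'' hz)
  exact Filter.Eventually.and (extChartAt_target_mem_nhds' hz) (h1.eventually_mem (hU.mem_nhds hx))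

section Manifold

variable [IsManifold 𝓘(ℝ, V) ∞ M]

theorem contMDiffAt_extChartAt_symm {x₀ : M} {y : V} (hy : y ∈ (extChartAt 𝓘(ℝ, V) x₀).target) :
    ContMDiffAt 𝓘(ℝ, V) 𝓘(ℝ, V) ∞ (extChartAt 𝓘(ℝ, V) x₀).symm y :=
  (contMDiffOn_extChartAt_symm x₀).contMDiffAt (extChartAt_target_mem_nhds' hy)

theorem contMDiffAt_extChartAt_of_mem {x₀ x : M} (hx : x ∈ (extChartAt 𝓘(ℝ, V) x₀).source) :
    ContMDiffAt 𝓘(ℝ, V) 𝓘(ℝ, V) ∞ (extChartAt 𝓘(ℝ, V) x₀) x :=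
  contMDiffAt_extChartAt' (by rwa [extChartAt_source] at hx)

theorem chartD_chartSymmD {x₀ : M} {y : V} (hy : y ∈ (extChartAt 𝓘(ℝ, V) x₀).target) (v : V) :
    chartD V x₀ ((extChartAt 𝓘(ℝ, V) x₀).symm y) (chartSymmD x₀ y v) = v := by
  have : IsManifold 𝓘(ℝ, V) 1 M := IsManifold.of_le (n := ∞) (by simp)
  have h := mfderiv_extChartAt_comp_mfderivWithin_extChartAt_symm (I := 𝓘(ℝ, V)) hy
  rw [modelWithCornersSelf_coe, Set.range_id, mfderivWithin_univ] at h
  exact congrArg (fun L : V →L[ℝ] V => L v) h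

theorem chartSymmD_chartD {x₀ : M} {y : V} (hy : y ∈ (extChartAt 𝓘(ℝ, V) x₀).target) (v : V) :
    chartSymmD x₀ y (chartD V x₀ ((extChartAt 𝓘(ℝ, V) x₀).symm y) v) = v := by
  have : IsManifold 𝓘(ℝ, V) 1 M := IsManifold.of_le (n := ∞) (by simp)
  have h := mfderivWithin_extChartAt_symm_comp_mfderiv_extChartAt (I := 𝓘(ℝ, V)) hy
  rw [modelWithCornersSelf_coe, Set.range_id, mfderivWithin_univ] at h
  exact congrArg (fun L : V →L[ℝ] V => L v) h

theorem chartD_self (x : M) : chartD V x x = ContinuousLinearMap.id ℝ V := by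
  have : IsManifold 𝓘(ℝ, V) 1 M := IsManifold.of_le (n := ∞) (by simp)
  exact mfderiv_extChartAt_self (I := 𝓘(ℝ, V)) (x := x)

theorem chartSymmD_self (x : M) :
    chartSymmD x (extChartAt 𝓘(ℝ, V) x x) = ContinuousLinearMap.id ℝ V := by
  have : IsManifold 𝓘(ℝ, V) 1 M := IsManifold.of_le (n := ∞) (by simp)
  have h := mfderivWithin_range_extChartAt_symm (I := 𝓘(ℝ, V)) (x := x)
  rw [modelWithCornersSelf_coe, Set.range_id, mfderivWithin_univ] at h
  exact h

variable [IsManifold 𝓘(ℝ, W) ∞ S]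

/-- The expression of a map `f : S → M` in the preferred charts at `s₀` and `x₀`. -/
def inCharts (f : S → M) (s₀ : S) (x₀ : M) (z : W) : V :=
  extChartAt 𝓘(ℝ, V) x₀ (f ((extChartAt 𝓘(ℝ, W) s₀).symm z))

theorem contDiffAt_inCharts {f : S → M} {s₀ : S} {x₀ : M} {z : W}
    (hz : z ∈ (extChartAt 𝓘(ℝ, W) s₀).target)
    (hf : ContMDiffAt 𝓘(ℝ, W) 𝓘(ℝ, V) ∞ f ((extChartAt 𝓘(ℝ, W) s₀).symm z))
    (hx : f ((extChartAt 𝓘(ℝ, W) s₀).symm z) ∈ (extChartAt 𝓘(ℝ, V) x₀).source) :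
    ContDiffAt ℝ ∞ (inCharts (V := V) f s₀ x₀) z :=
  contMDiffAt_iff_contDiffAt.1 ((contMDiffAt_extChartAt_of_mem hx).comp z
    (hf.comp z (contMDiffAt_extChartAt_symm hz)))

theorem fderiv_inCharts {f : S → M} {s₀ : S} {x₀ : M} {z : W}
    (hz : z ∈ (extChartAt 𝓘(ℝ, W) s₀).target)
    (hf : MDifferentiableAt 𝓘(ℝ, W) 𝓘(ℝ, V) f ((extChartAt 𝓘(ℝ, W) s₀).symm z))
    (hx : f ((extChartAt 𝓘(ℝ, W) s₀).symm z) ∈ (extChartAt 𝓘(ℝ, V) x₀).source) (u : W) :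
    fderiv ℝ (inCharts (V := V) f s₀ x₀) z u =
      chartD V x₀ (f ((extChartAt 𝓘(ℝ, W) s₀).symm z))
        (tangent f ((extChartAt 𝓘(ℝ, W) s₀).symm z) (chartSymmD s₀ z u)) := by
  have h1 := (contMDiffAt_extChartAt_of_mem hx).mdifferentiableAt (by simp)
  have h2 := (contMDiffAt_extChartAt_symm hz).mdifferentiableAt (by simp)
  rw [← tangent_eq_fderiv]
  have e1 := tangent_comp (M := W) (S := M) (N := V) (x := z) h1 (hf.comp z h2)
  have e2 := tangent_comp (M := W) (S := S) (N := M) (x := z) hf h2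
  exact (congrArg (fun L : W →L[ℝ] V => L u) e1).trans
    (congrArg (fun L : W →L[ℝ] V => chartD V x₀ (f ((extChartAt 𝓘(ℝ, W) s₀).symm z)) (L u)) e2)

end Manifold

end Charts

/-! ### Sections and spinors in charts, and local pure spinors -/

section PureSpinors

open Topology

variable {V : Type*} [NormedAddCommGroup V] [NormedSpace ℝ V]

/-- The pullback of a spinor under a linear map, degree by degree. -/
def spinorPullback {W : Type*} [NormedAddCommGroup W] [NormedSpace ℝ W] (φ : Spinor V)
    (A : W →L[ℝ] V) : Spinor W :=
  fun k => (φ k).compContinuousLinearMap A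

theorem spinorPullback_id (φ : Spinor V) :
    spinorPullback φ (ContinuousLinearMap.id ℝ V) = φ := by
  funext k
  ext v
  rfl

theorem spinorPullback_comp (φ : Spinor V) (A B : V →L[ℝ] V) :
    spinorPullback (spinorPullback φ A) B = spinorPullback φ (A.comp B) := by
  funext k
  ext v
  rfl

/-- The Clifford action is natural with respect to linear isomorphisms. -/
theorem spinorPullback_clifford (w : V × (V →L[ℝ] ℝ)) (φ : Spinor V) {A B : V →L[ℝ] V}
    (h : ∀ v, A (B v) = v) :
    spinorPullback (clifford w φ) A = clifford (B w.1, w.2.comp A) (spinorPullback φ A) := by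
  have h1 (k : ℕ) : ((φ (k + 1)).curryLeft w.1).compContinuousLinearMap A =
      (spinorPullback φ A (k + 1)).curryLeft (B w.1) := by
    rw [spinorPullback, ContinuousAlternatingMap.curryLeft_compContinuousLinearMap, h]
  funext k
  cases k with
  | zero => exact h1 0
  | succ k =>
    refine Eq.trans ?_ (congrArg₂ (· + ·) (h1 (k + 1)) (?_ :
      (covWedge w.2 (φ k)).compContinuousLinearMap A =
        covWedge (w.2.comp A) (spinorPullback φ A k)))
    · rfl
    · ext v
      simp only [ContinuousAlternatingMap.compContinuousLinearMap_apply, covWedge_apply]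
      rfl

theorem spinorPullback_cliffordProd {m : ℕ} (w : Fin m → V × (V →L[ℝ] ℝ)) (φ : Spinor V)
    {A B : V →L[ℝ] V} (h : ∀ v, A (B v) = v) :
    spinorPullback (cliffordProd w φ) A =
      cliffordProd (fun i => (B (w i).1, (w i).2.comp A)) (spinorPullback φ A) := by
  induction m with
  | zero => rfl
  | succ m ih => rw [cliffordProd, spinorPullback_clifford _ _ h, ih]; rfl

variable {M : Type*} [TopologicalSpace M] [ChartedSpace V M]

/-- The expression of a section of `TM ⊕ T*M` in the preferred chart at `x₀`. -/
def secInChart (w : M → V × (V →L[ℝ] ℝ)) (x₀ : M) (y : V) : V × (V →L[ℝ] ℝ) :=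
  (chartD V x₀ ((extChartAt 𝓘(ℝ, V) x₀).symm y) (w ((extChartAt 𝓘(ℝ, V) x₀).symm y)).1,
    (w ((extChartAt 𝓘(ℝ, V) x₀).symm y)).2.comp (chartSymmD x₀ y))

theorem SmoothSectionOn.contDiffAt {w : M → V × (V →L[ℝ] ℝ)} {U : Set M}
    (h : SmoothSectionOn w U) (hU : IsOpen U) {x₀ : M} {y : V}
    (hy : y ∈ (extChartAt 𝓘(ℝ, V) x₀).target) (hyU : (extChartAt 𝓘(ℝ, V) x₀).symm y ∈ U) :
    ContDiffAt ℝ ∞ (secInChart w x₀) y := by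
  have hn : chartDomain x₀ U ∈ 𝓝 y := (isOpen_chartDomain x₀ hU).mem_nhds ⟨hy, hyU⟩
  exact ((h x₀).1.contDiffAt hn).prodMk ((h x₀).2.contDiffAt hn)

theorem formInChart_eq_spinorPullback (φ : M → Spinor V) (x₀ : M) (y : V) (k : ℕ) :
    formInChart (fun x => φ x k) x₀ y =
      spinorPullback (φ ((extChartAt 𝓘(ℝ, V) x₀).symm y)) (chartSymmD x₀ y) k := rfl

theorem SmoothFormOn.of_contDiffAt {k : ℕ} {σ : M → V [⋀^Fin k]→L[ℝ] ℝ} {U : Set M}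
    (h : ∀ (x₀ : M) (y : V), y ∈ (extChartAt 𝓘(ℝ, V) x₀).target →
      (extChartAt 𝓘(ℝ, V) x₀).symm y ∈ U → ContDiffAt ℝ ∞ (formInChart σ x₀) y) :
    SmoothFormOn σ U :=
  fun x₀ y hy => (h x₀ y hy.1 hy.2).contDiffWithinAt

variable [IsManifold 𝓘(ℝ, V) ∞ M]

theorem secInChart_self (w : M → V × (V →L[ℝ] ℝ)) (x : M) :
    secInChart w x (extChartAt 𝓘(ℝ, V) x x) = w x := by
  rw [secInChart, chartSymmD_self, extChartAt_to_inv, chartD_self]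
  rfl

theorem extD_eq_extDeriv {k : ℕ} (σ : M → V [⋀^Fin k]→L[ℝ] ℝ) (x : M) :
    extD σ x = extDeriv (formInChart σ x) (extChartAt 𝓘(ℝ, V) x x) := by
  have h : extD σ x = (extDeriv (formInChart σ x)
    (extChartAt 𝓘(ℝ, V) x x)).compContinuousLinearMap (chartD V x x) := rfl
  rw [h, chartD_self]
  rfl

variable [FiniteDimensional ℝ V]

/-- An almost Dirac structure with a frame `w` near `x₀` is, near `x₀`, the null space of a smooth
pure spinor: the product of the Clifford actions of the frame on a form that is constant in
the chart. -/
theorem exists_smooth_pureSpinor {E : M → Submodule ℝ (V × (V →L[ℝ] ℝ))}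
    (hE : ∀ x, IsLagrangian (E x)) {x₀ : M} {U : Set M} (hU : IsOpen U) (hx₀ : x₀ ∈ U) {m : ℕ}
    {w : Fin m → M → V × (V →L[ℝ] ℝ)} (hw : ∀ i, SmoothSectionOn (w i) U)
    (hli : LinearIndependent ℝ fun i => w i x₀)
    (hspan : ∀ x ∈ U, E x = Submodule.span ℝ (Set.range fun i => w i x)) :
    ∃ (U' : Set M) (φ : M → Spinor V), IsOpen U' ∧ x₀ ∈ U' ∧
      (∀ k, SmoothFormOn (fun x => φ x k) U') ∧ ∀ x ∈ U', IsPureSpinorOf (E x) (φ x) := by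
  obtain ⟨ψ₀, hψ₀⟩ := exists_cliffordProd_ne_zero _ hli
  let ψ : M → Spinor V := fun x => spinorPullback ψ₀ (chartD V x₀ x)
  let φ : M → Spinor V := fun x => cliffordProd (fun i => w i x) (ψ x)
  -- The coordinate expression of `φ` in any chart is a product of Clifford actions.
  have hφ (x₁ : M) (y : V) (hy : y ∈ (extChartAt 𝓘(ℝ, V) x₁).target) :
      spinorPullback (φ ((extChartAt 𝓘(ℝ, V) x₁).symm y)) (chartSymmD x₁ y) =
        cliffordProd (fun i => secInChart (w i) x₁ y) (spinorPullback ψ₀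
          ((chartD V x₀ ((extChartAt 𝓘(ℝ, V) x₁).symm y)).comp (chartSymmD x₁ y))) := by
    rw [spinorPullback_cliffordProd _ _ (chartSymmD_chartD hy), spinorPullback_comp]
    rfl
  have hsmooth (x₁ : M) (y : V) (hy : y ∈ (extChartAt 𝓘(ℝ, V) x₁).target)
      (hyU : (extChartAt 𝓘(ℝ, V) x₁).symm y ∈ U)
      (hy₀ : (extChartAt 𝓘(ℝ, V) x₁).symm y ∈ (extChartAt 𝓘(ℝ, V) x₀).source) (k : ℕ) :
      ContDiffAt ℝ ∞ (formInChart (fun x => φ x k) x₁) y := by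
    let t : V → V := inCharts (V := V) (M := M) (S := M) id x₁ x₀
    have ht : ContDiffAt ℝ ∞ t y := contDiffAt_inCharts hy contMDiffAt_id hy₀
    have hdt : ContDiffAt ℝ ∞ (fderiv ℝ t) y := ht.fderiv_right (by simp)
    have h1 : ContDiffAt ℝ ∞ (fun y' => cliffordProd (fun i => secInChart (w i) x₁ y')
        (spinorPullback ψ₀ (fderiv ℝ t y')) k) y := by
      refine contDiffAt_cliffordProd (fun k => ?_) (fun i => (hw i).contDiffAt hU hy hyU) k
      refine contDiffAt_continuousAlternatingMap_of_apply fun v => ?_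
      exact (contDiffAt_const (c := ψ₀ k)).continuousAlternatingMap_apply fun i =>
        hdt.clm_apply contDiffAt_const
    refine h1.congr_of_eventuallyEq ?_
    filter_upwards [eventually_mem_source (f := id) hy continuousAt_id
      (isOpen_extChartAt_source (I := 𝓘(ℝ, V)) x₀) hy₀] with y' hy'
    rw [formInChart_eq_spinorPullback, hφ x₁ y' hy'.1]
    congr 2
    ext v
    have h2 := fderiv_inCharts (M := M) (S := M) (f := id) hy'.1 mdifferentiableAt_id hy'.2 v
    refine Eq.trans ?_ h2.symm
    have h3 : (tangent (id : M → M) ((extChartAt 𝓘(ℝ, V) x₁).symm y') : V →L[ℝ] V) =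
      ContinuousLinearMap.id ℝ V := mfderiv_id
    rw [h3]
    rfl
  have hx₀s := mem_extChartAt_source (I := 𝓘(ℝ, V)) x₀
  have hφx₀ : φ x₀ ≠ 0 := by
    simpa only [φ, ψ, chartD_self, spinorPullback_id] using hψ₀
  -- `φ` does not vanish near `x₀`.
  have hne : ∀ᶠ x in 𝓝 x₀, φ x ≠ 0 := by
    obtain ⟨k, hk⟩ := Function.ne_iff.1 hφx₀
    have hy := mem_extChartAt_target (I := 𝓘(ℝ, V)) x₀
    have hinv := extChartAt_to_inv (I := 𝓘(ℝ, V)) x₀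
    have hc := (hsmooth x₀ _ hy (by rwa [hinv]) (by rwa [hinv]) k).continuousAt
    have hne := hc.eventually_ne (y := 0) (by
      rw [formInChart_eq_spinorPullback, hinv, chartSymmD_self, spinorPullback_id]; exact hk)
    have hcont := (continuousAt_extChartAt (I := 𝓘(ℝ, V)) x₀).eventually hne
    filter_upwards [hcont, extChartAt_source_mem_nhds (I := 𝓘(ℝ, V)) x₀] with x hx hxs h0
    refine hx ?_
    rw [formInChart_eq_spinorPullback, (extChartAt 𝓘(ℝ, V) x₀).left_inv hxs, h0]
    rfl
  obtain ⟨U₁, hU₁, hU₁o, hx₁⟩ := mem_nhds_iff.1 hne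
  refine ⟨U ∩ (extChartAt 𝓘(ℝ, V) x₀).source ∩ U₁, φ,
    (hU.inter (isOpen_extChartAt_source x₀)).inter hU₁o, ⟨⟨hx₀, hx₀s⟩, hx₁⟩,
    fun k => SmoothFormOn.of_contDiffAt fun x₁ y hy hyU => hsmooth x₁ y hy hyU.1.1 hyU.1.2 k,
    fun x hx => isPureSpinorOf_cliffordProd (hE x) _ (hspan x hx.1.1) _ (hU₁ hx.2)⟩

/-- For a Dirac structure, every local frame satisfies the Courant identity in the chart. -/
theorem IsDirac.courantIdentityAt {E : M → Submodule ℝ (V × (V →L[ℝ] ℝ))}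
    {η : M → V [⋀^Fin 3]→L[ℝ] ℝ} (hE : IsDirac E η) {x₀ : M} {U : Set M} (hU : IsOpen U)
    (hx₀ : x₀ ∈ U) {m : ℕ} {w : Fin m → M → V × (V →L[ℝ] ℝ)}
    (hw : ∀ i, SmoothSectionOn (w i) U) (hli : LinearIndependent ℝ fun i => w i x₀)
    (hspan : ∀ x ∈ U, E x = Submodule.span ℝ (Set.range fun i => w i x)) :
    CourantIdentityAt (fun i => secInChart (w i) x₀) (η x₀) (extChartAt 𝓘(ℝ, V) x₀ x₀) := by
  obtain ⟨U', φ, hU', hx₀', hφ, hpure⟩ :=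
    exists_smooth_pureSpinor hE.almostDirac.lagrangian hU hx₀ hw hli hspan
  have hinv := extChartAt_to_inv (I := 𝓘(ℝ, V)) x₀
  have hy := mem_extChartAt_target (I := 𝓘(ℝ, V)) x₀
  have hself : spinorPullback (φ ((extChartAt 𝓘(ℝ, V) x₀).symm (extChartAt 𝓘(ℝ, V) x₀ x₀)))
      (chartSymmD x₀ (extChartAt 𝓘(ℝ, V) x₀ x₀)) = φ x₀ := by
    rw [hinv, chartSymmD_self, spinorPullback_id]
  have hmem (x : M) (hx : x ∈ U) (i : Fin m) : w i x ∈ E x := by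
    rw [hspan x hx]; exact Submodule.subset_span ⟨i, rfl⟩
  refine courantIdentityAt_of_spinor (δ := spinorD φ x₀)
    (φ := fun y => spinorPullback (φ ((extChartAt 𝓘(ℝ, V) x₀).symm y)) (chartSymmD x₀ y))
    rfl (fun k => extD_eq_extDeriv _ _) (fun k => ?_) (fun i => ?_) ?_ ?_ ?_
  · have hn : chartDomain x₀ U' ∈ 𝓝 (extChartAt 𝓘(ℝ, V) x₀ x₀) :=
      (isOpen_chartDomain x₀ hU').mem_nhds ⟨hy, by rwa [Set.mem_preimage, hinv]⟩
    exact ((hφ k x₀).contDiffAt hn).differentiableAt (by simp)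
  · exact ((hw i).contDiffAt hU hy (by rwa [hinv])).differentiableAt (by simp)
  · filter_upwards [eventually_mem_source (f := id) hy continuousAt_id (hU.inter hU')
      (by rw [hinv]; exact ⟨hx₀, hx₀'⟩)] with y hy' i
    have h1 : clifford (w i ((extChartAt 𝓘(ℝ, V) x₀).symm y))
        (φ ((extChartAt 𝓘(ℝ, V) x₀).symm y)) = 0 :=
      ((hpure _ hy'.2.2).2.2 _).1 (hmem _ hy'.2.1 i)
    have h2 := spinorPullback_clifford (w i ((extChartAt 𝓘(ℝ, V) x₀).symm y))
      (φ ((extChartAt 𝓘(ℝ, V) x₀).symm y)) (chartSymmD_chartD hy'.1)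
    rw [h1] at h2
    exact h2.symm
  · rw [hself]; exact (hpure x₀ hx₀').1
  · simp only [secInChart_self, ← hspan x₀ hx₀, hself]
    intro w₀ hw₀ w₁ hw₁ w₂ hw₂
    exact hE.integrable U' φ hU' hφ hpure x₀ hx₀' w₂ hw₂ w₁ hw₁ w₀ hw₀

end PureSpinors

/-! ### The 2-form induced on an integral manifold -/

section InducedForm

open Topology

variable {V : Type*} [NormedAddCommGroup V] [NormedSpace ℝ V]
  {M : Type*} [TopologicalSpace M] [ChartedSpace V M]
  {W : Type*} [NormedAddCommGroup W] [NormedSpace ℝ W] [FiniteDimensional ℝ W]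
  {S : Type*} [TopologicalSpace S] [ChartedSpace W S]
  {E : M → Submodule ℝ (V × (V →L[ℝ] ℝ))} {ι : S → M}

theorem exists_alternating_of_bilin (β : W →ₗ[ℝ] W →ₗ[ℝ] ℝ) (h : ∀ u, β u u = 0) :
    ∃ τ : W [⋀^Fin 2]→L[ℝ] ℝ, ∀ u₁ u₂, τ ![u₁, u₂] = β u₁ u₂ := by
  let β' : W →L[ℝ] W →L[ℝ] ℝ := LinearMap.toContinuousLinearMap
    ((LinearMap.toContinuousLinearMap (𝕜 := ℝ) (E := W) (F' := ℝ)).toLinearMap ∘ₗ β)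
  refine ⟨{ toFun := fun v => β' (v 0) (v 1)
            map_update_add' := fun v i x y => by fin_cases i <;> simp [Function.update]
            map_update_smul' := fun v i c x => by fin_cases i <;> simp [Function.update]
            cont := by fun_prop
            map_eq_zero_of_eq' := fun v i j hij hne => ?_ }, fun u₁ u₂ => rfl⟩
  have h01 : v 0 = v 1 := by
    fin_cases i <;> fin_cases j <;> simp_all
  change β' (v 0) (v 1) = 0
  rw [h01]
  exact h _

/-- A field of isotropic subspaces induces a unique 2-form on its integral manifolds. -/
theorem existsUnique_isInducedForm (hE : ∀ x, ∀ w ∈ E x, ∀ w' ∈ E x, pairing w w' = 0)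
    (hι : IsIntegralManifold W E ι) : ∃! τ : S → W [⋀^Fin 2]→L[ℝ] ℝ, IsInducedForm E ι τ := by
  have hex (s : S) (u : W) : ∃ α : V →L[ℝ] ℝ, ((tangent ι s u : V), α) ∈ E (ι s) := by
    have : (tangent ι s u : V) ∈ (ran (E (ι s)) : Set V) := by
      rw [← hι.tangent_eq s]; exact ⟨u, rfl⟩
    obtain ⟨w, hw, h⟩ := this
    exact ⟨w.2, by rw [← h]; exact hw⟩
  choose α hα using hex
  -- The values do not depend on the lifts.
  have hval (s : S) (u₁ u₂ : W) (β : V →L[ℝ] ℝ) (hβ : ((tangent ι s u₁ : V), β) ∈ E (ι s)) :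
      β (tangent ι s u₂) = -α s u₂ (tangent ι s u₁) := by
    have := hE _ _ hβ _ (hα s u₂)
    simp only [pairing] at this
    linarith
  have hskew (s : S) (u₁ u₂ : W) :
      α s u₁ (tangent ι s u₂) = -α s u₂ (tangent ι s u₁) := hval s u₁ u₂ _ (hα s u₁)
  have hlin (s : S) (a b : ℝ) (u u' u₂ : W) : α s (a • u + b • u') (tangent ι s u₂) =
      a * α s u (tangent ι s u₂) + b * α s u' (tangent ι s u₂) := by
    rw [hskew, hskew s u, hskew s u', map_add, map_smul, map_smul, map_add, map_smul, map_smul]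
    simp only [smul_eq_mul]
    ring
  let β (s : S) : W →ₗ[ℝ] W →ₗ[ℝ] ℝ := LinearMap.mk₂ ℝ
    (fun u₁ u₂ => α s u₁ (tangent ι s u₂))
    (fun u u' u₂ => by simpa using hlin s 1 1 u u' u₂)
    (fun c u u₂ => by simpa using hlin s c 0 u 0 u₂)
    (fun u u₂ u₂' => by simp) (fun c u u₂ => by simp)
  choose τ hτ using fun s => exists_alternating_of_bilin (β s) fun u => by
    have : α s u (tangent ι s u) = -α s u (tangent ι s u) := hskew s u u
    change α s u (tangent ι s u) = 0
    linarith
  refine ⟨τ, fun s u₁ u₂ γ hγ => ?_, fun τ' hτ' => ?_⟩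
  · rw [hτ, hval s u₁ u₂ γ hγ, ← hskew]; rfl
  · funext s
    ext u
    have hu : u = ![u 0, u 1] := by funext i; fin_cases i <;> rfl
    rw [hu, hτ, hτ' s (u 0) (u 1) _ (hα s (u 0))]; rfl

end InducedForm

section InducedForm

open Topology

variable {V : Type*} [NormedAddCommGroup V] [NormedSpace ℝ V]
  {M : Type*} [TopologicalSpace M] [ChartedSpace V M] [IsManifold 𝓘(ℝ, V) ∞ M]
  {W : Type*} [NormedAddCommGroup W] [NormedSpace ℝ W]
  {S : Type*} [TopologicalSpace S] [ChartedSpace W S] [IsManifold 𝓘(ℝ, W) ∞ S]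
  {E : M → Submodule ℝ (V × (V →L[ℝ] ℝ))} {ι : S → M} {U : Set M} {m : ℕ}
  {w : Fin m → M → V × (V →L[ℝ] ℝ)} {τ : S → W [⋀^Fin 2]→L[ℝ] ℝ}

/-- The coordinate expression of an integral manifold satisfies the hypotheses of
`contDiffAt_inducedForm` and `extDeriv_inducedForm`. -/
theorem IsIntegralManifold.inCharts (hι : IsIntegralManifold W E ι) (hU : IsOpen U)
    (hw : ∀ i, SmoothSectionOn (w i) U)
    (hspan : ∀ x ∈ U, E x = Submodule.span ℝ (Set.range fun i => w i x))
    (hτ : IsInducedForm E ι τ) {s₀ : S} {x₀ : M} {z : W}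
    (hz : z ∈ (extChartAt 𝓘(ℝ, W) s₀).target)
    (hx : ι ((extChartAt 𝓘(ℝ, W) s₀).symm z) ∈ (extChartAt 𝓘(ℝ, V) x₀).source)
    (hxU : ι ((extChartAt 𝓘(ℝ, W) s₀).symm z) ∈ U) :
    let f := inCharts (V := V) ι s₀ x₀
    let wc := fun i => secInChart (w i) x₀
    ContDiffAt ℝ ∞ f z ∧ (∀ i, ContDiffAt ℝ ∞ (wc i) (f z)) ∧
    Function.Injective (fderiv ℝ f z) ∧
    (∀ᶠ z' in 𝓝 z, ∀ v, v ∈ Set.range (fderiv ℝ f z') ↔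
      ∃ c : Fin m → ℝ, ∑ i, c i • (wc i (f z')).1 = v) ∧
    ∀ᶠ z' in 𝓝 z, ∀ (u₁ u₂ : W) (c : Fin m → ℝ),
      ∑ i, c i • (wc i (f z')).1 = fderiv ℝ f z' u₁ →
        formInChart τ s₀ z' ![u₁, u₂] = (∑ i, c i • (wc i (f z')).2) (fderiv ℝ f z' u₂) := by
  intro f wc
  -- At a point `z'` of the chart, with image `x` in `M`: the derivative of `f`, and the sections.
  have hfd {z' : W} (hz' : z' ∈ (extChartAt 𝓘(ℝ, W) s₀).target)
      (hx' : ι ((extChartAt 𝓘(ℝ, W) s₀).symm z') ∈ (extChartAt 𝓘(ℝ, V) x₀).source) (u : W) :=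
    fderiv_inCharts hz' (hι.smooth.mdifferentiableAt (by simp)) hx' u
  have hsymm {z' : W}
      (hx' : ι ((extChartAt 𝓘(ℝ, W) s₀).symm z') ∈ (extChartAt 𝓘(ℝ, V) x₀).source) :
      (extChartAt 𝓘(ℝ, V) x₀).symm (f z') = ι ((extChartAt 𝓘(ℝ, W) s₀).symm z') :=
    (extChartAt 𝓘(ℝ, V) x₀).left_inv hx'
  have htarget {z' : W}
      (hx' : ι ((extChartAt 𝓘(ℝ, W) s₀).symm z') ∈ (extChartAt 𝓘(ℝ, V) x₀).source) :
      f z' ∈ (extChartAt 𝓘(ℝ, V) x₀).target := (extChartAt 𝓘(ℝ, V) x₀).map_source hx'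
  have hchart {z' : W}
      (hx' : ι ((extChartAt 𝓘(ℝ, W) s₀).symm z') ∈ (extChartAt 𝓘(ℝ, V) x₀).source) (v : V) :
      chartSymmD x₀ (f z') (chartD V x₀ (ι ((extChartAt 𝓘(ℝ, W) s₀).symm z')) v) = v := by
    rw [← hsymm hx']; exact chartSymmD_chartD (htarget hx') v
  have hwc {z' : W}
      (hx' : ι ((extChartAt 𝓘(ℝ, W) s₀).symm z') ∈ (extChartAt 𝓘(ℝ, V) x₀).source) (i : Fin m) :
      wc i (f z') = (chartD V x₀ (ι ((extChartAt 𝓘(ℝ, W) s₀).symm z'))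
        (w i (ι ((extChartAt 𝓘(ℝ, W) s₀).symm z'))).1,
        (w i (ι ((extChartAt 𝓘(ℝ, W) s₀).symm z'))).2.comp (chartSymmD x₀ (f z'))) := by
    simp only [wc, secInChart, hsymm hx']
  have hinjD {z' : W}
      (hx' : ι ((extChartAt 𝓘(ℝ, W) s₀).symm z') ∈ (extChartAt 𝓘(ℝ, V) x₀).source) :
      Function.Injective (chartD V x₀ (ι ((extChartAt 𝓘(ℝ, W) s₀).symm z'))) :=
    Function.LeftInverse.injective (hchart hx')
  have hsum {z' : W}
      (hx' : ι ((extChartAt 𝓘(ℝ, W) s₀).symm z') ∈ (extChartAt 𝓘(ℝ, V) x₀).source)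
      (c : Fin m → ℝ) : ∑ i, c i • (wc i (f z')).1 =
        chartD V x₀ (ι ((extChartAt 𝓘(ℝ, W) s₀).symm z'))
          (∑ i, c i • w i (ι ((extChartAt 𝓘(ℝ, W) s₀).symm z'))).1 := by
    simp [hwc hx', Prod.fst_sum]
  have hmem {x : M} (hx : x ∈ U) (c : Fin m → ℝ) : ∑ i, c i • w i x ∈ E x := by
    rw [hspan x hx]
    exact Submodule.sum_mem _ fun i _ => Submodule.smul_mem _ _ (Submodule.subset_span ⟨i, rfl⟩)
  have hev := eventually_mem_source hz hι.smooth.continuous.continuousAt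
    (hU.inter (isOpen_extChartAt_source (I := 𝓘(ℝ, V)) x₀)) ⟨hxU, hx⟩
  refine ⟨contDiffAt_inCharts hz hι.smooth.contMDiffAt hx, fun i => ?_, ?_, ?_, ?_⟩
  · exact (hw i).contDiffAt hU (htarget hx) (by rw [hsymm hx]; exact hxU)
  · intro u u' h
    rw [hfd hz hx, hfd hz hx] at h
    have h1 := hι.immersion _ (hinjD hx h)
    rw [← chartD_chartSymmD hz u, h1, chartD_chartSymmD hz]
  · filter_upwards [hev] with z' hz' v
    have hx' := hz'.2.2
    constructor
    · rintro ⟨u, rfl⟩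
      have h1 : tangent ι ((extChartAt 𝓘(ℝ, W) s₀).symm z') (chartSymmD s₀ z' u) ∈
          (ran (E (ι ((extChartAt 𝓘(ℝ, W) s₀).symm z'))) : Set V) := by
        rw [← hι.tangent_eq]; exact ⟨_, rfl⟩
      obtain ⟨e, he, h2⟩ := h1
      rw [SetLike.mem_coe, hspan _ hz'.2.1, Submodule.mem_span_range_iff_exists_fun] at he
      obtain ⟨c, hc⟩ := he
      refine ⟨c, ?_⟩
      rw [hsum hx', hc, hfd hz'.1 hx']
      exact congrArg _ h2
    · rintro ⟨c, rfl⟩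
      have h1 : (∑ i, c i • w i (ι ((extChartAt 𝓘(ℝ, W) s₀).symm z'))).1 ∈
          Set.range (tangent ι ((extChartAt 𝓘(ℝ, W) s₀).symm z') : W →L[ℝ] V) := by
        rw [hι.tangent_eq]
        exact ⟨_, hmem hz'.2.1 c, rfl⟩
      obtain ⟨u, hu⟩ := h1
      refine ⟨chartD W s₀ ((extChartAt 𝓘(ℝ, W) s₀).symm z') u, ?_⟩
      rw [hfd hz'.1 hx', hsum hx', chartSymmD_chartD hz'.1, hu]
  · filter_upwards [hev] with z' hz' u₁ u₂ c hc
    have hx' := hz'.2.2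
    rw [hsum hx', hfd hz'.1 hx'] at hc
    have hc' := hinjD hx' hc
    have h1 := hτ _ (chartSymmD s₀ z' u₁) (chartSymmD s₀ z' u₂)
      (∑ i, c i • w i (ι ((extChartAt 𝓘(ℝ, W) s₀).symm z'))).2
      (by rw [← hc']; exact hmem hz'.2.1 c)
    have h2 : formInChart τ s₀ z' ![u₁, u₂] =
        τ ((extChartAt 𝓘(ℝ, W) s₀).symm z') ![chartSymmD s₀ z' u₁, chartSymmD s₀ z' u₂] := by
      rw [formInChart, ContinuousAlternatingMap.compContinuousLinearMap_apply]
      congr 1; funext i; fin_cases i <;> rfl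
    rw [h2, h1, hfd hz'.1 hx', Prod.snd_sum]
    simp only [sum_apply, smul_apply, hwc hx', Prod.smul_snd,
      ContinuousLinearMap.comp_apply, hchart hx']

variable [FiniteDimensional ℝ V] [FiniteDimensional ℝ W]

/-- The 2-form induced on an integral manifold is smooth, if the field of subspaces has smooth
local frames. -/
theorem IsInducedForm.smooth (hτ : IsInducedForm E ι τ) (hι : IsIntegralManifold W E ι)
    (hE : ∀ x₀ : M, ∃ U : Set M, IsOpen U ∧ x₀ ∈ U ∧ ∃ (m : ℕ) (w : Fin m → M → V × (V →L[ℝ] ℝ)),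
      (∀ i, SmoothSectionOn (w i) U) ∧
      ∀ x ∈ U, E x = Submodule.span ℝ (Set.range fun i => w i x)) :
    SmoothFormOn τ Set.univ := by
  refine SmoothFormOn.of_contDiffAt fun s₀ z hz _ => ?_
  obtain ⟨U, hU, hx, m, w, hw, hspan⟩ := hE (ι ((extChartAt 𝓘(ℝ, W) s₀).symm z))
  obtain ⟨h1, h2, h3, h4, h5⟩ := hι.inCharts hU hw hspan hτ hz (mem_extChartAt_source _) hx
  exact contDiffAt_inducedForm h1 h2 h3 h4 h5

/-- The exterior derivative of the 2-form that a Dirac structure induces on an integral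
manifold. -/
theorem IsInducedForm.extD_eq (hτ : IsInducedForm E ι τ) (hι : IsIntegralManifold W E ι)
    {η : M → V [⋀^Fin 3]→L[ℝ] ℝ} (hE : IsDirac E η) : extD τ = pullback ι η := by
  funext s
  obtain ⟨U, hU, hx, w, hw, hspan⟩ := hE.almostDirac.smooth (ι s)
  have hinv := extChartAt_to_inv (I := 𝓘(ℝ, W)) s
  have hz := mem_extChartAt_target (I := 𝓘(ℝ, W)) s
  have hxs : ι ((extChartAt 𝓘(ℝ, W) s).symm (extChartAt 𝓘(ℝ, W) s s)) ∈
      (extChartAt 𝓘(ℝ, V) (ι s)).source := by rw [hinv]; exact mem_extChartAt_source _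
  have hfz : DiracGeometry.inCharts (V := V) ι s (ι s) (extChartAt 𝓘(ℝ, W) s s) =
      extChartAt 𝓘(ℝ, V) (ι s) (ι s) := by rw [DiracGeometry.inCharts, hinv]
  obtain ⟨h1, h2, h3, h4, h5⟩ := hι.inCharts hU hw (fun x hx => (hspan x hx).2) hτ hz hxs
    (by rwa [hinv])
  have hd := extDeriv_inducedForm h1 h2 h3 h4 h5 (fun i j => ?_) (η := η (ι s)) ?_
  · rw [extD_eq_extDeriv, hd, pullback]
    congr 1
    ext u
    rw [fderiv_inCharts hz (hι.smooth.mdifferentiableAt (by simp)) hxs, chartSymmD_self, hinv,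
      chartD_self]
    rfl
  · rw [hfz, secInChart_self, secInChart_self]
    have hmem (i) : w i (ι s) ∈ E (ι s) := by
      rw [(hspan _ hx).2]; exact Submodule.subset_span ⟨i, rfl⟩
    exact (hE.almostDirac.lagrangian _ _).1 (hmem i) _ (hmem j)
  · rw [hfz]
    exact hE.courantIdentityAt hU hx hw (hspan _ hx).1 fun x hx => (hspan x hx).2

end InducedForm

/-! ### Translations and the adjoint action -/

section LieGroup

open Topology

variable {V : Type*} [NormedAddCommGroup V] [NormedSpace ℝ V]
  {G : Type*} [TopologicalSpace G] [ChartedSpace V G] 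

/-- The chain rule for self-maps of `G`, in a form that allows to prescribe the composite and the
intermediate point. -/
theorem tangent_tangent {f₁ f₂ f₃ : G → G} {x y : G} (hf : ∀ x, f₂ (f₁ x) = f₃ x) (hxy : f₁ x = y)
    (h₂ : MDifferentiableAt 𝓘(ℝ, V) 𝓘(ℝ, V) f₂ y) (h₁ : MDifferentiableAt 𝓘(ℝ, V) 𝓘(ℝ, V) f₁ x)
    (v : V) : (tangent f₂ y : V →L[ℝ] V) ((tangent f₁ x : V →L[ℝ] V) v) =
      (tangent f₃ x : V →L[ℝ] V) v := by
  subst hxy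
  have h := tangent_comp (M := G) (S := G) (N := G) (x := x) h₂ h₁
  rw [show f₃ = fun x => f₂ (f₁ x) from funext fun x => (hf x).symm, h]
  rfl

theorem tangent_id_apply (x : G) (v : V) : (tangent (fun x : G => x) x : V →L[ℝ] V) v = v := by
  have h : (tangent (fun x : G => x) x : V →L[ℝ] V) = ContinuousLinearMap.id ℝ V := mfderiv_id
  rw [h]; rfl

variable [Group G]

theorem Ad_one (v : V) : Ad (1 : G) v = v := by
  have : (fun x : G => (1 : G) * x * (1 : G)⁻¹) = fun x => x := by funext; simp
  rw [Ad, this, tangent_id_apply]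

theorem leftInv_one (v : V) : leftInv (1 : G) v = v := by
  have : (fun x : G => 1 * x) = fun x => x := funext one_mul
  rw [leftInv, this, tangent_id_apply]

theorem rightInv_one (v : V) : rightInv (1 : G) v = v := by
  have : (fun x : G => x * 1) = fun x => x := funext mul_one
  rw [rightInv, this, tangent_id_apply]

variable [LieGroup 𝓘(ℝ, V) ∞ G]

theorem mdifferentiableAt_mul_left (g x : G) :
    MDifferentiableAt 𝓘(ℝ, V) 𝓘(ℝ, V) (fun x : G => g * x) x :=
  (contMDiff_mul_left (I := 𝓘(ℝ, V)) (n := ∞) (a := g)).mdifferentiableAt (by simp)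

theorem mdifferentiableAt_mul_right (g x : G) :
    MDifferentiableAt 𝓘(ℝ, V) 𝓘(ℝ, V) (fun x : G => x * g) x :=
  (contMDiff_mul_right (I := 𝓘(ℝ, V)) (n := ∞) (a := g)).mdifferentiableAt (by simp)

theorem mdifferentiableAt_conj (g x : G) :
    MDifferentiableAt 𝓘(ℝ, V) 𝓘(ℝ, V) (fun x : G => g * x * g⁻¹) x :=
  (mdifferentiableAt_mul_right g⁻¹ (g * x)).comp x (mdifferentiableAt_mul_left g x)

theorem thetaL_leftInv (g : G) (v : V) : thetaL g (leftInv g v) = v :=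
  (tangent_tangent (f₃ := fun x => x) (by simp) (by simp) (mdifferentiableAt_mul_left _ _)
    (mdifferentiableAt_mul_left _ _) v).trans (tangent_id_apply _ _)

theorem leftInv_thetaL (g : G) (v : V) : leftInv g (thetaL g v) = v :=
  (tangent_tangent (f₃ := fun x => x) (by simp) (by simp) (mdifferentiableAt_mul_left _ _)
    (mdifferentiableAt_mul_left _ _) v).trans (tangent_id_apply _ _)

theorem thetaR_rightInv (g : G) (v : V) : thetaR g (rightInv g v) = v :=
  (tangent_tangent (f₃ := fun x => x) (by simp) (by simp) (mdifferentiableAt_mul_right _ _)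
    (mdifferentiableAt_mul_right _ _) v).trans (tangent_id_apply _ _)

theorem rightInv_thetaR (g : G) (v : V) : rightInv g (thetaR g v) = v :=
  (tangent_tangent (f₃ := fun x => x) (by simp) (by simp) (mdifferentiableAt_mul_right _ _)
    (mdifferentiableAt_mul_right _ _) v).trans (tangent_id_apply _ _)

theorem thetaR_leftInv (g : G) (v : V) : thetaR g (leftInv g v) = Ad g v :=
  tangent_tangent (by simp) (by simp) (mdifferentiableAt_mul_right _ _)
    (mdifferentiableAt_mul_left _ _) v

theorem thetaL_rightInv (g : G) (v : V) : thetaL g (rightInv g v) = Ad g⁻¹ v :=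
  tangent_tangent (by simp [mul_assoc]) (by simp) (mdifferentiableAt_mul_left _ _)
    (mdifferentiableAt_mul_right _ _) v

theorem Ad_mul (g h : G) (v : V) : Ad (g * h) v = Ad g (Ad h v) :=
  (tangent_tangent (by simp [mul_assoc]) (by simp) (mdifferentiableAt_conj _ _)
    (mdifferentiableAt_conj _ _) v).symm

theorem Ad_Ad_inv (g : G) (v : V) : Ad g (Ad g⁻¹ v) = v := by
  rw [← Ad_mul, mul_inv_cancel, Ad_one]

theorem Ad_inv_Ad (g : G) (v : V) : Ad g⁻¹ (Ad g v) = v := by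
  rw [← Ad_mul, inv_mul_cancel, Ad_one]

theorem thetaR_eq (g : G) (v : V) : thetaR g v = Ad g (thetaL g v) := by
  rw [← thetaR_leftInv, leftInv_thetaL]

theorem thetaL_sharp (g : G) (v : V) : thetaL g (sharp g v) = v - Ad g⁻¹ v := by
  rw [sharp, sub_apply, map_sub, thetaL_leftInv, thetaL_rightInv]

theorem thetaR_sharp (g : G) (v : V) : thetaR g (sharp g v) = Ad g v - v := by
  rw [sharp, sub_apply, map_sub, thetaR_leftInv, thetaR_rightInv]

/-- The derivative of the orbit map `p(a) = a g₀ a⁻¹`, in the right trivialization, is `-ξ^♯`.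
It is found by differentiating the identity `p(a) a = a g₀`. -/
theorem tangent_orbit_rightInv (g₀ a : G) (v : V) :
    (tangent (fun a : G => a * g₀ * a⁻¹) a : V →L[ℝ] V) (rightInv a v) =
      -sharp (a * g₀ * a⁻¹) v := by
  set p : G → G := fun a => a * g₀ * a⁻¹ with hp
  have hpd : MDifferentiableAt 𝓘(ℝ, V) 𝓘(ℝ, V) p a := by
    have h1 : ContMDiff 𝓘(ℝ, V) 𝓘(ℝ, V) ∞ p :=
      (contMDiff_mul_right (I := 𝓘(ℝ, V)) (n := ∞) (a := g₀)).mul (contMDiff_inv 𝓘(ℝ, V) ∞)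
    exact h1.mdifferentiableAt (by simp)
  have hid : MDifferentiableAt 𝓘(ℝ, V) 𝓘(ℝ, V) (fun x : G => x) a := mdifferentiableAt_id
  have hm : MDifferentiableAt (𝓘(ℝ, V).prod 𝓘(ℝ, V)) 𝓘(ℝ, V) (fun z : G × G => z.1 * z.2)
      (p a, a) := (contMDiff_mul 𝓘(ℝ, V) ∞).mdifferentiableAt (by simp)
  have key : ∀ X : V, (tangent (fun x : G => x * g₀) a : V →L[ℝ] V) X =
      (tangent (fun x : G => x * a) (p a) : V →L[ℝ] V) ((tangent p a : V →L[ℝ] V) X) +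
      (tangent (fun x : G => p a * x) a : V →L[ℝ] V) X := by
    intro X
    have h1 := mfderiv_comp_apply (f := fun x : G => (p x, x)) a hm (hpd.prodMk hid) X
    rw [mfderiv_prod_eq_add_apply hm, hpd.mfderiv_prod hid] at h1
    have e1 : (fun z : G × G => z.1 * z.2) ∘ (fun x : G => (p x, x)) = fun x => x * g₀ := by
      funext x; simp [hp]
    rw [e1] at h1
    have e2 := tangent_id_apply (V := V) a X
    refine h1.trans ?_
    exact congrArg (fun Y : V => (tangent (fun x : G => x * a) (p a) : V →L[ℝ] V)
      ((tangent p a : V →L[ℝ] V) X) + (tangent (fun x : G => p a * x) a : V →L[ℝ] V) Y) e2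
  have hr : ∀ (x b : G), MDifferentiableAt 𝓘(ℝ, V) 𝓘(ℝ, V) (fun x : G => x * b) x :=
    fun x b => mdifferentiableAt_mul_right b x
  have hl : ∀ (x b : G), MDifferentiableAt 𝓘(ℝ, V) 𝓘(ℝ, V) (fun x : G => b * x) x :=
    fun x b => mdifferentiableAt_mul_left b x
  have h := congrArg (tangent (fun x : G => x * a⁻¹) (a * g₀) : V →L[ℝ] V) (key (rightInv a v))
  rw [map_add] at h
  have hpa : a * g₀ = p a * a := by simp [hp]
  have t1 : (tangent (fun x : G => x * a⁻¹) (a * g₀) : V →L[ℝ] V)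
      ((tangent (fun x : G => x * g₀) a : V →L[ℝ] V) (rightInv a v)) = rightInv (p a) v := by
    rw [tangent_tangent (f₃ := fun x => x * (g₀ * a⁻¹)) (by simp [mul_assoc]) rfl (hr _ _) (hr _ _)]
    exact tangent_tangent (by simp [hp, mul_assoc]) (by simp) (hr _ _) (hr _ _) v
  have t2 : (tangent (fun x : G => x * a⁻¹) (a * g₀) : V →L[ℝ] V)
      ((tangent (fun x : G => x * a) (p a) : V →L[ℝ] V)
        ((tangent p a : V →L[ℝ] V) (rightInv a v))) = (tangent p a : V →L[ℝ] V) (rightInv a v) := by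
    exact (tangent_tangent (f₁ := fun x => x * a) (f₂ := fun x => x * a⁻¹) (f₃ := fun x => x)
      (by simp) hpa.symm (hr _ _) (hr _ _) _).trans (tangent_id_apply _ _)
  have t3 : (tangent (fun x : G => x * a⁻¹) (a * g₀) : V →L[ℝ] V)
      ((tangent (fun x : G => p a * x) a : V →L[ℝ] V) (rightInv a v)) = leftInv (p a) v := by
    refine (tangent_tangent (f₁ := fun x => p a * x) (f₂ := fun x => x * a⁻¹)
      (f₃ := fun x => p a * x * a⁻¹) (by simp) hpa.symm (hr _ _) (hl _ _) _).trans ?_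
    exact tangent_tangent (by simp [mul_assoc]) (by simp)
      ((hr _ a⁻¹).comp a (hl a (p a))) (hr _ _) v
  rw [t1, t2, t3] at h
  rw [sharp, sub_apply, neg_sub, h]
  abel

theorem tangent_orbit (g₀ a : G) (v : V) :
    (tangent (fun a : G => a * g₀ * a⁻¹) a : V →L[ℝ] V) v =
      sharp (a * g₀ * a⁻¹) (-thetaR a v) := by
  rw [map_neg, ← tangent_orbit_rightInv, rightInv_thetaR]

end LieGroup

/-! ### The Cartan-Dirac structure and the conjugacy classes -/

section CartanDirac

variable {V : Type*} [NormedAddCommGroup V] [NormedSpace ℝ V]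
  {G : Type*} [TopologicalSpace G] [ChartedSpace V G] [Group G]
  {W : Type*} [NormedAddCommGroup W] [NormedSpace ℝ W]
  {C : Type*} [TopologicalSpace C] [ChartedSpace W C]
  {B : LinearMap.BilinForm ℝ V}

theorem IsInvariantInner.apply_Ad_left [LieGroup 𝓘(ℝ, V) ∞ G] (hB : IsInvariantInner G B) (g : G)
    (ξ ζ : V) : B (Ad g ξ) ζ = B ξ (Ad g⁻¹ ζ) := by
  rw [← hB.invariant g ξ (Ad g⁻¹ ζ), Ad_Ad_inv]

theorem IsInvariantInner.apply_comm (hB : IsInvariantInner G B) (ξ ζ : V) : B ξ ζ = B ζ ξ :=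
  hB.symm.eq ξ ζ

section FiniteDimensional

variable [FiniteDimensional ℝ V]

theorem cartanDiracMap_snd (B : LinearMap.BilinForm ℝ V) (g : G) (ξ v : V) :
    (cartanDiracMap B g ξ).2 v = (1 / 2 : ℝ) * B (thetaL g v + thetaR g v) ξ := rfl

theorem cartanDiracMap_add (B : LinearMap.BilinForm ℝ V) (g : G) (ξ ζ : V) :
    cartanDiracMap B g (ξ + ζ) = cartanDiracMap B g ξ + cartanDiracMap B g ζ := by
  refine Prod.ext (map_add (sharp g) ξ ζ) ?_
  ext v
  simp only [cartanDiracMap_snd, Prod.snd_add, add_apply, map_add]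
  ring

theorem cartanDiracMap_smul (B : LinearMap.BilinForm ℝ V) (g : G) (c : ℝ) (ξ : V) :
    cartanDiracMap B g (c • ξ) = c • cartanDiracMap B g ξ := by
  refine Prod.ext (map_smul (sharp g) c ξ) ?_
  ext v
  simp only [cartanDiracMap_snd, Prod.smul_snd, smul_apply, map_smul, smul_eq_mul]
  ring

/-- The bundle map `e` at the point `g`, as a linear map. -/
def cartanDiracLinear (B : LinearMap.BilinForm ℝ V) (g : G) : V →ₗ[ℝ] V × (V →L[ℝ] ℝ) where
  toFun := cartanDiracMap B g
  map_add' := cartanDiracMap_add B g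
  map_smul' := cartanDiracMap_smul B g

theorem cartanDirac_eq_range (B : LinearMap.BilinForm ℝ V) (g : G) :
    cartanDirac B g = LinearMap.range (cartanDiracLinear B g) := by
  rw [cartanDirac, ← Submodule.span_eq (LinearMap.range (cartanDiracLinear B g))]
  rfl

theorem mem_cartanDirac {B : LinearMap.BilinForm ℝ V} {g : G} {w : V × (V →L[ℝ] ℝ)} :
    w ∈ cartanDirac B g ↔ ∃ ξ, cartanDiracMap B g ξ = w := by
  rw [cartanDirac_eq_range]; rfl

theorem cartanDirac_eq_span_basis (B : LinearMap.BilinForm ℝ V) (g : G) :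
    cartanDirac B g =
      Submodule.span ℝ (Set.range fun i => cartanDiracMap B g (Module.finBasis ℝ V i)) := by
  rw [cartanDirac_eq_range, LinearMap.range_eq_map, ← (Module.finBasis ℝ V).span_eq,
    Submodule.map_span, ← Set.range_comp]
  rfl

theorem ran_cartanDirac (B : LinearMap.BilinForm ℝ V) (g : G) :
    (ran (cartanDirac B g) : Set V) = Set.range (sharp g : V →L[ℝ] V) := by
  ext v
  constructor
  · rintro ⟨w, hw, rfl⟩
    obtain ⟨ξ, rfl⟩ := mem_cartanDirac.1 hw
    exact ⟨ξ, rfl⟩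
  · rintro ⟨ξ, rfl⟩
    exact ⟨_, mem_cartanDirac.2 ⟨ξ, rfl⟩, rfl⟩

end FiniteDimensional

theorem IsConjugacyClass.exists_eq {g₀ : G} {ι : C → G} (hι : IsConjugacyClass V W g₀ ι)
    {q : G → C} (hq : ∀ a, ι (q a) = a * g₀ * a⁻¹) (c : C) : ∃ a, q a = c := by
  have : ι c ∈ {g | IsConj g₀ g} := hι.range_eq ▸ Set.mem_range_self c
  obtain ⟨a, ha⟩ := isConj_iff.1 this
  exact ⟨a, hι.injective ((hq a).trans ha)⟩

variable [LieGroup 𝓘(ℝ, V) ∞ G]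

/-- On the image of the orbit map, the differential of `ι` is given by the generating vector
fields of the conjugation action. -/
theorem tangent_tangent_orbit {g₀ : G} {ι : C → G} (hι : ContMDiff 𝓘(ℝ, W) 𝓘(ℝ, V) ∞ ι)
    {q : G → C} (hq : ∀ a, ι (q a) = a * g₀ * a⁻¹)
    (hq' : ContMDiff 𝓘(ℝ, V) 𝓘(ℝ, W) ∞ q) (a : G) (v : V) :
    (tangent ι (q a) : W →L[ℝ] V) ((tangent q a : V →L[ℝ] W) v) =
      sharp (ι (q a)) (-thetaR a v) := by
  have h := tangent_comp (M := G) (S := C) (N := G) (x := a)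
    (hι.mdifferentiableAt (by simp)) (hq'.mdifferentiableAt (by simp))
  rw [funext hq] at h
  rw [hq, ← tangent_orbit, h]
  rfl

variable [FiniteDimensional ℝ V]

/-- The value of the covector part of `e(ξ₁)` on the generating vector field `ξ₂^♯`. -/
theorem IsInvariantInner.cartanDiracMap_snd_sharp (hB : IsInvariantInner G B) (g : G)
    (ξ₁ ξ₂ : V) : (cartanDiracMap B g ξ₁).2 (sharp g ξ₂) =
      (1 / 2 : ℝ) * B (Ad g⁻¹ ξ₁ - Ad g ξ₁) ξ₂ := by
  have h1 := hB.apply_Ad_left g ξ₂ ξ₁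
  have h2 := hB.apply_Ad_left g⁻¹ ξ₂ ξ₁
  rw [inv_inv] at h2
  rw [cartanDiracMap_snd, thetaL_sharp, thetaR_sharp, hB.apply_comm _ ξ₂]
  simp only [map_add, map_sub, LinearMap.add_apply, LinearMap.sub_apply, h1, h2]
  ring

theorem IsInvariantInner.isotropic (hB : IsInvariantInner G B) (g : G) :
    ∀ w ∈ cartanDirac B g, ∀ w' ∈ cartanDirac B g, pairing w w' = 0 := by
  intro w hw w' hw'
  obtain ⟨ξ, rfl⟩ := mem_cartanDirac.1 hw
  obtain ⟨ζ, rfl⟩ := mem_cartanDirac.1 hw'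
  have h1 := hB.apply_Ad_left g ξ ζ
  have h2 := hB.apply_Ad_left g⁻¹ ξ ζ
  rw [inv_inv] at h2
  change (cartanDiracMap B g ξ).2 (sharp g ζ) + (cartanDiracMap B g ζ).2 (sharp g ξ) = 0
  rw [hB.cartanDiracMap_snd_sharp, hB.cartanDiracMap_snd_sharp, hB.apply_comm _ ξ]
  simp only [map_sub, LinearMap.sub_apply, h1, h2]
  ring

/-- The conjugation action is transitive on the class and has the generating vector fields `ξ^♯`, so
the class is tangent to `ran` of the Cartan-Dirac structure, which they span. -/
theorem IsConjugacyClass.isIntegralManifold {g₀ : G} {ι : C → G}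
    (hι : IsConjugacyClass V W g₀ ι) (B : LinearMap.BilinForm ℝ V) :
    IsIntegralManifold W (cartanDirac B) ι where
  smooth := hι.smooth
  immersion := hι.immersion
  tangent_eq c := by
    obtain ⟨q, hq, hq', hsurj⟩ := hι.orbit
    obtain ⟨a, rfl⟩ := hι.exists_eq hq c
    rw [ran_cartanDirac]
    ext v
    constructor
    · rintro ⟨u, rfl⟩
      obtain ⟨x, rfl⟩ := hsurj a u
      exact ⟨_, (tangent_tangent_orbit hι.smooth hq hq' a x).symm⟩
    · rintro ⟨ξ, rfl⟩
      refine ⟨(tangent q a : V →L[ℝ] W) (rightInv a (-ξ)), ?_⟩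
      rw [tangent_tangent_orbit hι.smooth hq hq', thetaR_rightInv, neg_neg]

/-- The GHJW form is the 2-form induced by the Cartan-Dirac structure. -/
theorem IsInvariantInner.isGHJWForm_iff (hB : IsInvariantInner G B) {g₀ : G} {ι : C → G}
    (hι : IsConjugacyClass V W g₀ ι) (τ : C → W [⋀^Fin 2]→L[ℝ] ℝ) :
    IsGHJWForm B ι τ ↔ IsInducedForm (cartanDirac B) ι τ := by
  constructor
  · intro h c u₁ u₂ α hα
    obtain ⟨ξ₁, h₁⟩ := mem_cartanDirac.1 hα
    obtain ⟨ξ₂, h₂⟩ : (tangent ι c u₂ : V) ∈ Set.range (sharp (ι c) : V →L[ℝ] V) := by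
      rw [← ran_cartanDirac B, ← (hι.isIntegralManifold B).tangent_eq]
      exact ⟨u₂, rfl⟩
    rw [h c u₁ u₂ ξ₁ ξ₂ (congrArg Prod.fst h₁).symm h₂.symm, ← hB.cartanDiracMap_snd_sharp,
      h₁, h₂]
  · intro h c u₁ u₂ ξ₁ ξ₂ h₁ h₂
    rw [h c u₁ u₂ (cartanDiracMap B (ι c) ξ₁).2 (mem_cartanDirac.2 ⟨ξ₁, by rw [h₁]; rfl⟩), h₂,
      hB.cartanDiracMap_snd_sharp]

end CartanDirac

/-! ### Invariant vector fields in charts -/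

section InvariantFields

open Topology

variable {V : Type*} [NormedAddCommGroup V] [NormedSpace ℝ V]
  {G : Type*} [TopologicalSpace G] [ChartedSpace V G] [Group G]

/-- The multiplication of `G`, read in the preferred charts at `a`, `b` (factors) and `c`
(product). -/
def mulInCharts (a b c : G) (p : V × V) : V :=
  extChartAt 𝓘(ℝ, V) c ((extChartAt 𝓘(ℝ, V) a).symm p.1 * (extChartAt 𝓘(ℝ, V) b).symm p.2)

/-- The left-invariant vector fields in the preferred chart at `x₀`: the linear map taking `ξ` to
the coordinate expression of `ξᴸ` at the point with coordinates `y`. -/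
def leftInChart (x₀ : G) (y : V) : V →L[ℝ] V :=
  (chartD V x₀ ((extChartAt 𝓘(ℝ, V) x₀).symm y)).comp (leftInv ((extChartAt 𝓘(ℝ, V) x₀).symm y))

/-- The right-invariant vector fields in the preferred chart at `x₀`. -/
def rightInChart (x₀ : G) (y : V) : V →L[ℝ] V :=
  (chartD V x₀ ((extChartAt 𝓘(ℝ, V) x₀).symm y)).comp (rightInv ((extChartAt 𝓘(ℝ, V) x₀).symm y))

/-- The left-invariant Maurer-Cartan form in the preferred chart at `x₀`. -/
def thetaLInChart (x₀ : G) (y : V) : V →L[ℝ] V :=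
  (thetaL ((extChartAt 𝓘(ℝ, V) x₀).symm y)).comp (chartSymmD x₀ y)

/-- The right-invariant Maurer-Cartan form in the preferred chart at `x₀`. -/
def thetaRInChart (x₀ : G) (y : V) : V →L[ℝ] V :=
  (thetaR ((extChartAt 𝓘(ℝ, V) x₀).symm y)).comp (chartSymmD x₀ y)

variable [LieGroup 𝓘(ℝ, V) ∞ G]

theorem contDiffAt_mulInCharts {a b c : G} {p : V × V}
    (h₁ : p.1 ∈ (extChartAt 𝓘(ℝ, V) a).target) (h₂ : p.2 ∈ (extChartAt 𝓘(ℝ, V) b).target)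
    (hc : (extChartAt 𝓘(ℝ, V) a).symm p.1 * (extChartAt 𝓘(ℝ, V) b).symm p.2 ∈
      (extChartAt 𝓘(ℝ, V) c).source) :
    ContDiffAt ℝ ∞ (mulInCharts (V := V) a b c) p := by
  have e1 : ContMDiffAt 𝓘(ℝ, V × V) 𝓘(ℝ, V) ∞
      (fun p : V × V => (extChartAt 𝓘(ℝ, V) a).symm p.1) p :=
    (contMDiffAt_extChartAt_symm h₁).comp p contDiff_fst.contMDiff.contMDiffAt
  have e2 : ContMDiffAt 𝓘(ℝ, V × V) 𝓘(ℝ, V) ∞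
      (fun p : V × V => (extChartAt 𝓘(ℝ, V) b).symm p.2) p :=
    (contMDiffAt_extChartAt_symm h₂).comp p contDiff_snd.contMDiff.contMDiffAt
  exact contMDiffAt_iff_contDiffAt.1
    ((contMDiffAt_extChartAt_of_mem hc).comp p (e1.mul e2))

theorem leftInChart_eq {x₀ : G} {y : V} (hy : y ∈ (extChartAt 𝓘(ℝ, V) x₀).target) :
    leftInChart x₀ y = (fderiv ℝ (mulInCharts (V := V) x₀ 1 x₀)
      (y, extChartAt 𝓘(ℝ, V) (1 : G) 1)).comp (ContinuousLinearMap.inr ℝ V V) := by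
  have h1 : (extChartAt 𝓘(ℝ, V) (1 : G)).symm (extChartAt 𝓘(ℝ, V) (1 : G) 1) = 1 :=
    extChartAt_to_inv _
  have ht := mem_extChartAt_target (I := 𝓘(ℝ, V)) (1 : G)
  have hs : (extChartAt 𝓘(ℝ, V) x₀).symm y ∈ (extChartAt 𝓘(ℝ, V) x₀).source :=
    (extChartAt 𝓘(ℝ, V) x₀).map_target hy
  have hH := contDiffAt_mulInCharts (p := (y, extChartAt 𝓘(ℝ, V) (1 : G) 1)) (c := x₀) hy ht
    (by simpa only [h1, mul_one] using hs)
  ext u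
  have e1 : HasFDerivAt (fun t : V => mulInCharts (V := V) x₀ 1 x₀ (y, t))
      ((fderiv ℝ (mulInCharts (V := V) x₀ 1 x₀) (y, extChartAt 𝓘(ℝ, V) (1 : G) 1)).comp
        (ContinuousLinearMap.inr ℝ V V)) (extChartAt 𝓘(ℝ, V) (1 : G) 1) :=
    HasFDerivAt.comp _ (hH.differentiableAt (by simp)).hasFDerivAt
      (hasFDerivAt_prodMk_right y _)
  have e2 := fderiv_inCharts (V := V) (x₀ := x₀) (u := u)
    (f := fun x : G => (extChartAt 𝓘(ℝ, V) x₀).symm y * x) ht (mdifferentiableAt_mul_left _ _)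
    (by simpa only [h1, mul_one] using hs)
  rw [← e1.fderiv]
  refine Eq.trans ?_ e2.symm
  rw [chartSymmD_self]
  simp only [h1, mul_one]
  rfl

theorem rightInChart_eq {x₀ : G} {y : V} (hy : y ∈ (extChartAt 𝓘(ℝ, V) x₀).target) :
    rightInChart x₀ y = (fderiv ℝ (mulInCharts (V := V) 1 x₀ x₀)
      (extChartAt 𝓘(ℝ, V) (1 : G) 1, y)).comp (ContinuousLinearMap.inl ℝ V V) := by
  have h1 : (extChartAt 𝓘(ℝ, V) (1 : G)).symm (extChartAt 𝓘(ℝ, V) (1 : G) 1) = 1 :=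
    extChartAt_to_inv _
  have ht := mem_extChartAt_target (I := 𝓘(ℝ, V)) (1 : G)
  have hs : (extChartAt 𝓘(ℝ, V) x₀).symm y ∈ (extChartAt 𝓘(ℝ, V) x₀).source :=
    (extChartAt 𝓘(ℝ, V) x₀).map_target hy
  have hH := contDiffAt_mulInCharts (p := (extChartAt 𝓘(ℝ, V) (1 : G) 1, y)) (c := x₀) ht hy
    (by simpa only [h1, one_mul] using hs)
  ext u
  have e1 : HasFDerivAt (fun t : V => mulInCharts (V := V) 1 x₀ x₀ (t, y))
      ((fderiv ℝ (mulInCharts (V := V) 1 x₀ x₀) (extChartAt 𝓘(ℝ, V) (1 : G) 1, y)).comp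
        (ContinuousLinearMap.inl ℝ V V)) (extChartAt 𝓘(ℝ, V) (1 : G) 1) :=
    HasFDerivAt.comp (f := fun t : V => (t, y)) _ (hH.differentiableAt (by simp)).hasFDerivAt
      (hasFDerivAt_prodMk_left _ y)
  have e2 := fderiv_inCharts (V := V) (x₀ := x₀) (u := u)
    (f := fun x : G => x * (extChartAt 𝓘(ℝ, V) x₀).symm y) ht (mdifferentiableAt_mul_right _ _)
    (by simpa only [h1, one_mul] using hs)
  rw [← e1.fderiv]
  refine Eq.trans ?_ e2.symm
  rw [chartSymmD_self]
  simp only [h1, one_mul]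
  rfl

theorem contDiffAt_leftInChart {x₀ : G} {y : V} (hy : y ∈ (extChartAt 𝓘(ℝ, V) x₀).target) :
    ContDiffAt ℝ ∞ (leftInChart (V := V) x₀) y := by
  have h1 : (extChartAt 𝓘(ℝ, V) (1 : G)).symm (extChartAt 𝓘(ℝ, V) (1 : G) 1) = 1 :=
    extChartAt_to_inv _
  have hH := contDiffAt_mulInCharts (p := (y, extChartAt 𝓘(ℝ, V) (1 : G) 1)) (c := x₀) hy
    (mem_extChartAt_target (I := 𝓘(ℝ, V)) (1 : G))
    (by simpa only [h1, mul_one] using (extChartAt 𝓘(ℝ, V) x₀).map_target hy)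
  have h2 : ContDiffAt ℝ ∞ (fun y => (fderiv ℝ (mulInCharts (V := V) x₀ 1 x₀)
      (y, extChartAt 𝓘(ℝ, V) (1 : G) 1)).comp (ContinuousLinearMap.inr ℝ V V)) y :=
    (ContDiffAt.comp y (hH.fderiv_right (by simp)) (by fun_prop)).clm_comp contDiffAt_const
  refine h2.congr_of_eventuallyEq ?_
  filter_upwards [extChartAt_target_mem_nhds' hy] with y' hy' using leftInChart_eq hy'

theorem contDiffAt_rightInChart {x₀ : G} {y : V} (hy : y ∈ (extChartAt 𝓘(ℝ, V) x₀).target) :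
    ContDiffAt ℝ ∞ (rightInChart (V := V) x₀) y := by
  have h1 : (extChartAt 𝓘(ℝ, V) (1 : G)).symm (extChartAt 𝓘(ℝ, V) (1 : G) 1) = 1 :=
    extChartAt_to_inv _
  have hH := contDiffAt_mulInCharts (p := (extChartAt 𝓘(ℝ, V) (1 : G) 1, y)) (c := x₀)
    (mem_extChartAt_target (I := 𝓘(ℝ, V)) (1 : G)) hy
    (by simpa only [h1, one_mul] using (extChartAt 𝓘(ℝ, V) x₀).map_target hy)
  have h2 : ContDiffAt ℝ ∞ (fun y => (fderiv ℝ (mulInCharts (V := V) 1 x₀ x₀)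
      (extChartAt 𝓘(ℝ, V) (1 : G) 1, y)).comp (ContinuousLinearMap.inl ℝ V V)) y :=
    (ContDiffAt.comp y (hH.fderiv_right (by simp)) (by fun_prop)).clm_comp contDiffAt_const
  refine h2.congr_of_eventuallyEq ?_
  filter_upwards [extChartAt_target_mem_nhds' hy] with y' hy' using rightInChart_eq hy'

theorem thetaLInChart_leftInChart {x₀ : G} {y : V} (hy : y ∈ (extChartAt 𝓘(ℝ, V) x₀).target)
    (v : V) : thetaLInChart x₀ y (leftInChart x₀ y v) = v :=
  (congrArg (thetaL ((extChartAt 𝓘(ℝ, V) x₀).symm y)) (chartSymmD_chartD hy _)).trans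
    (thetaL_leftInv _ v)

theorem leftInChart_thetaLInChart {x₀ : G} {y : V} (hy : y ∈ (extChartAt 𝓘(ℝ, V) x₀).target)
    (v : V) : leftInChart x₀ y (thetaLInChart x₀ y v) = v :=
  (congrArg (chartD V x₀ ((extChartAt 𝓘(ℝ, V) x₀).symm y)) (leftInv_thetaL _ _)).trans
    (chartD_chartSymmD hy v)

theorem thetaRInChart_rightInChart {x₀ : G} {y : V} (hy : y ∈ (extChartAt 𝓘(ℝ, V) x₀).target)
    (v : V) : thetaRInChart x₀ y (rightInChart x₀ y v) = v :=
  (congrArg (thetaR ((extChartAt 𝓘(ℝ, V) x₀).symm y)) (chartSymmD_chartD hy _)).trans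
    (thetaR_rightInv _ v)

theorem rightInChart_thetaRInChart {x₀ : G} {y : V} (hy : y ∈ (extChartAt 𝓘(ℝ, V) x₀).target)
    (v : V) : rightInChart x₀ y (thetaRInChart x₀ y v) = v :=
  (congrArg (chartD V x₀ ((extChartAt 𝓘(ℝ, V) x₀).symm y)) (rightInv_thetaR _ _)).trans
    (chartD_chartSymmD hy v)

/-- A family of operators that is inverse to a smooth family is smooth. -/
theorem _root_.ContDiffAt.of_inverse [CompleteSpace V] {A T : V → V →L[ℝ] V} {y : V}
    (hA : ContDiffAt ℝ ∞ A y) (h₁ : ∀ᶠ z in 𝓝 y, ∀ v, T z (A z v) = v)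
    (h₂ : ∀ᶠ z in 𝓝 y, ∀ v, A z (T z v) = v) : ContDiffAt ℝ ∞ T y := by
  have hu : ∀ z, (∀ v, T z (A z v) = v) → (∀ v, A z (T z v) = v) →
      ∃ u : (V →L[ℝ] V)ˣ, (u : V →L[ℝ] V) = A z ∧ Ring.inverse (A z) = T z := by
    intro z a b
    let u : (V →L[ℝ] V)ˣ := ⟨A z, T z, by ext v; exact b v, by ext v; exact a v⟩
    exact ⟨u, rfl, Ring.inverse_unit u⟩
  obtain ⟨u, hu', -⟩ := hu y h₁.self_of_nhds h₂.self_of_nhds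
  have h := contDiffAt_ringInverse (n := ∞) ℝ u
  rw [hu'] at h
  refine (h.comp y hA).congr_of_eventuallyEq ?_
  filter_upwards [h₁, h₂] with z a b
  exact (hu z a b).choose_spec.2.symm

theorem contDiffAt_thetaLInChart [CompleteSpace V] {x₀ : G} {y : V}
    (hy : y ∈ (extChartAt 𝓘(ℝ, V) x₀).target) : ContDiffAt ℝ ∞ (thetaLInChart (V := V) x₀) y := by
  refine (contDiffAt_leftInChart hy).of_inverse ?_ ?_
  · filter_upwards [extChartAt_target_mem_nhds' hy] with z hz using thetaLInChart_leftInChart hz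
  · filter_upwards [extChartAt_target_mem_nhds' hy] with z hz using leftInChart_thetaLInChart hz

theorem contDiffAt_thetaRInChart [CompleteSpace V] {x₀ : G} {y : V}
    (hy : y ∈ (extChartAt 𝓘(ℝ, V) x₀).target) : ContDiffAt ℝ ∞ (thetaRInChart (V := V) x₀) y := by
  refine (contDiffAt_rightInChart hy).of_inverse ?_ ?_
  · filter_upwards [extChartAt_target_mem_nhds' hy] with z hz using thetaRInChart_rightInChart hz
  · filter_upwards [extChartAt_target_mem_nhds' hy] with z hz using rightInChart_thetaRInChart hz

theorem smoothSectionOn_cartanDiracMap [FiniteDimensional ℝ V] (B : LinearMap.BilinForm ℝ V)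
    (ξ : V) : SmoothSectionOn (fun g : G => cartanDiracMap B g ξ) Set.univ := by
  intro x₀
  constructor
  · intro y hy
    exact (((contDiffAt_leftInChart hy.1).sub (contDiffAt_rightInChart hy.1)).clm_apply
      contDiffAt_const : ContDiffAt ℝ ∞ (fun z => (leftInChart x₀ z - rightInChart x₀ z) ξ)
        y).contDiffWithinAt.congr_of_mem (fun z _ => by
          simp only [leftInChart, rightInChart, cartanDiracMap, sharp]
          exact map_sub _ _ _) hy
  · intro y hy
    have := FiniteDimensional.complete ℝ V
    let b : V →L[ℝ] ℝ := LinearMap.toContinuousLinearMap ((1 / 2 : ℝ) • B.flip ξ)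
    have h : ContDiffAt ℝ ∞ (fun z => b.comp (thetaLInChart x₀ z + thetaRInChart x₀ z)) y :=
      contDiffAt_const.clm_comp
        ((contDiffAt_thetaLInChart hy.1).add (contDiffAt_thetaRInChart hy.1))
    exact h.contDiffWithinAt

end InvariantFields

/-! ### The Lie bracket and the adjoint action -/

section Bracket

open Topology

variable {V : Type*} [NormedAddCommGroup V] [NormedSpace ℝ V]
  {G : Type*} [TopologicalSpace G] [ChartedSpace V G] [Group G]

variable (V G) in
/-- The coordinates of the unit of `G` in the preferred chart there. -/
abbrev unitCoord : V := extChartAt 𝓘(ℝ, V) (1 : G) 1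

theorem unitCoord_mem : unitCoord V G ∈ (extChartAt 𝓘(ℝ, V) (1 : G)).target :=
  mem_extChartAt_target (I := 𝓘(ℝ, V)) (1 : G)

theorem symm_unitCoord : (extChartAt 𝓘(ℝ, V) (1 : G)).symm (unitCoord V G) = 1 :=
  extChartAt_to_inv _

variable [LieGroup 𝓘(ℝ, V) ∞ G]

theorem leftInChart_unitCoord (v : V) : leftInChart (1 : G) (unitCoord V G) v = v := by
  rw [leftInChart, symm_unitCoord, chartD_self]
  exact leftInv_one v

theorem rightInChart_unitCoord (v : V) : rightInChart (1 : G) (unitCoord V G) v = v := by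
  rw [rightInChart, symm_unitCoord, chartD_self]
  exact rightInv_one v

theorem thetaLInChart_unitCoord (v : V) : thetaLInChart (1 : G) (unitCoord V G) v = v := by
  conv_lhs => rw [← leftInChart_unitCoord (G := G) v]
  exact thetaLInChart_leftInChart unitCoord_mem v

theorem differentiableAt_leftInChart_unitCoord :
    DifferentiableAt ℝ (leftInChart (V := V) (1 : G)) (unitCoord V G) :=
  (contDiffAt_leftInChart unitCoord_mem).differentiableAt (by simp)

/-- The bracket of the Lie algebra, computed in the preferred chart at the unit. -/
theorem lieBracket_eq_fderiv (ξ ζ : V) : lieBracket G ξ ζ =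
    fderiv ℝ (leftInChart (V := V) (1 : G)) (unitCoord V G) ξ ζ -
      fderiv ℝ (leftInChart (V := V) (1 : G)) (unitCoord V G) ζ ξ := by
  have hF : ∀ χ : V, VectorField.mpullbackWithin 𝓘(ℝ, V) 𝓘(ℝ, V)
      (extChartAt 𝓘(ℝ, V) (1 : G)).symm
      (mulInvariantVectorField (I := 𝓘(ℝ, V)) (G := G) χ) (Set.range 𝓘(ℝ, V))
        =ᶠ[𝓝 (unitCoord V G)] fun y => leftInChart (1 : G) y χ := by
    intro χ
    filter_upwards [extChartAt_target_mem_nhds' (unitCoord_mem (V := V) (G := G))] with y hy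
    have hinv : (chartSymmD (1 : G) y).inverse =
        chartD V (1 : G) ((extChartAt 𝓘(ℝ, V) (1 : G)).symm y) :=
      ContinuousLinearMap.inverse_eq (by ext v; exact chartSymmD_chartD hy v)
        (by ext v; exact chartD_chartSymmD hy v)
    rw [VectorField.mpullbackWithin_apply, modelWithCornersSelf_coe, Set.range_id,
      mfderivWithin_univ]
    exact congrArg (fun L : V →L[ℝ] V => L (leftInv ((extChartAt 𝓘(ℝ, V) (1 : G)).symm y) χ)) hinv
  have hd : ∀ χ u : V, fderiv ℝ (fun y => leftInChart (1 : G) y χ) (unitCoord V G) u =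
      fderiv ℝ (leftInChart (V := V) (1 : G)) (unitCoord V G) u χ := by
    intro χ u
    rw [fderiv_clm_apply differentiableAt_leftInChart_unitCoord (by fun_prop)]
    simp
  have h : lieBracket G ξ ζ = VectorField.lieBracket ℝ (fun y => leftInChart (1 : G) y ξ)
      (fun y => leftInChart (1 : G) y ζ) (unitCoord V G) := by
    have e0 : lieBracket G ξ ζ = VectorField.mlieBracketWithin 𝓘(ℝ, V)
      (mulInvariantVectorField (I := 𝓘(ℝ, V)) (G := G) ξ)
      (mulInvariantVectorField (I := 𝓘(ℝ, V)) (G := G) ζ) Set.univ (1 : G) := rfl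
    rw [e0, VectorField.mlieBracketWithin_apply]
    have e1 : (chartD V (1 : G) 1).inverse = ContinuousLinearMap.id ℝ V := by
      rw [chartD_self, ContinuousLinearMap.inverse_id]
    refine (congrArg (fun L : V →L[ℝ] V => L _) e1).trans ?_
    rw [ContinuousLinearMap.id_apply, Set.preimage_univ, modelWithCornersSelf_coe, Set.range_id,
      Set.univ_inter]
    have hF' := hF
    rw [modelWithCornersSelf_coe, Set.range_id] at hF'
    exact (congrFun VectorField.lieBracketWithin_univ _).trans
      (Filter.EventuallyEq.lieBracket_vectorField_eq (hF' ξ) (hF' ζ))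
  rw [h, VectorField.lieBracket, hd, hd, leftInChart_unitCoord, leftInChart_unitCoord]

/-- The derivatives at the unit of the right- and left-invariant vector fields agree up to
exchanging the arguments: both are the mixed second derivative of the multiplication. -/
theorem fderiv_rightInChart (ξ ζ : V) :
    fderiv ℝ (rightInChart (V := V) (1 : G)) (unitCoord V G) ξ ζ =
      fderiv ℝ (leftInChart (V := V) (1 : G)) (unitCoord V G) ζ ξ := by
  set e := unitCoord V G
  have he : e ∈ (extChartAt 𝓘(ℝ, V) (1 : G)).target := unitCoord_mem
  have hH : ContDiffAt ℝ ∞ (mulInCharts (V := V) (1 : G) 1 1) (e, e) := by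
    refine contDiffAt_mulInCharts he he ?_
    rw [show ((e, e) : V × V).1 = unitCoord V G from rfl,
      show ((e, e) : V × V).2 = unitCoord V G from rfl, symm_unitCoord, mul_one]
    exact mem_extChartAt_source _
  have hd : DifferentiableAt ℝ (fderiv ℝ (mulInCharts (V := V) (1 : G) 1 1)) (e, e) :=
    (hH.fderiv_right (m := ∞) (by simp)).differentiableAt (by simp)
  have hsymm := (hH.isSymmSndFDerivAt minSmoothness_two_le_infty) (0, ξ) (ζ, 0)
  have hL : HasFDerivAt (leftInChart (V := V) (1 : G))
      (((ContinuousLinearMap.compL ℝ V (V × V) V).flip (ContinuousLinearMap.inr ℝ V V)).comp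
        ((fderiv ℝ (fderiv ℝ (mulInCharts (V := V) (1 : G) 1 1)) (e, e)).comp
          (ContinuousLinearMap.inl ℝ V V))) e := by
    refine HasFDerivAt.congr_of_eventuallyEq ?_
      (Filter.eventually_of_mem (extChartAt_target_mem_nhds' he) fun y hy => leftInChart_eq hy)
    exact (((ContinuousLinearMap.compL ℝ V (V × V) V).flip
      (ContinuousLinearMap.inr ℝ V V)).hasFDerivAt).comp e
      (HasFDerivAt.comp (f := fun t : V => (t, e)) e hd.hasFDerivAt (hasFDerivAt_prodMk_left e e))
  have hR : HasFDerivAt (rightInChart (V := V) (1 : G))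
      (((ContinuousLinearMap.compL ℝ V (V × V) V).flip (ContinuousLinearMap.inl ℝ V V)).comp
        ((fderiv ℝ (fderiv ℝ (mulInCharts (V := V) (1 : G) 1 1)) (e, e)).comp
          (ContinuousLinearMap.inr ℝ V V))) e := by
    refine HasFDerivAt.congr_of_eventuallyEq ?_
      (Filter.eventually_of_mem (extChartAt_target_mem_nhds' he) fun y hy => rightInChart_eq hy)
    exact (((ContinuousLinearMap.compL ℝ V (V × V) V).flip
      (ContinuousLinearMap.inl ℝ V V)).hasFDerivAt).comp e
      (HasFDerivAt.comp (f := fun t : V => (e, t)) e hd.hasFDerivAt (hasFDerivAt_prodMk_right e e))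
  rw [hL.fderiv, hR.fderiv]
  exact hsymm

theorem lieBracket_comm (ξ ζ : V) : lieBracket G ξ ζ = -lieBracket G ζ ξ := by
  rw [lieBracket_eq_fderiv, lieBracket_eq_fderiv, neg_sub]

variable (G) in
/-- The Lie bracket as a bilinear map. -/
def lieBracketL : V →L[ℝ] V →L[ℝ] V :=
  fderiv ℝ (leftInChart (V := V) (1 : G)) (unitCoord V G) -
    (fderiv ℝ (leftInChart (V := V) (1 : G)) (unitCoord V G)).flip

theorem lieBracketL_apply (ξ ζ : V) : lieBracketL G ξ ζ = lieBracket G ξ ζ := by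
  rw [lieBracket_eq_fderiv]; rfl

variable [CompleteSpace V]

/-- The derivative of the adjoint action at the unit is the bracket: differentiate
`ζᴸ = (Ad ζ)ᴿ` at the unit. -/
theorem hasMFDerivAt_Ad (ζ : V) : HasMFDerivAt 𝓘(ℝ, V) 𝓘(ℝ, V) (fun x : G => Ad x ζ) 1
    ((lieBracketL G).flip ζ : V →L[ℝ] V) := by
  let f : V → V := fun y => thetaRInChart (1 : G) y (leftInChart (1 : G) y ζ)
  have hT := (contDiffAt_thetaRInChart (unitCoord_mem (V := V) (G := G))).differentiableAt
    (by simp)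
  have hR := (contDiffAt_rightInChart (unitCoord_mem (V := V) (G := G))).differentiableAt
    (by simp)
  have hL := differentiableAt_leftInChart_unitCoord (V := V) (G := G)
  have hf : DifferentiableAt ℝ f (unitCoord V G) :=
    hT.clm_apply (hL.clm_apply (differentiableAt_const ζ))
  have hfe : f (unitCoord V G) = ζ := by
    have := thetaRInChart_rightInChart (unitCoord_mem (V := V) (G := G)) ζ
    rw [rightInChart_unitCoord] at this
    simp only [f, leftInChart_unitCoord, this]
  have hRf : (fun y => rightInChart (1 : G) y (f y)) =ᶠ[𝓝 (unitCoord V G)]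
      fun y => leftInChart (1 : G) y ζ := by
    filter_upwards [extChartAt_target_mem_nhds' (unitCoord_mem (V := V) (G := G))] with y hy
      using rightInChart_thetaRInChart hy _
  have hfd : fderiv ℝ f (unitCoord V G) = (lieBracketL G).flip ζ := by
    ext ξ
    have h := congrArg (fun L : V →L[ℝ] V => L ξ) hRf.fderiv_eq
    simp only [fderiv_clm_apply hR hf, fderiv_clm_apply hL (differentiableAt_const ζ)] at h
    simp only [add_apply, ContinuousLinearMap.comp_apply, ContinuousLinearMap.flip_apply,
      rightInChart_unitCoord, hfe, fderiv_rightInChart, fderiv_fun_const, Pi.zero_apply,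
      zero_apply, map_zero, zero_add] at h
    rw [ContinuousLinearMap.flip_apply, lieBracketL_apply, lieBracket_eq_fderiv, ← h]
    abel
  have hev : (fun x : G => Ad x ζ) =ᶠ[𝓝 1] fun x => f (extChartAt 𝓘(ℝ, V) (1 : G) x) := by
    filter_upwards [extChartAt_source_mem_nhds (I := 𝓘(ℝ, V)) (1 : G)] with x hx
    have hy := (extChartAt 𝓘(ℝ, V) (1 : G)).map_source hx
    have hxx := (extChartAt 𝓘(ℝ, V) (1 : G)).left_inv hx
    have := congrArg (thetaR x) (chartSymmD_chartD hy (leftInv x ζ))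
    rw [hxx] at this
    simp only [f, leftInChart, thetaRInChart, hxx]
    exact (this.trans (thetaR_leftInv x ζ)).symm
  refine HasMFDerivAt.congr_of_eventuallyEq ?_ hev
  have h1 : HasMFDerivAt 𝓘(ℝ, V) 𝓘(ℝ, V) (extChartAt 𝓘(ℝ, V) (1 : G)) 1
      (chartD V (1 : G) 1) :=
    ((contMDiffAt_extChartAt (I := 𝓘(ℝ, V)) (n := ∞) (x := (1 : G))).mdifferentiableAt
      (by simp)).hasMFDerivAt
  have h2 : HasMFDerivAt 𝓘(ℝ, V) 𝓘(ℝ, V) f (unitCoord V G)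
      ((lieBracketL G).flip ζ : V →L[ℝ] V) :=
    (hfd ▸ hf.hasFDerivAt).hasMFDerivAt
  have h3 := h2.comp (1 : G) h1
  rw [chartD_self] at h3
  exact h3

/-- The adjoint action is by Lie algebra automorphisms: differentiate
`Ad_{g x g⁻¹} Ad_g = Ad_g Ad_x` at `x = 1`. -/
theorem Ad_lieBracket (g : G) (ξ ζ : V) :
    Ad g (lieBracket G ξ ζ) = lieBracket G (Ad g ξ) (Ad g ζ) := by
  have hc : HasMFDerivAt 𝓘(ℝ, V) 𝓘(ℝ, V) (fun x : G => g * x * g⁻¹) 1 (Ad (V := V) g) :=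
    (mdifferentiableAt_conj g 1).hasMFDerivAt
  have h1g : g * 1 * g⁻¹ = 1 := by simp
  have h1 : HasMFDerivAt 𝓘(ℝ, V) 𝓘(ℝ, V) (fun x : G => Ad x (Ad g ζ)) (g * 1 * g⁻¹)
      ((lieBracketL G).flip (Ad g ζ) : V →L[ℝ] V) := by
    have := hasMFDerivAt_Ad (G := G) (Ad g ζ)
    rw [← h1g] at this
    exact this
  have h2 := h1.comp (1 : G) hc
  have h3 : HasMFDerivAt 𝓘(ℝ, V) 𝓘(ℝ, V) (fun x : G => Ad g (Ad x ζ)) 1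
      ((Ad (V := V) g).comp ((lieBracketL G).flip ζ) : V →L[ℝ] V) :=
    ((Ad (V := V) g).hasFDerivAt.hasMFDerivAt).comp (1 : G) (hasMFDerivAt_Ad (G := G) ζ)
  have he : (fun x : G => Ad x (Ad g ζ)) ∘ (fun x : G => g * x * g⁻¹) =
      fun x : G => Ad g (Ad x ζ) := by
    funext x
    simp only [Function.comp_apply, ← Ad_mul]
    simp
  rw [he] at h2
  have h := congrArg (fun L : V →L[ℝ] V => L ξ) (hasMFDerivAt_unique h3 h2)
  simpa only [lieBracketL_apply] using
    (show Ad g (lieBracketL G ξ ζ) = lieBracketL G (Ad g ξ) (Ad g ζ) from h)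

/-- The infinitesimal form of the invariance of `B`. -/
theorem IsInvariantInner.lieBracket_add [FiniteDimensional ℝ V] {B : LinearMap.BilinForm ℝ V}
    (hB : IsInvariantInner G B) (ξ ζ χ : V) :
    B (lieBracket G ξ ζ) χ + B ζ (lieBracket G ξ χ) = 0 := by
  let b : V →L[ℝ] V →L[ℝ] ℝ := LinearMap.toContinuousBilinearMap B
  have hb : ∀ x y, b x y = B x y := fun _ _ => rfl
  have h1 := hasMFDerivAt_Ad (G := G) ζ
  have h2 := hasMFDerivAt_Ad (G := G) χ
  have h3 : HasMFDerivAt 𝓘(ℝ, V × V) 𝓘(ℝ, ℝ) (fun p : V × V => b p.1 p.2)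
      (Ad (1 : G) ζ, Ad (1 : G) χ)
      (b.isBoundedBilinearMap.deriv (Ad (1 : G) ζ, Ad (1 : G) χ) : V × V →L[ℝ] ℝ) :=
    (b.isBoundedBilinearMap.hasFDerivAt _).hasMFDerivAt
  have h4 := HasMFDerivAt.comp (f := fun x : G => (Ad x ζ, Ad x χ)) (1 : G) h3
    (show HasMFDerivAt 𝓘(ℝ, V) 𝓘(ℝ, V × V) (fun x : G => (Ad x ζ, Ad x χ)) 1
      (((lieBracketL G).flip ζ).prod ((lieBracketL G).flip χ) : V →L[ℝ] V × V) from
      ⟨h1.1.prodMk h2.1, h1.2.prodMk h2.2⟩)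
  have he : (fun p : V × V => b p.1 p.2) ∘ (fun x : G => (Ad x ζ, Ad x χ)) = fun _ => B ζ χ :=
    funext fun x => hB.invariant x ζ χ
  rw [he] at h4
  have h5 := hasMFDerivAt_unique h4 (hasMFDerivAt_const (I := 𝓘(ℝ, V)) (B ζ χ) (1 : G))
  have h : b (Ad (1 : G) ζ) (lieBracketL G ξ χ) + b (lieBracketL G ξ ζ) (Ad (1 : G) χ) = 0 :=
    congrArg (fun L : V →L[ℝ] ℝ => L ξ) h5
  rw [Ad_one, Ad_one, hb, hb, lieBracketL_apply, lieBracketL_apply] at h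
  rw [add_comm, h]

end Bracket

/-! ### The exterior derivative of the GHJW form -/

section Forms

open Topology

variable {V : Type*} [NormedAddCommGroup V] [NormedSpace ℝ V]

theorem covWedge_covWedge_covWedge_apply (α β γ : V →L[ℝ] ℝ) (x y z : V) :
    covWedge α (covWedge β (covWedge γ
      (ContinuousAlternatingMap.constOfIsEmpty ℝ V (Fin 0) (1 : ℝ)))) ![x, y, z] =
      α x * (β y * γ z - β z * γ y) - α y * (β x * γ z - β z * γ x) +
        α z * (β x * γ y - β y * γ x) := by
  simp [covWedge_apply, Fin.sum_univ_succ, Fin.removeNth, Fin.succAbove]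
  ring

theorem sum_dualBasis_trilinear [FiniteDimensional ℝ V] (B : V →ₗ[ℝ] V →ₗ[ℝ] ℝ)
    (L : V →L[ℝ] V →L[ℝ] V) (x y z : V) :
    ∑ a, ∑ b, ∑ c, B (Module.finBasis ℝ V a) (L (Module.finBasis ℝ V b) (Module.finBasis ℝ V c)) *
      (dualBasis a x * (dualBasis b y * dualBasis c z)) = B x (L y z) := by
  conv_rhs => rw [← finBasis_repr_sum_dualBasis x, ← finBasis_repr_sum_dualBasis y,
    ← finBasis_repr_sum_dualBasis z]
  simp only [map_sum, map_smul, LinearMap.sum_apply, sum_apply, smul_apply, LinearMap.smul_apply,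
    smul_eq_mul, Finset.mul_sum]
  rw [Finset.sum_comm, Finset.sum_congr rfl fun b _ => Finset.sum_comm, Finset.sum_comm]
  refine Finset.sum_congr rfl fun c _ => Finset.sum_congr rfl fun b _ =>
    Finset.sum_congr rfl fun a _ => ?_
  ring

variable {G : Type*} [TopologicalSpace G] [ChartedSpace V G] [Group G] [LieGroup 𝓘(ℝ, V) ∞ G]

/-- In the left trivialization, the exterior derivative at the unit of the left-invariant 2-form
with value `b` is `b(u₀, [u₁, u₂])` summed over cyclic permutations. This is the Maurer-Cartan
equation. -/
theorem extDeriv_leftInvariant [CompleteSpace V] (b : V →L[ℝ] V →L[ℝ] ℝ)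
    (hb : ∀ u v, b u v = -b v u)
    {β : V → V [⋀^Fin 2]→L[ℝ] ℝ} (hβ : DifferentiableAt ℝ β (unitCoord V G))
    (h : ∀ᶠ y in 𝓝 (unitCoord V G), ∀ u v,
      β y ![u, v] = b (thetaLInChart (1 : G) y u) (thetaLInChart (1 : G) y v)) (u₀ u₁ u₂ : V) :
    extDeriv β (unitCoord V G) ![u₀, u₁, u₂] =
      b u₀ (lieBracket G u₁ u₂) + b u₁ (lieBracket G u₂ u₀) + b u₂ (lieBracket G u₀ u₁) := by
  have hT := (contDiffAt_thetaLInChart (unitCoord_mem (V := V) (G := G))).differentiableAt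
    (by simp)
  have hL := differentiableAt_leftInChart_unitCoord (V := V) (G := G)
  have hTv : ∀ v, DifferentiableAt ℝ (fun y => thetaLInChart (1 : G) y v) (unitCoord V G) :=
    fun v => hT.clm_apply (differentiableAt_const v)
  -- differentiating `Λ Θ = 1` expresses the derivative of `Θ` by that of `Λ`
  have hdT : ∀ u v, fderiv ℝ (fun y => thetaLInChart (1 : G) y v) (unitCoord V G) u =
      -fderiv ℝ (leftInChart (V := V) (1 : G)) (unitCoord V G) u v := by
    intro u v
    have he : (fun y => leftInChart (1 : G) y (thetaLInChart (1 : G) y v))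
        =ᶠ[𝓝 (unitCoord V G)] fun _ => v := by
      filter_upwards [extChartAt_target_mem_nhds' (unitCoord_mem (V := V) (G := G))] with y hy
        using leftInChart_thetaLInChart hy v
    have h1 := congrArg (fun L : V →L[ℝ] V => L u) he.fderiv_eq
    simp only [fderiv_clm_apply hL (hTv v)] at h1
    simp only [add_apply, ContinuousLinearMap.comp_apply, ContinuousLinearMap.flip_apply,
      leftInChart_unitCoord, thetaLInChart_unitCoord, fderiv_fun_const, Pi.zero_apply,
      zero_apply] at h1
    exact eq_neg_of_add_eq_zero_left h1
  have hd : ∀ u v w, fderiv ℝ (fun y => β y ![v, w]) (unitCoord V G) u =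
      -b (fderiv ℝ (leftInChart (V := V) (1 : G)) (unitCoord V G) u v) w -
        b v (fderiv ℝ (leftInChart (V := V) (1 : G)) (unitCoord V G) u w) := by
    intro u v w
    have he : (fun y => β y ![v, w]) =ᶠ[𝓝 (unitCoord V G)]
        fun y => b (thetaLInChart (1 : G) y v) (thetaLInChart (1 : G) y w) := by
      filter_upwards [h] with y hy using hy v w
    have hbv : DifferentiableAt ℝ (fun y => b (thetaLInChart (1 : G) y v)) (unitCoord V G) :=
      b.differentiableAt.comp _ (hTv v)
    have hbd : fderiv ℝ (fun y => b (thetaLInChart (1 : G) y v)) (unitCoord V G) =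
        b.comp (fderiv ℝ (fun y => thetaLInChart (1 : G) y v) (unitCoord V G)) :=
      (b.hasFDerivAt.comp _ (hTv v).hasFDerivAt).fderiv
    rw [he.fderiv_eq, fderiv_clm_apply hbv (hTv w)]
    simp only [add_apply, ContinuousLinearMap.comp_apply, ContinuousLinearMap.flip_apply, hbd,
      hdT, thetaLInChart_unitCoord, map_neg, neg_apply]
    ring
  rw [extDeriv_apply hβ, Fin.sum_univ_three]
  have r0 : (0 : Fin 3).removeNth ![u₀, u₁, u₂] = ![u₁, u₂] := by
    funext i; fin_cases i <;> rfl
  have r1 : (1 : Fin 3).removeNth ![u₀, u₁, u₂] = ![u₀, u₂] := by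
    funext i; fin_cases i <;> rfl
  have r2 : (2 : Fin 3).removeNth ![u₀, u₁, u₂] = ![u₀, u₁] := by
    funext i; fin_cases i <;> rfl
  rw [r0, r1, r2]
  simp only [hd, lieBracket_eq_fderiv, map_sub]
  set D := fderiv ℝ (leftInChart (V := V) (1 : G)) (unitCoord V G)
  change (-1 : ℤ) ^ 0 • (-b (D u₀ u₁) u₂ - b u₁ (D u₀ u₂)) +
    (-1 : ℤ) ^ 1 • (-b (D u₁ u₀) u₂ - b u₀ (D u₁ u₂)) +
    (-1 : ℤ) ^ 2 • (-b (D u₂ u₀) u₁ - b u₀ (D u₂ u₁)) = _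
  rw [hb (D u₀ u₁) u₂, hb (D u₁ u₀) u₂, hb (D u₂ u₀) u₁]
  simp only [zsmul_eq_mul]
  push_cast
  ring

variable {W : Type*} [NormedAddCommGroup W] [NormedSpace ℝ W]
  {C : Type*} [TopologicalSpace C] [ChartedSpace W C] {B : LinearMap.BilinForm ℝ V}

/-- The pullback of the GHJW form under the orbit map, in the left trivialization. -/
theorem IsGHJWForm.pullback_orbit (hB : IsInvariantInner G B) {g : G} {ι : C → G}
    (hι : ContMDiff 𝓘(ℝ, W) 𝓘(ℝ, V) ∞ ι) {τ : C → W [⋀^Fin 2]→L[ℝ] ℝ} (hτ : IsGHJWForm B ι τ)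
    {q : G → C} (hq : ∀ a, ι (q a) = a * g * a⁻¹) (hq' : ContMDiff 𝓘(ℝ, V) 𝓘(ℝ, W) ∞ q)
    (a : G) (u v : V) :
    pullback q τ a ![u, v] =
      (1 / 2 : ℝ) * B (Ad g⁻¹ (thetaL a u) - Ad g (thetaL a u)) (thetaL a v) := by
  have h := hτ (q a) (tangent q a u) (tangent q a v) _ _ (tangent_tangent_orbit hι hq hq' a u)
    (tangent_tangent_orbit hι hq hq' a v)
  have h1 : pullback q τ a ![u, v] = τ (q a) ![tangent q a u, tangent q a v] := by
    rw [pullback, ContinuousAlternatingMap.compContinuousLinearMap_apply]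
    congr 1; funext i; fin_cases i <;> rfl
  have h2 : (a * g * a⁻¹)⁻¹ = a * g⁻¹ * a⁻¹ := by group
  have h3 : Ad (a * g⁻¹ * a⁻¹) (-thetaR a u) - Ad (a * g * a⁻¹) (-thetaR a u) =
      -Ad a (Ad g⁻¹ (thetaL a u) - Ad g (thetaL a u)) := by
    simp only [thetaR_eq, Ad_mul, map_neg, Ad_inv_Ad, map_sub]
    abel
  rw [h1, h, hq, h2, h3, thetaR_eq, map_neg, map_neg (B : V →ₗ[ℝ] V →ₗ[ℝ] ℝ),
    LinearMap.neg_apply, neg_neg, hB.invariant]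

variable [FiniteDimensional ℝ V]

theorem IsInvariantInner.apply_lieBracket_cyclic (hB : IsInvariantInner G B) (x y z : V) :
    B x (lieBracket G y z) = B y (lieBracket G z x) := by
  have h := hB.lieBracket_add z x y
  rw [lieBracket_comm y z, map_neg, hB.apply_comm y]
  linarith

theorem IsInvariantInner.apply_lieBracket_Ad (hB : IsInvariantInner G B) (g : G) (x y z : V) :
    B (Ad g x) (lieBracket G (Ad g y) (Ad g z)) = B x (lieBracket G y z) := by
  rw [← Ad_lieBracket, hB.invariant]

theorem cartanForm_apply (hB : IsInvariantInner G B) (g : G) (x y z : V) :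
    cartanForm B g ![x, y, z] =
      (1 / 2 : ℝ) * B (thetaL g x) (lieBracket G (thetaL g y) (thetaL g z)) := by
  have key : ∀ X Y Z : V, ∑ a, ∑ b, ∑ c, B (Module.finBasis ℝ V a)
      (lieBracket G (Module.finBasis ℝ V b) (Module.finBasis ℝ V c)) *
      (dualBasis a X * (dualBasis b Y * dualBasis c Z)) = B X (lieBracket G Y Z) := by
    intro X Y Z
    have := sum_dualBasis_trilinear B (lieBracketL G) X Y Z
    simpa only [lieBracketL_apply] using this
  simp only [cartanForm, ContinuousAlternatingMap.smul_apply, ContinuousAlternatingMap.sum_apply,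
     covWedge_covWedge_covWedge_apply, smul_eq_mul,
    mul_add, mul_sub, Finset.sum_add_distrib, Finset.sum_sub_distrib,
    ContinuousLinearMap.comp_apply, key]
  set X := thetaL g x
  set Y := thetaL g y
  set Z := thetaL g z
  have h1 := hB.apply_lieBracket_cyclic X Y Z
  have h2 := hB.apply_lieBracket_cyclic Y Z X
  have h3 := hB.apply_lieBracket_cyclic X Z Y
  have h4 := hB.apply_lieBracket_cyclic Z Y X
  have h5 : B X (lieBracket G Z Y) = -B X (lieBracket G Y Z) := by
    rw [lieBracket_comm, map_neg]
  linarith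

/-- With `T(x, y, z) = B(x, [y, z])` and `A = Ad_g`, the invariance of `T` under `A` gives
`T((A⁻¹ - 1)x, (A⁻¹ - 1)y, (A⁻¹ - 1)z) = ∑ B((A⁻¹ - A)x, [y, z])`, summed over cyclic permutations. -/
theorem IsInvariantInner.apply_lieBracket_sub (hB : IsInvariantInner G B) (g : G) (x y z : V) :
    B (Ad g⁻¹ x - x) (lieBracket G (Ad g⁻¹ y - y) (Ad g⁻¹ z - z)) =
      B (Ad g⁻¹ x - Ad g x) (lieBracket G y z) + B (Ad g⁻¹ y - Ad g y) (lieBracket G z x) +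
        B (Ad g⁻¹ z - Ad g z) (lieBracket G x y) := by
  have h3 := hB.apply_lieBracket_Ad g⁻¹ x y z
  have h2 : ∀ x y z, B (Ad g⁻¹ x) (lieBracket G (Ad g⁻¹ y) z) = B x (lieBracket G y (Ad g z)) := by
    intro x y z
    rw [← hB.apply_lieBracket_Ad g⁻¹ x y, Ad_inv_Ad]
  have c1 := fun x y z => hB.apply_lieBracket_cyclic x y z
  simp only [← lieBracketL_apply, map_sub, LinearMap.sub_apply, sub_apply] at *
  have e1 := h2 x y z
  have e2 := h2 y z x
  have e3 := h2 z x y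
  linarith [c1 x (Ad g⁻¹ y) z, c1 (Ad g⁻¹ z) x y, c1 (Ad g z) x y, c1 (Ad g⁻¹ z) (Ad g⁻¹ x) y,
    c1 (Ad g y) z x, c1 x (Ad g⁻¹ y) (Ad g⁻¹ z), c1 (Ad g x) y z]

variable [IsManifold 𝓘(ℝ, W) ∞ C]

/-- The exterior derivative of the GHJW form at the image of the unit under the orbit map: the
pullback to `G` is left-invariant, and the pullback of `η` is found in the same trivialization. -/
theorem IsGHJWForm.extD_eq_orbit_one (hB : IsInvariantInner G B) {g : G} {ι : C → G}
    (hι : ContMDiff 𝓘(ℝ, W) 𝓘(ℝ, V) ∞ ι) {τ : C → W [⋀^Fin 2]→L[ℝ] ℝ} (hτ : IsGHJWForm B ι τ)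
    (hsm : SmoothFormOn τ Set.univ)
    {q : G → C} (hq : ∀ a, ι (q a) = a * g * a⁻¹) (hq' : ContMDiff 𝓘(ℝ, V) 𝓘(ℝ, W) ∞ q)
    (hsurj : Function.Surjective (tangent q (1 : G) : V →L[ℝ] W)) :
    extD τ (q 1) = pullback ι (cartanForm B) (q 1) := by
  have := FiniteDimensional.complete ℝ V
  have hq1 : ι (q 1) = g := by simp [hq]
  have he := unitCoord_mem (V := V) (G := G)
  let f : V → W := inCharts (V := W) q (1 : G) (q 1)
  have hsrc : q ((extChartAt 𝓘(ℝ, V) (1 : G)).symm (unitCoord V G)) ∈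
      (extChartAt 𝓘(ℝ, W) (q 1)).source := by
    rw [symm_unitCoord]; exact mem_extChartAt_source _
  have hf : ContDiffAt ℝ ∞ f (unitCoord V G) := contDiffAt_inCharts he hq'.contMDiffAt hsrc
  have hfe : f (unitCoord V G) = extChartAt 𝓘(ℝ, W) (q 1) (q 1) := by
    simp only [f, inCharts, symm_unitCoord]
  have hfd : fderiv ℝ f (unitCoord V G) = tangent q (1 : G) := by
    ext u
    rw [fderiv_inCharts he (hq'.mdifferentiableAt (by simp)) hsrc, chartSymmD_self,
      symm_unitCoord, chartD_self]
    rfl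
  let β : V → V [⋀^Fin 2]→L[ℝ] ℝ := fun y =>
    (formInChart τ (q 1) (f y)).compContinuousLinearMap (fderiv ℝ f y)
  let b : V →L[ℝ] V →L[ℝ] ℝ :=
    (1 / 2 : ℝ) • (LinearMap.toContinuousBilinearMap B).comp (Ad (V := V) g⁻¹ - Ad g)
  have hb : ∀ u v, b u v = (1 / 2 : ℝ) * B (Ad g⁻¹ u - Ad g u) v := fun _ _ => rfl
  have hbanti : ∀ u v, b u v = -b v u := by
    intro u v
    have h1 := hB.apply_Ad_left g u v
    have h2 := hB.apply_Ad_left g⁻¹ u v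
    rw [inv_inv] at h2
    rw [hb, hb, hB.apply_comm _ u]
    simp only [map_sub, LinearMap.sub_apply, h1, h2]
    ring
  have hβ : ∀ᶠ y in 𝓝 (unitCoord V G), ∀ u v,
      β y ![u, v] = b (thetaLInChart (1 : G) y u) (thetaLInChart (1 : G) y v) := by
    filter_upwards [eventually_mem_source he hq'.continuous.continuousAt
      (isOpen_extChartAt_source (I := 𝓘(ℝ, W)) (q 1)) hsrc] with y hy u v
    have hfy : (extChartAt 𝓘(ℝ, W) (q 1)).symm (f y) = q ((extChartAt 𝓘(ℝ, V) (1 : G)).symm y) :=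
      (extChartAt 𝓘(ℝ, W) (q 1)).left_inv hy.2
    have hfyt : f y ∈ (extChartAt 𝓘(ℝ, W) (q 1)).target :=
      (extChartAt 𝓘(ℝ, W) (q 1)).map_source hy.2
    have hcomp : ∀ u, chartSymmD (q 1) (f y) (fderiv ℝ f y u) =
        tangent q ((extChartAt 𝓘(ℝ, V) (1 : G)).symm y) (chartSymmD (1 : G) y u) := by
      intro u
      rw [fderiv_inCharts hy.1 (hq'.mdifferentiableAt (by simp)) hy.2, ← hfy]
      exact chartSymmD_chartD hfyt _
    have h1 : β y ![u, v] = pullback q τ ((extChartAt 𝓘(ℝ, V) (1 : G)).symm y)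
        ![chartSymmD (1 : G) y u, chartSymmD (1 : G) y v] := by
      simp only [β, formInChart, pullback,
        ContinuousAlternatingMap.compContinuousLinearMap_apply, hfy]
      congr 1
      funext i
      fin_cases i
      · exact hcomp u
      · exact hcomp v
    rw [h1, hτ.pullback_orbit hB hι hq hq', hb]
    rfl
  have hT := contDiffAt_thetaLInChart he
  have hβd : DifferentiableAt ℝ β (unitCoord V G) := by
    refine ContDiffAt.differentiableAt (n := ∞)
      (contDiffAt_continuousAlternatingMap_of_apply fun v => ?_) (by simp)
    have h1 : ContDiffAt ℝ ∞ (fun y => b (thetaLInChart (1 : G) y (v 0))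
        (thetaLInChart (1 : G) y (v 1))) (unitCoord V G) := by fun_prop
    refine h1.congr_of_eventuallyEq ?_
    filter_upwards [hβ] with y hy
    rw [← hy, show ![v 0, v 1] = v from by funext i; fin_cases i <;> rfl]
  have hd : extDeriv β (unitCoord V G) = (extD τ (q 1)).compContinuousLinearMap
      (tangent q (1 : G) : V →L[ℝ] W) := by
    rw [extD_eq_extDeriv, ← hfd, ← hfe]
    refine extDeriv_pullback ?_ hf minSmoothness_two_le_infty
    rw [hfe]
    refine ((hsm (q 1)).contDiffAt ?_).differentiableAt (by simp)
    exact (isOpen_chartDomain _ isOpen_univ).mem_nhds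
      ⟨mem_extChartAt_target _, Set.mem_univ _⟩
  ext w
  choose u hu using hsurj
  have hw : w = fun i => (tangent q (1 : G) : V →L[ℝ] W) (![u (w 0), u (w 1), u (w 2)] i) := by
    funext i
    fin_cases i <;> exact (hu _).symm
  have hR : ∀ v : V, thetaR (1 : G) v = v := by
    intro v
    conv_lhs => rw [← rightInv_one (G := G) v]
    exact thetaR_rightInv _ _
  have hθ : ∀ v : V, thetaL (ι (q 1)) ((tangent ι (q 1) : W →L[ℝ] V)
      ((tangent q (1 : G) : V →L[ℝ] W) v)) = Ad g⁻¹ v - v := by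
    intro v
    rw [tangent_tangent_orbit hι hq hq', thetaL_sharp, hR, hq1, map_neg]
    abel
  have hl : extD τ (q 1) w = extDeriv β (unitCoord V G) ![u (w 0), u (w 1), u (w 2)] := by
    rw [hd, ContinuousAlternatingMap.compContinuousLinearMap_apply]
    exact congrArg _ hw
  have hr : pullback ι (cartanForm B) (q 1) w = cartanForm B (ι (q 1))
      ![(tangent ι (q 1) : W →L[ℝ] V) (w 0), (tangent ι (q 1) : W →L[ℝ] V) (w 1),
        (tangent ι (q 1) : W →L[ℝ] V) (w 2)] := by
    rw [pullback, ContinuousAlternatingMap.compContinuousLinearMap_apply]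
    congr 1; funext i; fin_cases i <;> rfl
  rw [hl, hr, extDeriv_leftInvariant b hbanti hβd hβ, cartanForm_apply hB, ← hu (w 0), ← hu (w 1),
    ← hu (w 2), hθ, hθ, hθ, hB.apply_lieBracket_sub]
  simp only [hb, hu]
  ring

/-- The GHJW form on a conjugacy class is a primitive of the pullback of the Cartan 3-form. Every
point of the class is the image of the unit under a suitable orbit map. -/
theorem IsGHJWForm.extD_eq (hB : IsInvariantInner G B) {g₀ : G} {ι : C → G}
    (hι : IsConjugacyClass V W g₀ ι) {τ : C → W [⋀^Fin 2]→L[ℝ] ℝ} (hτ : IsGHJWForm B ι τ)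
    (hsm : SmoothFormOn τ Set.univ) : extD τ = pullback ι (cartanForm B) := by
  funext c
  obtain ⟨q, hq, hq', hsurj⟩ := hι.orbit
  obtain ⟨a, rfl⟩ := hι.exists_eq hq c
  have h := hτ.extD_eq_orbit_one hB hι.smooth hsm (g := a * g₀ * a⁻¹) (q := fun x => q (x * a))
    (fun x => by simp [hq, mul_assoc])
    (hq'.comp (contMDiff_mul_right (I := 𝓘(ℝ, V)) (n := ∞) (a := a))) ?_
  · rwa [one_mul] at h
  · have hc := tangent_comp (M := G) (S := G) (N := C) (x := (1 : G)) (g := q) (f := fun x => x * a)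
      (hq'.mdifferentiableAt (by simp)) (mdifferentiableAt_mul_right a 1)
    rw [hc]
    refine (hsurj _).comp fun v => ⟨thetaR a v, rightInv_thetaR a v⟩

/-- The GHJW form is smooth, because the Cartan-Dirac structure is spanned by smooth sections. -/
theorem IsGHJWForm.smooth [FiniteDimensional ℝ W] (hB : IsInvariantInner G B) {g₀ : G} {ι : C → G}
    (hι : IsConjugacyClass V W g₀ ι) {τ : C → W [⋀^Fin 2]→L[ℝ] ℝ} (hτ : IsGHJWForm B ι τ) :
    SmoothFormOn τ Set.univ :=
  ((hB.isGHJWForm_iff hι τ).1 hτ).smooth (hι.isIntegralManifold B) fun _ =>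
    ⟨Set.univ, isOpen_univ, Set.mem_univ _, _, fun i g => cartanDiracMap B g (Module.finBasis ℝ V i),
      fun _ => smoothSectionOn_cartanDiracMap B _, fun g _ => cartanDirac_eq_span_basis B g⟩

end Forms

end DiracGeometry

end

open DiracGeometry in
theorem mainTheorem4 :
    -- the 2-forms on the integral manifolds (leaves) of a Dirac structure
    (∀ (V : Type u₁) [NormedAddCommGroup V] [NormedSpace ℝ V] [FiniteDimensional ℝ V]
      (M : Type u₂) [TopologicalSpace M] [ChartedSpace V M] [IsManifold 𝓘(ℝ, V) ∞ M]
      (E : M → Submodule ℝ (V × (V →L[ℝ] ℝ))) (η : M → V [⋀^Fin 3]→L[ℝ] ℝ),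
      IsDirac E η →
      ∀ (W : Type u₃) [NormedAddCommGroup W] [NormedSpace ℝ W] [FiniteDimensional ℝ W]
        (S : Type u₄) [TopologicalSpace S] [ChartedSpace W S] [IsManifold 𝓘(ℝ, W) ∞ S]
        (ι : S → M), IsIntegralManifold W E ι →
        (∃! τ : S → W [⋀^Fin 2]→L[ℝ] ℝ, IsInducedForm E ι τ) ∧
        ∀ τ : S → W [⋀^Fin 2]→L[ℝ] ℝ, IsInducedForm E ι τ →
          SmoothFormOn τ Set.univ ∧ extD τ = pullback ι η) ∧
    -- the GHJW 2-forms on the conjugacy classes of a Lie group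
    (∀ (V : Type u₁) [NormedAddCommGroup V] [NormedSpace ℝ V] [FiniteDimensional ℝ V]
      (G : Type u₂) [TopologicalSpace G] [ChartedSpace V G] [Group G] [LieGroup 𝓘(ℝ, V) ∞ G]
      (B : LinearMap.BilinForm ℝ V), IsInvariantInner G B →
      ∀ (W : Type u₃) [NormedAddCommGroup W] [NormedSpace ℝ W] [FiniteDimensional ℝ W]
        (C : Type u₄) [TopologicalSpace C] [ChartedSpace W C] [IsManifold 𝓘(ℝ, W) ∞ C]
        (g₀ : G) (ι : C → G), IsConjugacyClass V W g₀ ι →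
        (∃! τ : C → W [⋀^Fin 2]→L[ℝ] ℝ, IsGHJWForm B ι τ) ∧
        ∀ τ : C → W [⋀^Fin 2]→L[ℝ] ℝ, IsGHJWForm B ι τ →
          SmoothFormOn τ Set.univ ∧ IsInducedForm (cartanDirac B) ι τ ∧
            extD τ = pullback ι (cartanForm B)) := by
  refine ⟨?_, ?_⟩
  · intro V _ _ _ M _ _ _ E η hE W _ _ _ S _ _ _ ι hι
    exact ⟨existsUnique_isInducedForm
      (fun x w hw w' hw' => (hE.almostDirac.lagrangian x w).1 hw w' hw') hι,
      fun τ hτ => ⟨hτ.smooth hι fun x₀ => by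
        obtain ⟨U, hU, hx, w, hw, hspan⟩ := hE.almostDirac.smooth x₀
        exact ⟨U, hU, hx, _, w, hw, fun x hx => (hspan x hx).2⟩, hτ.extD_eq hι hE⟩⟩
  · intro V _ _ _ G _ _ _ _ B hB W _ _ _ C _ _ _ g₀ ι hι
    refine ⟨?_, fun τ hτ => ?_⟩
    · obtain ⟨τ, hτ, huniq⟩ := existsUnique_isInducedForm hB.isotropic (hι.isIntegralManifold B)
      exact ⟨τ, (hB.isGHJWForm_iff hι τ).2 hτ,
        fun σ hσ => huniq σ ((hB.isGHJWForm_iff hι σ).1 hσ)⟩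
    · have hsm := IsGHJWForm.smooth hB hι hτ
      exact ⟨hsm, (hB.isGHJWForm_iff hι τ).1 hτ, hτ.extD_eq hB hι hsm⟩
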